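/- **Model.** The word RAM with word length $w$ has finitely many registers, a random access memory (initially filled with zeros) whose cells and addresses are $w$-bit words, and a read-only array that holds the current request. Its unit-cost instructions are: loading a constant, $+,-,\cdot$ modulo $2^w$ and division rounded down, indirect load and store, reading an entry of the request, jumps, and jumps conditional on $<$ or $=$ between two registers. Only the memory persists between requests. Every request lists its kind, $n$, $f$, and the vertices it concerns; a hyperedge is presented as the increasing list of its vertices. **Problem.** Let $V=\{0,\dots,n-1\}$ and let $E$ be a set of hyperedges, i.e. of nonempty subsets of $V$ with at most $f$ elements. Initially $E=\emptyset$; each update inserts a hyperedge that is not in $E$ or deletes a hyperedge of $E$. A fractional matching is an $x\colon E\to\mathbb{R}_{\ge 0}$ with $\sum_{e\in E,\,v\in e}x(e)\le 1$ for all $v\in V$; its size is $\sum_{e\in E}x(e)$. A vertex cover is a set $S\subseteq V$ that meets every $e\in E$. A fractional matching is $c$-approximate if no fractional matching has more than $c$ times its size; a vertex cover is $c$-approximate if its cardinality is at most $c$ times that of every vertex cover. **Theorem.** There are a single (deterministic) word RAM program and an absolute constant $C$ such that the following holds for all $n\ge 0$, $f\ge 1$ and every sequence of $T$ updates as above, starting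 from $E=\emptyset$ and revealed one at a time. Let $m$ be the number of distinct hyperedges that occur in the sequence, and let the word length $w$ satisfy $w\ge C\log_2(n+f+m+1)$. Then, without any preprocessing, the program handles the $T$ updates in at most $C f^2\,T$ steps altogether (amortized update time $O(f^2)$), and afterwards its memory represents a $Cf^3$-approximate maximum fractional matching $x$ and a $Cf^3$-approximate minimum vertex cover $S$ of the current hypergraph $(V,E)$: without changing the memory, the program answers the query whether $v\in S$ in at most $C$ steps, for every $v\in V$, and the query for $x(e)$ (as numerator and denominator) in at most $Cf$ steps, for every $e\in E$. Since this holds for every sequence, it holds after every update. In particular, for graphs ($f=2$) this gives an $O(1)$-approximate maximum fractional matching and an $O(1)$-approximate minimum vertex cover in $O(1)$ amortized update time. -/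

import Mathlib

namespace DynHypergraph

/-! ### Hypergraphs, fractional matchings, vertex covers

A hypergraph on the vertex set `Fin n` is its finite set of hyperedges `E`. -/

section Combinatorics

variable {n : ℕ}

/-- `x` assigns nonnegative weights to the hyperedges of `E` so that every vertex receives total
weight at most `1`. (Values of `x` outside `E` are irrelevant.) -/
def IsFractionalMatching (E : Finset (Finset (Fin n))) (x : Finset (Fin n) → ℝ) : Prop :=
  (∀ e ∈ E, 0 ≤ x e) ∧ ∀ v : Fin n, ∑ e ∈ E with v ∈ e, x e ≤ 1

/-- `x` is a fractional matching whose size is at least `1 / c` times the size of every fractional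
matching. -/
def IsApproxMaxFractionalMatching (c : ℝ) (E : Finset (Finset (Fin n)))
    (x : Finset (Fin n) → ℝ) : Prop :=
  IsFractionalMatching E x ∧
    ∀ y : Finset (Fin n) → ℝ, IsFractionalMatching E y → ∑ e ∈ E, y e ≤ c * ∑ e ∈ E, x e

/-- `S` meets every hyperedge of `E`. -/
def IsVertexCover (E : Finset (Finset (Fin n))) (S : Finset (Fin n)) : Prop :=
  ∀ e ∈ E, ∃ v ∈ e, v ∈ S

/-- `S` is a vertex cover whose size is at most `c` times the size of every vertex cover. -/
def IsApproxMinVertexCover (c : ℝ) (E : Finset (Finset (Fin n))) (S : Finset (Fin n)) : Prop :=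
  IsVertexCover E S ∧
    ∀ S' : Finset (Fin n), IsVertexCover E S' → (S.card : ℝ) ≤ c * (S'.card : ℝ)

/-! ### Fully dynamic update sequences -/

/-- An update: the insertion or the deletion of one hyperedge. -/
inductive Update (n : ℕ) where
  | insert (e : Finset (Fin n))
  | delete (e : Finset (Fin n))

/-- The hyperedge an update is about. -/
def Update.edge : Update n → Finset (Fin n)
  | .insert e => e
  | .delete e => e

/-- `Evolves f us E`: starting from the hypergraph without hyperedges, `us` is a sequence of
updates, each of which inserts a new hyperedge with at least one and at most `f` vertices or
deletes a hyperedge that is present, and `E` is the set of hyperedges after these updates. -/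
inductive Evolves (f : ℕ) : List (Update n) → Finset (Finset (Fin n)) → Prop where
  | nil : Evolves f [] ∅
  | insert {us : List (Update n)} {E : Finset (Finset (Fin n))} {e : Finset (Fin n)} :
      Evolves f us E → e.Nonempty → e.card ≤ f → e ∉ E →
      Evolves f (us ++ [.insert e]) (insert e E)
  | delete {us : List (Update n)} {E : Finset (Finset (Fin n))} {e : Finset (Fin n)} :
      Evolves f us E → e ∈ E → Evolves f (us ++ [.delete e]) (E.erase e)

/-- The set of distinct hyperedges that occur in a sequence of updates. -/
def edgesOccurring (us : List (Update n)) : Finset (Finset (Fin n)) :=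
  (us.map Update.edge).toFinset

end Combinatorics

/-! ### The word RAM

A word is a natural number below `2 ^ w`. The machine has registers, a random access memory whose
cells are addressed by words, and a read-only array that holds the current request. A program is
a finite list of instructions and so mentions only finitely many registers. Every instruction
costs one unit of time. -/

/-- Arithmetic operations on words. -/
inductive Op where
  | add | sub | mul | div

/-- Arithmetic modulo `2 ^ w` (`div` is rounded down, and division by `0` gives `0`);
`a` and `b` are words. -/
def Op.eval (w : ℕ) (o : Op) (a b : ℕ) : ℕ :=
  match o with
  | .add => (a + b) % 2 ^ w
  | .sub => (a + (2 ^ w - b)) % 2 ^ w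
  | .mul => (a * b) % 2 ^ w
  | .div => a / b

/-- Instructions; `d`, `a`, `b` are register numbers and `l` is a position in the program. -/
inductive Instr where
  /-- register `d` becomes the constant `k` -/
  | const (d k : ℕ)
  /-- register `d` becomes the result of `o` on the registers `a` and `b` -/
  | op (o : Op) (d a b : ℕ)
  /-- register `d` becomes the memory cell whose address is in register `a` -/
  | load (d a : ℕ)
  /-- the memory cell whose address is in register `a` becomes the content of register `b` -/
  | store (a b : ℕ)
  /-- register `d` becomes the entry of the request whose index is in register `a` -/
  | read (d a : ℕ)
  /-- continue at `l` -/
  | jump (l : ℕ)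
  /-- continue at `l` if register `a` is less than register `b` -/
  | jumpLt (a b l : ℕ)
  /-- continue at `l` if register `a` is equal to register `b` -/
  | jumpEq (a b l : ℕ)
  /-- stop -/
  | halt

/-- A program. -/
abbrev Program := List Instr

/-- The contents of the memory. -/
abbrev Mem := ℕ → ℕ

/-- A configuration of the machine. -/
structure Config where
  pc : ℕ
  reg : ℕ → ℕ
  mem : Mem

/-- One step of the machine with word length `w` on the request `inp`; the result is `none` if the
machine has stopped, by `halt` or because the program counter has left the program. -/
def step (w : ℕ) (P : Program) (inp : List ℕ) (c : Config) : Option Config :=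
  match P[c.pc]? with
  | none => none
  | some i =>
    match i with
    | .const d k => some ⟨c.pc + 1, Function.update c.reg d (k % 2 ^ w), c.mem⟩
    | .op o d a b =>
        some ⟨c.pc + 1, Function.update c.reg d (o.eval w (c.reg a) (c.reg b)), c.mem⟩
    | .load d a => some ⟨c.pc + 1, Function.update c.reg d (c.mem (c.reg a)), c.mem⟩
    | .store a b => some ⟨c.pc + 1, c.reg, Function.update c.mem (c.reg a) (c.reg b)⟩
    | .read d a =>
        some ⟨c.pc + 1, Function.update c.reg d (inp.getD (c.reg a) 0 % 2 ^ w), c.mem⟩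
    | .jump l => some ⟨l, c.reg, c.mem⟩
    | .jumpLt a b l => some ⟨if c.reg a < c.reg b then l else c.pc + 1, c.reg, c.mem⟩
    | .jumpEq a b l => some ⟨if c.reg a = c.reg b then l else c.pc + 1, c.reg, c.mem⟩
    | .halt => none

/-- `Runs w P inp c t c'`: started in `c`, the machine stops after exactly `t` steps, in `c'`. -/
inductive Runs (w : ℕ) (P : Program) (inp : List ℕ) : Config → ℕ → Config → Prop where
  | halted {c : Config} : step w P inp c = none → Runs w P inp c 0 c
  | step {c c' c'' : Config} {t : ℕ} :
      step w P inp c = some c' → Runs w P inp c' t c'' → Runs w P inp c (t + 1) c''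

/-- Every request starts at the first instruction with all registers `0`; only the memory persists
between requests. -/
def start (M : Mem) : Config := ⟨0, fun _ => 0, M⟩

/-! ### Dynamic algorithms on the word RAM -/

section Algorithms

variable {n : ℕ}

/-- A request: its kind, the number of vertices, the bound `f` on the size of the hyperedges, the
number of vertices listed, and the list itself. -/
def request (kind n f : ℕ) (l : List (Fin n)) : List ℕ :=
  [kind, n, f, l.length] ++ l.map Fin.val

/-- A hyperedge is presented as the increasing list of its vertices. -/
def edgeList (e : Finset (Fin n)) : List (Fin n) := e.sort (· ≤ ·)

/-- Requests of kind `0` are insertions and those of kind `1` are deletions. -/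
def Update.request (f : ℕ) : Update n → List ℕ
  | .insert e => DynHypergraph.request 0 n f (edgeList e)
  | .delete e => DynHypergraph.request 1 n f (edgeList e)

/-- The request of kind `2` that asks whether `v` belongs to the vertex cover. -/
def coverQuery (f : ℕ) (v : Fin n) : List ℕ := request 2 n f [v]

/-- The request of kind `3` that asks for the weight of `e` in the fractional matching. -/
def weightQuery (f : ℕ) (e : Finset (Fin n)) : List ℕ := request 3 n f (edgeList e)

/-- `Processes w P f us M t`: from a memory filled with zeros, `P` handles the updates `us` one
after the other (each update becomes known only when the previous one has been handled) in `t`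
steps altogether, and leaves the memory `M`. -/
inductive Processes (w : ℕ) (P : Program) (f : ℕ) : List (Update n) → Mem → ℕ → Prop where
  | nil : Processes w P f [] (fun _ => 0) 0
  | snoc {us : List (Update n)} {u : Update n} {M : Mem} {t s : ℕ} {c : Config} :
      Processes w P f us M t → Runs w P (u.request f) (start M) s c →
      Processes w P f (us ++ [u]) c.mem (t + s)

/-- The memory `M` represents the vertex set `S`: for every vertex `v`, the query whether `v ∈ S`
is answered in at most `q` steps, without a change of the memory, by register `0` being nonzero
or zero. -/
def RepresentsCover (w : ℕ) (P : Program) (f q : ℕ) (M : Mem) (S : Finset (Fin n)) : Prop :=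
  ∀ v : Fin n, ∃ (s : ℕ) (c : Config), Runs w P (coverQuery f v) (start M) s c ∧ s ≤ q ∧
    c.mem = M ∧ (c.reg 0 ≠ 0 ↔ v ∈ S)

/-- The memory `M` represents the weights `x` on the hyperedges in `E`: for every `e ∈ E`, the
query for `x e` is answered in at most `q` steps, without a change of the memory, by the numerator
and the denominator of a fraction in the registers `0` and `1`. -/
def RepresentsWeights (w : ℕ) (P : Program) (f q : ℕ) (M : Mem) (E : Finset (Finset (Fin n)))
    (x : Finset (Fin n) → ℝ) : Prop :=
  ∀ e ∈ E, ∃ (s : ℕ) (c : Config), Runs w P (weightQuery f e) (start M) s c ∧ s ≤ q ∧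
    c.mem = M ∧ c.reg 1 ≠ 0 ∧ x e = (c.reg 0 : ℝ) / (c.reg 1 : ℝ)

end Algorithms

end DynHypergraph

namespace DynHypergraph

/-! ### A structured language compiled to the word RAM -/

/-! Every vertex carries a level and every present hyperedge has as its level the maximum of the
levels of its vertices; all levels are powers of two. A hyperedge of level `p` has weight `1 / p`,
and the load of a vertex is the total weight of its hyperedges. A vertex whose load reaches 2 is
raised: its level doubles, and its hyperedges of the old level follow. A vertex of level above 1
whose load falls below about `1 / (128 f²)` is lowered: its level is halved, and the levels of its
hyperedges are recomputed. A raise takes precedence over a lowering, and this goes on until no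
vertex qualifies.

In such a stable state all loads are below 2, so the halved weights form a fractional matching. The
vertices whose load reaches the lower threshold form a cover: each hyperedge has a vertex of its own
level, and if that vertex were light, both levels would be 1 and the hyperedge alone would give it
load 1. Summing loads over the cover, where each hyperedge is counted at most `f` times, bounds the
cover by `512 f³` times the size of the matching; by weak duality this single inequality yields both
approximation guarantees (`approx_of_card_le`, `Represents.approx`).

The time is paid by a potential. For a vertex of level `p` it consists of `64000 f · max(0, 2 *
excess - p)` and, if `p > 1`, of `16000 · p · max(0, 1 - load)`, where `excess` is the least number
of hyperedges whose omission brings the load down to 1. At a raise each weight is at most `1 / p`,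
so `excess ≥ p` and the first term drops by `64000 f p`, while at most `3p` hyperedges move
(`raiseVertex_spec`). A lowering from `2q` to `q` releases at least `8000 q` of the second term,
while at most `q / (64 f²)` hyperedges are examined (`lowerVertex_spec`). One change of weight
affects at most `f` vertices; it costs at most `16000 f` if the weight falls, and at most `128000
f²` if it grows, because `excess` then rises by at most 1 per vertex. Hence an update costs `O(f²)`
amortized.

On the machine, hyperedges are nodes of a trie, whose parent pointers also enumerate their vertices.
Loads are stored as multiples of `2 ^ (w - 4)`, exactly, since every level divides this unit. For
each vertex and level the hyperedges are kept in an array with back pointers, which gives constant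
time insertion and removal. Everything is encoded so that zero memory is the empty structure, so no
preprocessing is needed. The routines are written in a small structured language with a timed big
step semantics; `Exec.simulate` transfers its results to the machine, and the routines are verified
by weakest preconditions. -/

/-- The address of the cell `(a, b)` of the table `g < 16`. -/
def loc (g a b : ℕ) : ℕ := (a + (a + b) * (a + b)) * 16 + g

/-- With `s = a + b`, the value lies between `s²` and `(s + 1)² - 1`, so it determines `s`, and then
`a`. This makes one linear memory serve as several two-dimensional tables. -/
theorem add_sq_inj {a b a' b' : ℕ} (h : a + (a + b) * (a + b) = a' + (a' + b') * (a' + b')) :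
    a = a' ∧ b = b' := by
  have h1 : a + b = a' + b' := by
    rcases lt_trichotomy (a + b) (a' + b') with h2 | h2 | h2
    · nlinarith
    · exact h2
    · nlinarith
  rw [h1] at h
  omega

theorem loc_inj {g a b g' a' b' : ℕ} (hg : g < 16) (hg' : g' < 16) :
    loc g a b = loc g' a' b' ↔ g = g' ∧ a = a' ∧ b = b' := by
  constructor
  · intro h
    unfold loc at h
    have h1 : g = g' := by omega
    have h2 : a + (a + b) * (a + b) = a' + (a' + b') * (a' + b') := by omega
    exact ⟨h1, add_sq_inj h2⟩
  · rintro ⟨rfl, rfl, rfl⟩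
    rfl

theorem loc_lt {g a b Y w : ℕ} (hg : g < 16) (ha : a ≤ Y) (hb : b ≤ Y)
    (hY : 64 * Y ^ 2 + 16 * Y + 16 ≤ 2 ^ w) : loc g a b < 2 ^ w := by
  unfold loc
  have : (a + b) * (a + b) ≤ (Y + Y) * (Y + Y) := Nat.mul_le_mul (by omega) (by omega)
  nlinarith

theorem update_loc {g a b g' a' b' x : ℕ} {M : Mem} (hg : g < 16) (hg' : g' < 16) :
    Function.update M (loc g' a' b') x (loc g a b) =
      if g = g' ∧ a = a' ∧ b = b' then x else M (loc g a b) := by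
  simp only [Function.update_apply, loc_inj hg hg']

/-- Expressions over registers, memory cells and the request. -/
inductive Expr where
  | const (k : ℕ)
  | var (r : ℕ)
  | top
  | op (o : Op) (a b : Expr)
  | cell (g : ℕ) (a b : Expr)
  | inp (a : Expr)

/-- Statements; a condition is a comparison of two expressions. -/
inductive Stmt where
  | assign (x : ℕ) (e : Expr)
  | store (g : ℕ) (a b e : Expr)
  | seq (s t : Stmt)
  | ite (a b : Expr) (s t : Stmt)
  | while (a b : Expr) (s : Stmt)

/-- Program states: variables, memory, elapsed time. -/
structure State where
  v : ℕ → ℕ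
  mem : Mem
  time : ℕ

/-- The value of an operation on natural numbers. -/
def Op.nat : Op → ℕ → ℕ → ℕ
  | .add, a, b => a + b
  | .sub, a, b => a - b
  | .mul, a, b => a * b
  | .div, a, b => a / b

/-- The operation is not affected by the word length. -/
def Op.safe (w : ℕ) : Op → ℕ → ℕ → Prop
  | .add, a, b => a + b < 2 ^ w
  | .sub, a, b => b ≤ a ∧ a < 2 ^ w
  | .mul, a, b => a * b < 2 ^ w
  | .div, _, _ => True

theorem Op.eval_eq {w : ℕ} {o : Op} {a b : ℕ} (h : o.safe w a b) : o.eval w a b = o.nat a b := by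
  cases o
  · exact Nat.mod_eq_of_lt h
  · obtain ⟨h1, h2⟩ := h
    have : a + (2 ^ w - b) = (a - b) + 2 ^ w := by omega
    simp only [Op.eval, Op.nat, this, Nat.add_mod_right]
    exact Nat.mod_eq_of_lt (by omega)
  · exact Nat.mod_eq_of_lt h
  · rfl

namespace Expr

/-- The value of an expression over the natural numbers. -/
def eval (w : ℕ) (inp : List ℕ) (σ : State) : Expr → ℕ
  | const k => k
  | var r => σ.v r
  | top => 2 ^ w - 1
  | op o a b => o.nat (a.eval w inp σ) (b.eval w inp σ)
  | cell g a b => σ.mem (loc g (a.eval w inp σ) (b.eval w inp σ))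
  | .inp a => inp.getD (a.eval w inp σ) 0

/-- The evaluation of an expression is not affected by the word length. -/
def ok (w : ℕ) (inp : List ℕ) (σ : State) : Expr → Prop
  | const k => k < 2 ^ w
  | var r => r < 50
  | top => True
  | op o a b => a.ok w inp σ ∧ b.ok w inp σ ∧ o.safe w (a.eval w inp σ) (b.eval w inp σ)
  | cell g a b => a.ok w inp σ ∧ b.ok w inp σ ∧ loc g (a.eval w inp σ) (b.eval w inp σ) < 2 ^ w
  | .inp a => a.ok w inp σ ∧ inp.getD (a.eval w inp σ) 0 < 2 ^ w

/-- Code that turns the contents `a`, `b` of registers `d`, `d + 1` into the address `loc g a b`. -/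
def locCode (g d : ℕ) : List Instr :=
  [.op .add (d + 1) d (d + 1), .op .mul (d + 1) (d + 1) (d + 1), .op .add d d (d + 1),
    .const (d + 1) 16, .op .mul d d (d + 1), .const (d + 1) g, .op .add d d (d + 1)]

/-- Code that evaluates an expression into register `d`. -/
def code : Expr → ℕ → List Instr
  | const k, d => [.const d k]
  | var r, d => [.const d 1, .op .div d r d]
  | top, d => [.const d 0, .const (d + 1) 1, .op .sub d d (d + 1)]
  | op o a b, d => a.code d ++ b.code (d + 1) ++ [.op o d d (d + 1)]
  | cell g a b, d => a.code d ++ b.code (d + 1) ++ locCode g d ++ [.load d d]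
  | .inp a, d => a.code d ++ [.read d d]

/-- The running time of the code of an expression. -/
def cost : Expr → ℕ
  | const _ => 1
  | var _ => 2
  | top => 3
  | op _ a b => a.cost + b.cost + 1
  | cell _ a b => a.cost + b.cost + 8
  | .inp a => a.cost + 1

theorem length_code (e : Expr) (d : ℕ) : (e.code d).length = e.cost := by
  induction e generalizing d <;> simp_all [code, cost, locCode] <;> omega

end Expr

/-! ### Correctness of the compiler -/

/-- `code` stands at position `o` of the program `P`. -/
def CodeAt (P : Program) (o : ℕ) (code : List Instr) : Prop :=
  ∀ i < code.length, P[o + i]? = code[i]?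

theorem CodeAt.left {P : Program} {o : ℕ} {a b : List Instr} (h : CodeAt P o (a ++ b)) :
    CodeAt P o a := by
  intro i hi
  rw [h i (by simp; omega), List.getElem?_append_left hi]

theorem CodeAt.right {P : Program} {o : ℕ} {a b : List Instr} (h : CodeAt P o (a ++ b)) :
    CodeAt P (o + a.length) b := by
  intro i hi
  have := h (a.length + i) (by simp; omega)
  rw [List.getElem?_append_right (by omega)] at this
  simpa [add_assoc] using this

theorem CodeAt.head {P : Program} {o : ℕ} {i : Instr} {b : List Instr} (h : CodeAt P o (i :: b)) :
    P[o]? = some i := by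
  simpa using h 0 (by simp)

theorem CodeAt.tail {P : Program} {o : ℕ} {i : Instr} {b : List Instr} (h : CodeAt P o (i :: b)) :
    CodeAt P (o + 1) b :=
  CodeAt.right (a := [i]) h

/-- `t` steps lead from `c` to `c'`. -/
def Steps (w : ℕ) (P : Program) (inp : List ℕ) : ℕ → Config → Config → Prop
  | 0, c, c' => c = c'
  | t + 1, c, c' => ∃ d, step w P inp c = some d ∧ Steps w P inp t d c'

section Simulation

variable {w : ℕ} {P : Program} {inp : List ℕ}

theorem Steps.trans {s t : ℕ} {a b c : Config} (h : Steps w P inp s a b) (h' : Steps w P inp t b c) :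
    Steps w P inp (s + t) a c := by
  induction s generalizing a with
  | zero => cases h; simpa using h'
  | succ s ih =>
    obtain ⟨d, h1, h2⟩ := h
    rw [Nat.succ_add]
    exact ⟨d, h1, ih h2⟩

theorem Steps.one {a b : Config} (h : step w P inp a = some b) : Steps w P inp 1 a b :=
  ⟨b, h, rfl⟩

theorem Steps.cast {s t p q : ℕ} {a : Config} {reg : ℕ → ℕ} {mem : Mem}
    (h : Steps w P inp s a ⟨p, reg, mem⟩) (hs : s = t) (hp : p = q) :
    Steps w P inp t a ⟨q, reg, mem⟩ := by
  subst hs hp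
  exact h

theorem Steps.runs {t : ℕ} {a b : Config} (h : Steps w P inp t a b) (hb : step w P inp b = none) :
    Runs w P inp a t b := by
  induction t generalizing a with
  | zero => cases h; exact .halted hb
  | succ t ih =>
    obtain ⟨d, h1, h2⟩ := h
    exact .step h1 (ih h2)

/-- The configuration `c` at position `o` agrees with the state `σ`. -/
def Agrees (c : Config) (o : ℕ) (σ : State) : Prop :=
  c.pc = o ∧ c.mem = σ.mem ∧ ∀ r < 50, c.reg r = σ.v r

/-- Apart from the constant 16, all intermediate results are at most the final address, so the bound
on the address alone excludes overflow. -/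
theorem locCode_steps {g d o : ℕ} {reg : ℕ → ℕ} {mem : Mem} (hw : 16 < 2 ^ w)
    (hg : loc g (reg d) (reg (d + 1)) < 2 ^ w) (hc : CodeAt P o (Expr.locCode g d)) :
    ∃ reg', Steps w P inp 7 ⟨o, reg, mem⟩ ⟨o + 7, reg', mem⟩ ∧
      reg' d = loc g (reg d) (reg (d + 1)) ∧ ∀ r < d, reg' r = reg r := by
  unfold loc at hg
  set a := reg d with ha
  set b := reg (d + 1) with hb
  have h1 : a + (a + b) * (a + b) < 2 ^ w := by nlinarith
  have h2 : (a + b) * (a + b) < 2 ^ w := by omega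
  have h3 : a + b < 2 ^ w := lt_of_le_of_lt (Nat.le_mul_self _) h2
  have h4 : (a + (a + b) * (a + b)) * 16 < 2 ^ w := by omega
  have h5 : g < 2 ^ w := by omega
  have e1 := hc.head
  have e2 := hc.tail.head
  have e3 := hc.tail.tail.head
  have e4 := hc.tail.tail.tail.head
  have e5 := hc.tail.tail.tail.tail.head
  have e6 := hc.tail.tail.tail.tail.tail.head
  have e7 := hc.tail.tail.tail.tail.tail.tail.head
  refine ⟨_, ⟨_, by simp only [step, e1]; rfl, _, by simp only [step, e2]; rfl,
    _, by simp only [step, e3]; rfl, _, by simp only [step, e4]; rfl,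
    _, by simp only [step, e5]; rfl, _, by simp only [step, e6]; rfl,
    _, by simp only [step, e7]; rfl, rfl⟩, ?_, ?_⟩
  · simp [Op.eval, ← ha, ← hb, Nat.mod_eq_of_lt h3, Nat.mod_eq_of_lt h2, Nat.mod_eq_of_lt h1,
      Nat.mod_eq_of_lt hw, Nat.mod_eq_of_lt h4, Nat.mod_eq_of_lt h5, Nat.mod_eq_of_lt hg, loc]
  · intro r hr
    have : r ≠ d := by omega
    have : r ≠ d + 1 := by omega
    simp [*]

/-- The registers from `d` on act as a stack: code for `d` never changes lower registers, so the
first operand in `d` survives the evaluation of the second one in `d + 1`, and the variables, which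
are below 50, survive everything. -/
theorem Expr.steps {e : Expr} {σ : State} (hw : 16 < 2 ^ w) (he : e.ok w inp σ) {d o : ℕ}
    (hd : 50 ≤ d) (hc : CodeAt P o (e.code d)) {reg : ℕ → ℕ} (hr : ∀ r < 50, reg r = σ.v r) :
    ∃ reg', Steps w P inp e.cost ⟨o, reg, σ.mem⟩ ⟨o + e.cost, reg', σ.mem⟩ ∧
      reg' d = e.eval w inp σ ∧ ∀ r < d, reg' r = reg r := by
  induction e generalizing d o reg with
  | const k =>
    refine ⟨_, ⟨_, by simp only [step, hc.head]; rfl, rfl⟩, ?_, ?_⟩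
    · simpa [Expr.eval] using Nat.mod_eq_of_lt he
    · intro r hr
      simp [hr.ne]
  -- The machine has no copy instruction; the code divides by a 1 placed in `d`, which is correct
  -- because `k ≠ d`.
  | var k =>
    have hk : k < 50 := he
    have : k ≠ d := by omega
    refine ⟨_, ⟨_, by simp only [step, hc.head]; rfl, _,
      by simp only [step, hc.tail.head]; rfl, rfl⟩, ?_, ?_⟩
    · simp [Expr.eval, this, Op.eval, hr k hk, Nat.mod_eq_of_lt (show 1 < 2 ^ w by omega)]
    · intro r hr
      simp [hr.ne]
  -- Subtracting 1 from 0 wraps around to the greatest word. This is how a program that does not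
  -- know `w` obtains it.
  | top =>
    refine ⟨_, ⟨_, by simp only [step, hc.head]; rfl, _,
      by simp only [step, hc.tail.head]; rfl, _,
      by simp only [step, hc.tail.tail.head]; rfl, rfl⟩, ?_, ?_⟩
    · simp only [Expr.eval, Op.eval, Nat.zero_mod, Function.update_self, Nat.mod_eq_of_lt (show 1 < 2 ^ w by omega)]
      rw [Function.update_of_ne (by omega), Function.update_self, Nat.zero_add]
      exact Nat.mod_eq_of_lt (by omega)
    · intro r hr
      have : r ≠ d + 1 := by omega
      simp [hr.ne, this]
  | op p a b iha ihb =>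
    obtain ⟨ha, hb, hs⟩ := he
    obtain ⟨r1, s1, v1, f1⟩ := iha ha hd hc.left.left hr
    have hc2 := hc.left.right
    rw [Expr.length_code] at hc2
    obtain ⟨r2, s2, v2, f2⟩ := ihb hb (by omega) hc2
      (reg := r1) (fun r h => (f1 r (by omega)).trans (hr r h))
    have hc3 := hc.right.head
    rw [List.length_append, Expr.length_code, Expr.length_code, ← add_assoc] at hc3
    refine ⟨_, ((s1.trans s2).trans (Steps.one (by simp only [step, hc3]; rfl))).cast rfl
      (by simp only [Expr.cost]; omega), ?_, ?_⟩
    · simp only [Function.update_self, v2, f2 d (by omega), v1, Op.eval_eq hs]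
      rfl
    · intro r hr
      rw [Function.update_of_ne hr.ne, f2 r (by omega), f1 r hr]
  | cell g a b iha ihb =>
    obtain ⟨ha, hb, hs⟩ := he
    obtain ⟨r1, s1, v1, f1⟩ := iha ha hd hc.left.left.left hr
    have hc2 := hc.left.left.right
    rw [Expr.length_code] at hc2
    obtain ⟨r2, s2, v2, f2⟩ := ihb hb (by omega) hc2
      (reg := r1) (fun r h => (f1 r (by omega)).trans (hr r h))
    have hc3 := hc.left.right
    rw [List.length_append, Expr.length_code, Expr.length_code, ← add_assoc] at hc3
    have hv : r2 d = a.eval w inp σ := by rw [f2 d (by omega), v1]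
    obtain ⟨r3, s3, v3, f3⟩ := locCode_steps (inp := inp) (reg := r2) (mem := σ.mem) hw
      (by rw [hv, v2]; exact hs) hc3
    have hc4 := hc.right.head
    rw [List.length_append, List.length_append, Expr.length_code, Expr.length_code] at hc4
    have hc5 : P[o + a.cost + b.cost + 7]? = some (.load d d) := by
      rw [← hc4]; congr 1; simp [Expr.locCode]; omega
    refine ⟨_, (((s1.trans s2).trans s3).trans (Steps.one (by simp only [step, hc5]; rfl))).cast rfl
      (by simp only [Expr.cost]; omega), ?_, ?_⟩
    · simp only [Function.update_self, v3, v2, hv]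
      rfl
    · intro r hr
      rw [Function.update_of_ne hr.ne, f3 r hr, f2 r (by omega), f1 r hr]
  | inp a iha =>
    obtain ⟨ha, hs⟩ := he
    obtain ⟨r1, s1, v1, f1⟩ := iha ha hd hc.left hr
    have hc2 := hc.right.head
    rw [Expr.length_code] at hc2
    refine ⟨_, s1.trans (Steps.one (by simp only [step, hc2]; rfl)), ?_, ?_⟩
    · simp only [Function.update_self, v1, Nat.mod_eq_of_lt hs]
      rfl
    · intro r hr
      rw [Function.update_of_ne hr.ne, f1 r hr]

namespace Stmt

/-- The length of the code of a statement. -/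
def len : Stmt → ℕ
  | assign _ e => e.cost + 2
  | store _ a b e => a.cost + b.cost + 7 + e.cost + 1
  | seq s t => s.len + t.len
  | ite a b s t => a.cost + b.cost + 1 + t.len + 1 + s.len
  | .while a b s => a.cost + b.cost + 2 + s.len + 1

/-- The code of a statement at position `o` of a program. -/
def code : Stmt → ℕ → List Instr
  | assign x e, _ => e.code 50 ++ [.const 51 1, .op .div x 50 51]
  | store g a b e, _ => a.code 50 ++ b.code 51 ++ Expr.locCode g 50 ++ e.code 51 ++ [.store 50 51]
  | seq s t, o => s.code o ++ t.code (o + s.len)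
  | ite a b s t, o =>
      a.code 50 ++ b.code 51 ++ [.jumpLt 50 51 (o + a.cost + b.cost + 1 + t.len + 1)] ++
        t.code (o + a.cost + b.cost + 1) ++ [.jump (o + a.cost + b.cost + 1 + t.len + 1 + s.len)] ++
        s.code (o + a.cost + b.cost + 1 + t.len + 1)
  | .while a b s, o =>
      a.code 50 ++ b.code 51 ++ [.jumpLt 50 51 (o + a.cost + b.cost + 2),
        .jump (o + a.cost + b.cost + 2 + s.len + 1)] ++ s.code (o + a.cost + b.cost + 2) ++ [.jump o]

theorem length_code (s : Stmt) (o : ℕ) : (s.code o).length = s.len := by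
  induction s generalizing o <;> simp_all [code, len, Expr.locCode, Expr.length_code] <;> omega

end Stmt

/-- Let `k` units of time pass. -/
def State.tick (σ : State) (k : ℕ) : State := { σ with time := σ.time + k }

/-- Assignment of `a` to the variable `x`, in `k` units of time. -/
def State.set (σ : State) (x a k : ℕ) : State :=
  ⟨Function.update σ.v x a, σ.mem, σ.time + k⟩

/-- Assignment of `a` to the memory cell `l`, in `k` units of time. -/
def State.put (σ : State) (l a k : ℕ) : State :=
  ⟨σ.v, Function.update σ.mem l a, σ.time + k⟩

/-- Big step semantics. -/
inductive Exec (w : ℕ) (inp : List ℕ) : Stmt → State → State → Prop where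
  | assign {x : ℕ} {e : Expr} {σ : State} : x < 50 → e.ok w inp σ →
      Exec w inp (.assign x e) σ (σ.set x (e.eval w inp σ) (e.cost + 2))
  | store {g : ℕ} {a b e : Expr} {σ : State} : a.ok w inp σ → b.ok w inp σ → e.ok w inp σ →
      loc g (a.eval w inp σ) (b.eval w inp σ) < 2 ^ w →
      Exec w inp (.store g a b e) σ
        (σ.put (loc g (a.eval w inp σ) (b.eval w inp σ)) (e.eval w inp σ)
          (a.cost + b.cost + e.cost + 8))
  | seq {s t : Stmt} {σ σ' σ'' : State} : Exec w inp s σ σ' → Exec w inp t σ' σ'' →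
      Exec w inp (.seq s t) σ σ''
  | ite_true {a b : Expr} {s t : Stmt} {σ σ' : State} : a.ok w inp σ → b.ok w inp σ →
      a.eval w inp σ < b.eval w inp σ → Exec w inp s (σ.tick (a.cost + b.cost + 2)) σ' →
      Exec w inp (.ite a b s t) σ σ'
  | ite_false {a b : Expr} {s t : Stmt} {σ σ' : State} : a.ok w inp σ → b.ok w inp σ →
      ¬ a.eval w inp σ < b.eval w inp σ → Exec w inp t (σ.tick (a.cost + b.cost + 2)) σ' →
      Exec w inp (.ite a b s t) σ σ'
  | while_true {a b : Expr} {s : Stmt} {σ σ' σ'' : State} : a.ok w inp σ → b.ok w inp σ →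
      a.eval w inp σ < b.eval w inp σ → Exec w inp s (σ.tick (a.cost + b.cost + 2)) σ' →
      Exec w inp (.while a b s) σ' σ'' →
      Exec w inp (.while a b s) σ σ''
  | while_false {a b : Expr} {s : Stmt} {σ : State} : a.ok w inp σ → b.ok w inp σ →
      ¬ a.eval w inp σ < b.eval w inp σ →
      Exec w inp (.while a b s) σ (σ.tick (a.cost + b.cost + 2))

theorem cond_steps {a b : Expr} {σ : State} (hw : 16 < 2 ^ w) (ha : a.ok w inp σ)
    (hb : b.ok w inp σ) {o : ℕ} (hc : CodeAt P o (a.code 50 ++ b.code 51)) {reg : ℕ → ℕ}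
    (hr : ∀ r < 50, reg r = σ.v r) :
    ∃ reg', Steps w P inp (a.cost + b.cost) ⟨o, reg, σ.mem⟩ ⟨o + (a.cost + b.cost), reg', σ.mem⟩ ∧
      reg' 50 = a.eval w inp σ ∧ reg' 51 = b.eval w inp σ ∧ ∀ r < 50, reg' r = σ.v r := by
  obtain ⟨r1, s1, v1, f1⟩ := a.steps hw ha le_rfl hc.left hr
  have hc2 := hc.right
  rw [Expr.length_code] at hc2
  obtain ⟨r2, s2, v2, f2⟩ := b.steps hw hb (by omega) hc2
    (reg := r1) (fun r h => (f1 r (by omega)).trans (hr r h))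
  rw [← add_assoc]
  exact ⟨r2, s1.trans s2, by rw [f2 _ (by omega), v1], v2,
    fun r h => by rw [f2 r (by omega), f1 r h, hr r h]⟩

/-- Induction is on the execution, because a loop executes itself again. The time is only bounded
above: both branches of a conditional are charged the same, although only one of them ends with a
jump. -/
theorem Exec.simulate {s : Stmt} {σ σ' : State} (hw : 16 < 2 ^ w) (h : Exec w inp s σ σ') {o : ℕ}
    (hc : CodeAt P o (s.code o)) {c : Config} (hcσ : Agrees c o σ) :
    ∃ t c', Steps w P inp t c c' ∧ σ.time + t ≤ σ'.time ∧ Agrees c' (o + s.len) σ' := by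
  induction h generalizing o c with
  | @assign x e σ hx he =>
    obtain ⟨pc, reg, mem⟩ := c
    obtain ⟨rfl, rfl, hr⟩ := hcσ
    obtain ⟨r1, s1, v1, f1⟩ := e.steps hw he le_rfl hc.left hr
    have h2 := hc.right
    rw [Expr.length_code] at h2
    refine ⟨_, _, s1.trans (t := 2) ⟨_, by simp only [step, h2.head]; rfl, _,
      by simp only [step, h2.tail.head]; rfl, rfl⟩, ?_, ?_, rfl, ?_⟩
    · simp [State.set]
    · simp [Stmt.len, add_assoc]
    · intro r hr'
      have : r ≠ 51 := by omega
      have h1 : 1 % 2 ^ w = 1 := Nat.mod_eq_of_lt (by omega)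
      simp only [State.set, Op.eval, Function.update_self, h1, Nat.div_one]
      rw [Function.update_of_ne (by omega : (50 : ℕ) ≠ 51), v1]
      rcases eq_or_ne r x with rfl | hrx
      · simp
      · rw [Function.update_of_ne hrx, Function.update_of_ne this, Function.update_of_ne hrx]
        exact (f1 r hr').trans (hr r hr')
  | @store g a b e σ ha hb he hl =>
    obtain ⟨pc, reg, mem⟩ := c
    obtain ⟨rfl, rfl, hr⟩ := hcσ
    obtain ⟨r1, s1, v1, v2, f1⟩ := cond_steps hw ha hb hc.left.left.left hr
    have h2 := hc.left.left.right
    rw [List.length_append, Expr.length_code, Expr.length_code] at h2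
    obtain ⟨r2, s2, v3, f2⟩ := locCode_steps (inp := inp) (reg := r1) (mem := σ.mem) hw
      (by rw [v1, v2]; exact hl) h2
    have h3 := hc.left.right
    simp only [List.length_append, Expr.length_code, Expr.locCode, List.length_cons,
      List.length_nil, zero_add, Nat.reduceAdd, ← add_assoc] at h3
    obtain ⟨r3, s3, v4, f3⟩ := e.steps (d := 51) hw he (by omega)
      (by simpa only [← add_assoc] using h3) (reg := r2)
      (fun r h => (f2 r h).trans (f1 r h))
    have h4 := hc.right.head
    have h5 : P[pc + a.cost + b.cost + 7 + e.cost]? = some (.store 50 51) := by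
      rw [← h4]; congr 1; simp [Expr.locCode, Expr.length_code]; omega
    have s12 := (s1.trans s2).cast rfl
      (show pc + (a.cost + b.cost) + 7 = pc + a.cost + b.cost + 7 by omega)
    refine ⟨_, _, (s12.trans s3).trans (t := 1) ⟨_, by simp only [step, h5]; rfl, rfl⟩,
      ?_, ?_, ?_, ?_⟩
    · simp only [State.put]; omega
    · simp only [Stmt.len]; omega
    · simp only [State.put, v4, f3 50 (by omega), v3, v1, v2]
    · intro r hr'
      simp only [State.put, f3 r (by omega), f2 r hr', f1 r hr']
  | seq _ _ ih1 ih2 =>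
    obtain ⟨t1, c1, s1, l1, a1⟩ := ih1 hc.left hcσ
    have h2 := hc.right
    rw [Stmt.length_code] at h2
    obtain ⟨t2, c2, s2, l2, a2⟩ := ih2 h2 a1
    exact ⟨_, c2, s1.trans s2, by omega, by simpa only [Stmt.len, add_assoc] using a2⟩
  | @ite_true a b s t σ σ' ha hb hab _ ih =>
    obtain ⟨pc, reg, mem⟩ := c
    obtain ⟨rfl, rfl, hr⟩ := hcσ
    obtain ⟨r1, s1, v1, v2, f1⟩ := cond_steps hw ha hb hc.left.left.left.left hr
    have h2 := hc.left.left.left.right.head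
    rw [List.length_append, Expr.length_code, Expr.length_code] at h2
    have h3 := hc.right
    have e3 : pc + (a.code 50 ++ b.code 51 ++ [Instr.jumpLt 50 51 (pc + a.cost + b.cost + 1 + t.len + 1)] ++
        t.code (pc + a.cost + b.cost + 1) ++
        [Instr.jump (pc + a.cost + b.cost + 1 + t.len + 1 + s.len)]).length =
        pc + a.cost + b.cost + 1 + t.len + 1 := by
      simp [Expr.length_code, Stmt.length_code]; omega
    rw [e3] at h3
    obtain ⟨k, c', s2, l2, a2⟩ := ih h3
      (c := ⟨pc + a.cost + b.cost + 1 + t.len + 1, r1, σ.mem⟩) ⟨rfl, rfl, f1⟩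
    refine ⟨_, c', (s1.trans (Steps.one ?_)).trans s2, ?_, ?_⟩
    · simp only [step, h2, v1, v2, hab, if_true]
    · simp only [State.tick] at l2; omega
    · convert a2 using 1; simp only [Stmt.len]; omega
  | @ite_false a b s t σ σ' ha hb hab _ ih =>
    obtain ⟨pc, reg, mem⟩ := c
    obtain ⟨rfl, rfl, hr⟩ := hcσ
    obtain ⟨r1, s1, v1, v2, f1⟩ := cond_steps hw ha hb hc.left.left.left.left hr
    have h2 := hc.left.left.left.right.head
    rw [List.length_append, Expr.length_code, Expr.length_code] at h2
    have h3 := hc.left.left.right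
    have e3 : pc + (a.code 50 ++ b.code 51 ++
        [Instr.jumpLt 50 51 (pc + a.cost + b.cost + 1 + t.len + 1)]).length =
        pc + a.cost + b.cost + 1 := by
      simp [Expr.length_code]; omega
    rw [e3] at h3
    have h4 := hc.left.right.head
    have e4 : pc + (a.code 50 ++ b.code 51 ++
        [Instr.jumpLt 50 51 (pc + a.cost + b.cost + 1 + t.len + 1)] ++
        t.code (pc + a.cost + b.cost + 1)).length = pc + a.cost + b.cost + 1 + t.len := by
      simp [Expr.length_code, Stmt.length_code]; omega
    rw [e4] at h4
    obtain ⟨k, ⟨pc', reg', mem'⟩, s2, l2, a2, a3, a4⟩ := ih h3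
      (c := ⟨pc + a.cost + b.cost + 1, r1, σ.mem⟩) ⟨rfl, rfl, f1⟩
    obtain rfl : pc' = pc + a.cost + b.cost + 1 + t.len := a2
    refine ⟨_, ⟨pc + a.cost + b.cost + 1 + t.len + 1 + s.len, reg', mem'⟩,
      ((s1.trans (Steps.one ?_)).trans s2).trans
      (Steps.one (by simp only [step, h4])), ?_, ?_, a3, a4⟩
    · simp only [step, h2, v1, v2, hab, if_false, add_assoc]
    · simp only [State.tick] at l2; omega
    · simp only [Stmt.len]; omega
  | @while_true a b s σ σ' σ'' ha hb hab _ _ ih1 ih2 =>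
    obtain ⟨pc, reg, mem⟩ := c
    obtain ⟨rfl, rfl, hr⟩ := hcσ
    obtain ⟨r1, s1, v1, v2, f1⟩ := cond_steps hw ha hb hc.left.left.left hr
    have h2 := hc.left.left.right.head
    rw [List.length_append, Expr.length_code, Expr.length_code] at h2
    have h3 := hc.left.right
    have e3 : pc + (a.code 50 ++ b.code 51 ++ [Instr.jumpLt 50 51 (pc + a.cost + b.cost + 2),
        Instr.jump (pc + a.cost + b.cost + 2 + s.len + 1)]).length = pc + a.cost + b.cost + 2 := by
      simp [Expr.length_code]; omega
    rw [e3] at h3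
    have h4 := hc.right.head
    have e4 : pc + (a.code 50 ++ b.code 51 ++ [Instr.jumpLt 50 51 (pc + a.cost + b.cost + 2),
        Instr.jump (pc + a.cost + b.cost + 2 + s.len + 1)] ++ s.code (pc + a.cost + b.cost + 2)).length =
        pc + a.cost + b.cost + 2 + s.len := by
      simp [Expr.length_code, Stmt.length_code]; omega
    rw [e4] at h4
    obtain ⟨k, ⟨pc', reg', mem'⟩, s2, l2, a2, a3, a4⟩ := ih1 h3
      (c := ⟨pc + a.cost + b.cost + 2, r1, σ.mem⟩) ⟨rfl, rfl, f1⟩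
    obtain rfl : pc' = pc + a.cost + b.cost + 2 + s.len := a2
    obtain ⟨k', c', s3, l3, a5⟩ := ih2 hc (c := ⟨pc, reg', mem'⟩) ⟨rfl, a3, a4⟩
    refine ⟨_, c', (((s1.trans (Steps.one ?_)).trans s2).trans
      (Steps.one (by simp only [step, h4]))).trans s3, ?_, a5⟩
    · simp only [step, h2, v1, v2, hab, if_true]
    · simp only [State.tick] at l2; omega
  | @while_false a b s σ ha hb hab =>
    obtain ⟨pc, reg, mem⟩ := c
    obtain ⟨rfl, rfl, hr⟩ := hcσ
    obtain ⟨r1, s1, v1, v2, f1⟩ := cond_steps hw ha hb hc.left.left.left hr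
    have h2 := hc.left.left.right
    rw [List.length_append, Expr.length_code, Expr.length_code] at h2
    refine ⟨_, _, s1.trans (t := 2) ⟨_, by simp only [step, h2.head, v1, v2, hab, if_false]; rfl, _,
      by simp only [step, h2.tail.head]; rfl, rfl⟩, ?_, ?_, rfl, f1⟩
    · simp [State.tick, add_assoc]
    · simp only [Stmt.len]; omega

/-- A complete execution of a compiled statement. -/
theorem Exec.runs {s : Stmt} {σ' : State} {M : Mem} (hw : 16 < 2 ^ w)
    (h : Exec w inp s ⟨fun _ => 0, M, 0⟩ σ') :
    ∃ t c, Runs w (s.code 0) inp (start M) t c ∧ t ≤ σ'.time ∧ c.mem = σ'.mem ∧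
      c.reg 0 = σ'.v 0 ∧ c.reg 1 = σ'.v 1 := by
  obtain ⟨t, c, s1, l1, a1, a2, a3⟩ := h.simulate (P := s.code 0) (o := 0) hw
    (fun i hi => by simp) (c := start M) ⟨rfl, rfl, fun _ _ => rfl⟩
  refine ⟨t, c, s1.runs ?_, by simpa using l1, a2, a3 0 (by omega), a3 1 (by omega)⟩
  have : (s.code 0)[c.pc]? = none := by
    rw [a1, List.getElem?_eq_none]
    simp [Stmt.length_code]
  simp [step, this]

/-! ### Weakest preconditions -/

/-- The statement terminates from `σ`, in a state that satisfies `Q`. -/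
def wp (w : ℕ) (inp : List ℕ) (s : Stmt) (Q : State → Prop) (σ : State) : Prop :=
  ∃ σ', Exec w inp s σ σ' ∧ Q σ'

variable {Q R : State → Prop} {σ : State}

theorem wp.mono {s : Stmt} (h : wp w inp s Q σ) (hQ : ∀ σ', Q σ' → R σ') : wp w inp s R σ :=
  let ⟨σ', h1, h2⟩ := h
  ⟨σ', h1, hQ _ h2⟩

theorem wp_seq {s t : Stmt} (h : wp w inp s (wp w inp t Q) σ) : wp w inp (.seq s t) Q σ :=
  let ⟨_, h1, σ'', h2, h3⟩ := h
  ⟨σ'', .seq h1 h2, h3⟩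

theorem wp_assign {x : ℕ} {e : Expr} (hx : x < 50) (he : e.ok w inp σ)
    (h : Q (σ.set x (e.eval w inp σ) (e.cost + 2))) : wp w inp (.assign x e) Q σ :=
  ⟨_, .assign hx he, h⟩

theorem wp_store {g : ℕ} {a b e : Expr} (ha : a.ok w inp σ) (hb : b.ok w inp σ)
    (he : e.ok w inp σ) (hl : loc g (a.eval w inp σ) (b.eval w inp σ) < 2 ^ w)
    (h : Q (σ.put (loc g (a.eval w inp σ) (b.eval w inp σ)) (e.eval w inp σ)
      (a.cost + b.cost + e.cost + 8))) : wp w inp (.store g a b e) Q σ :=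
  ⟨_, .store ha hb he hl, h⟩

theorem wp_ite {a b : Expr} {s t : Stmt} (ha : a.ok w inp σ) (hb : b.ok w inp σ)
    (h1 : a.eval w inp σ < b.eval w inp σ → wp w inp s Q (σ.tick (a.cost + b.cost + 2)))
    (h2 : b.eval w inp σ ≤ a.eval w inp σ → wp w inp t Q (σ.tick (a.cost + b.cost + 2))) :
    wp w inp (.ite a b s t) Q σ := by
  by_cases h : a.eval w inp σ < b.eval w inp σ
  · obtain ⟨σ', h3, h4⟩ := h1 h
    exact ⟨σ', .ite_true ha hb h h3, h4⟩
  · obtain ⟨σ', h3, h4⟩ := h2 (not_lt.1 h)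
    exact ⟨σ', .ite_false ha hb h h3, h4⟩

/-- The measure `m` provides termination only. Running time needs no rule of its own: it is part of
the state and can be bounded in the invariant `I`. -/
theorem wp_while {a b : Expr} {s : Stmt} (I : State → Prop) (m : State → ℕ)
    (hI : ∀ σ, I σ → a.ok w inp σ ∧ b.ok w inp σ ∧
      (a.eval w inp σ < b.eval w inp σ →
        wp w inp s (fun σ' => I σ' ∧ m σ' < m σ) (σ.tick (a.cost + b.cost + 2))) ∧
      (b.eval w inp σ ≤ a.eval w inp σ → Q (σ.tick (a.cost + b.cost + 2))))
    (h0 : I σ) : wp w inp (.while a b s) Q σ := by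
  induction hk : m σ using Nat.strong_induction_on generalizing σ with
  | _ k ih =>
    obtain ⟨ha, hb, h1, h2⟩ := hI σ h0
    by_cases h : a.eval w inp σ < b.eval w inp σ
    · obtain ⟨σ', h3, h4, h5⟩ := h1 h
      obtain ⟨σ'', h6, h7⟩ := ih (m σ') (hk ▸ h5) h4 rfl
      exact ⟨σ'', .while_true ha hb h h3 h6, h7⟩
    · exact ⟨_, .while_false ha hb h, h2 (not_lt.1 h)⟩

end Simulation

attribute [simp] Expr.eval Expr.ok Expr.cost Op.nat Op.safe State.set State.put State.tick

/-! ### A family of sets in memory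

The set with key `k` is stored as an array without repetitions; `posOf M k x` is the position of
`x` in this array, counted from `1`, and `0` if `x` does not belong to the set. -/

/-- The cardinality of the set with key `k`. -/
def cntOf (M : Mem) (k : ℕ) : ℕ := M (loc 7 k 0)

/-- The array of the elements of the set with key `k`. -/
def arrOf (M : Mem) (k i : ℕ) : ℕ := M (loc 8 k i)

/-- The positions in the array of the set with key `k`. -/
def posOf (M : Mem) (k x : ℕ) : ℕ := M (loc 9 k x)

/-- The family of sets is stored consistently. -/
structure SetsWF (M : Mem) : Prop where
  pos_le : ∀ k x, posOf M k x ≠ 0 → posOf M k x ≤ cntOf M k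
  arr_pos : ∀ k x, posOf M k x ≠ 0 → arrOf M k (posOf M k x - 1) = x
  pos_arr : ∀ k i, i < cntOf M k → posOf M k (arrOf M k i) = i + 1

/-- The array enumerates distinct elements. This keeps counters within the address range and also
bounds the number of hyperedges handled when a vertex is lowered. -/
theorem SetsWF.cnt_le_card {M : Mem} (h : SetsWF M) {k : ℕ} {s : Finset ℕ}
    (hs : ∀ x, posOf M k x ≠ 0 → x ∈ s) : cntOf M k ≤ s.card := by
  have : (Finset.range (cntOf M k)).card ≤ s.card := by
    refine Finset.card_le_card_of_injOn (arrOf M k) ?_ ?_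
    · intro i hi
      have := h.pos_arr k i (by simpa using hi)
      exact hs _ (by omega)
    · intro i hi j hj hij
      have h1 := h.pos_arr k i (by simpa using hi)
      have h2 := h.pos_arr k j (by simpa using hj)
      rw [hij] at h1
      omega
  simpa using this

theorem SetsWF.cnt_le {M : Mem} (h : SetsWF M) {k Z : ℕ} (hs : ∀ x, posOf M k x ≠ 0 → x < Z) :
    cntOf M k ≤ Z := by
  simpa using h.cnt_le_card (s := Finset.range Z) (fun x hx => by simpa using hs x hx)

/-- The memory after the insertion of a new element. -/
def insMem (M : Mem) (k x : ℕ) : Mem :=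
  Function.update (Function.update (Function.update M (loc 8 k (cntOf M k)) x)
    (loc 9 k x) (cntOf M k + 1)) (loc 7 k 0) (cntOf M k + 1)

/-- The memory after the removal of an element. -/
def eraseMem (M : Mem) (k x : ℕ) : Mem :=
  Function.update (Function.update (Function.update (Function.update M
    (loc 8 k (posOf M k x - 1)) (arrOf M k (cntOf M k - 1)))
    (loc 9 k (arrOf M k (cntOf M k - 1))) (posOf M k x)) (loc 9 k x) 0)
    (loc 7 k 0) (cntOf M k - 1)

/-- The result of an insertion. -/
structure IsInsert (M M' : Mem) (k x : ℕ) : Prop where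
  wf : SetsWF M'
  mem : ∀ l y, posOf M' l y ≠ 0 ↔ posOf M l y ≠ 0 ∨ (l = k ∧ y = x)
  pos : ∀ l y, l ≠ k ∨ y ≠ x → posOf M' l y = posOf M l y
  other : ∀ g a b, g < 7 → M' (loc g a b) = M (loc g a b)

/-- The result of a removal. -/
structure IsErase (M M' : Mem) (k x : ℕ) : Prop where
  wf : SetsWF M'
  mem : ∀ l y, posOf M' l y ≠ 0 ↔ posOf M l y ≠ 0 ∧ ¬(l = k ∧ y = x)
  pos : ∀ l y, l ≠ k ∨ posOf M l y < posOf M l x → posOf M' l y = posOf M l y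
  other : ∀ g a b, g < 7 → M' (loc g a b) = M (loc g a b)

theorem insMem_isInsert {M : Mem} (h : SetsWF M) {k x : ℕ} (hx : posOf M k x = 0) :
    IsInsert M (insMem M k x) k x := by
  have hc : ∀ l, cntOf (insMem M k x) l = if l = k then cntOf M k + 1 else cntOf M l := by
    intro l
    simp only [cntOf, insMem, Function.update_apply, loc_inj (by norm_num : 7 < 16) (by norm_num : 7 < 16),
      loc_inj (by norm_num : 7 < 16) (by norm_num : 9 < 16), loc_inj (by norm_num : 7 < 16) (by norm_num : 8 < 16)]
    simp
  have ha : ∀ l i, arrOf (insMem M k x) l i = if l = k ∧ i = cntOf M k then x else arrOf M l i := by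
    intro l i
    simp only [cntOf, arrOf, insMem, Function.update_apply, loc_inj (by norm_num : 8 < 16) (by norm_num : 7 < 16),
      loc_inj (by norm_num : 8 < 16) (by norm_num : 9 < 16), loc_inj (by norm_num : 8 < 16) (by norm_num : 8 < 16)]
    grind
  have hp : ∀ l y, posOf (insMem M k x) l y =
      if l = k ∧ y = x then cntOf M k + 1 else posOf M l y := by
    intro l i
    simp only [cntOf, posOf, insMem, Function.update_apply, loc_inj (by norm_num : 9 < 16) (by norm_num : 7 < 16),
      loc_inj (by norm_num : 9 < 16) (by norm_num : 9 < 16), loc_inj (by norm_num : 9 < 16) (by norm_num : 8 < 16)]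
    simp
  refine ⟨⟨?_, ?_, ?_⟩, ?_, ?_, ?_⟩
  · intro l y
    rw [hp, hc]
    have := h.pos_le l y
    split_ifs with h1 h2 h2
    · omega
    · exact absurd h1.1 h2
    · subst h2; omega
    · exact this
  · intro l y
    rw [hp, ha]
    have h1 := h.pos_le l y
    have h2 := h.arr_pos l y
    split_ifs with h3 h4 h4
    · simp [h3.2]
    · exact absurd ⟨h3.1, by omega⟩ h4
    · intro h5
      obtain ⟨rfl, h6⟩ := h4
      have := h1 h5
      omega
    · exact h2
  · intro l i
    rw [hc, ha, hp]
    intro h1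
    by_cases hl : l = k
    · subst hl
      simp only [if_true, true_and] at h1 ⊢
      by_cases hi : i = cntOf M l
      · simp [hi]
      · have h2 := h.pos_arr l i (by omega)
        have : arrOf M l i ≠ x := fun h3 => by rw [h3] at h2; omega
        simp [hi, this, h2]
    · simp only [hl, if_false, false_and] at h1 ⊢
      exact h.pos_arr l i h1
  · intro l y
    rw [hp]
    split_ifs with h1
    · simp [h1]
    · simp [h1]
  · intro l y h1
    rw [hp, if_neg (by tauto)]
  · intro g a b hg
    simp only [insMem, Function.update_apply, loc_inj (by omega : g < 16) (by norm_num : 7 < 16),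
      loc_inj (by omega : g < 16) (by norm_num : 9 < 16), loc_inj (by omega : g < 16) (by norm_num : 8 < 16)]
    have : g ≠ 7 ∧ g ≠ 8 ∧ g ≠ 9 := by omega
    simp [this]

/-- The last element `z` moves into the gap, so positions before that of `x` do not change; a loop
running backwards through an array may therefore erase as it goes. If `z = x`, it matters that the
position of `x` is cleared after that of `z` is set. -/
theorem eraseMem_isErase {M : Mem} (h : SetsWF M) {k x : ℕ} (hx : posOf M k x ≠ 0) :
    IsErase M (eraseMem M k x) k x := by
  have hle := h.pos_le k x hx
  set z := arrOf M k (cntOf M k - 1) with hz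
  have hpz : posOf M k z = cntOf M k := by
    rw [hz, h.pos_arr k _ (by omega)]
    omega
  have hc : ∀ l, cntOf (eraseMem M k x) l = if l = k then cntOf M k - 1 else cntOf M l := by
    intro l
    simp only [cntOf, eraseMem, Function.update_apply, loc_inj (by norm_num : 7 < 16) (by norm_num : 7 < 16),
      loc_inj (by norm_num : 7 < 16) (by norm_num : 9 < 16), loc_inj (by norm_num : 7 < 16) (by norm_num : 8 < 16)]
    simp
  have ha : ∀ l i, arrOf (eraseMem M k x) l i =
      if l = k ∧ i = posOf M k x - 1 then z else arrOf M l i := by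
    intro l i
    rw [hz]
    simp only [cntOf, arrOf, posOf, eraseMem, Function.update_apply, loc_inj (by norm_num : 8 < 16) (by norm_num : 7 < 16),
      loc_inj (by norm_num : 8 < 16) (by norm_num : 9 < 16), loc_inj (by norm_num : 8 < 16) (by norm_num : 8 < 16)]
    grind
  have hp : ∀ l y, posOf (eraseMem M k x) l y =
      if l = k ∧ y = x then 0 else if l = k ∧ y = z then posOf M k x else posOf M l y := by
    intro l i
    rw [hz]
    simp only [cntOf, arrOf, posOf, eraseMem, Function.update_apply, loc_inj (by norm_num : 9 < 16) (by norm_num : 7 < 16),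
      loc_inj (by norm_num : 9 < 16) (by norm_num : 9 < 16), loc_inj (by norm_num : 9 < 16) (by norm_num : 8 < 16)]
    grind
  have hinj : ∀ y, posOf M k y ≠ 0 → posOf M k y = posOf M k x → y = x := by
    intro y h1 h2
    rw [← h.arr_pos k y h1, h2, h.arr_pos k x hx]
  have hinz : ∀ y, posOf M k y ≠ 0 → posOf M k y = cntOf M k → y = z := by
    intro y h1 h2
    rw [← h.arr_pos k y h1, h2]
  clear_value z
  refine ⟨⟨?_, ?_, ?_⟩, ?_, ?_, ?_⟩
  · intro l y
    rw [hp, hc]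
    by_cases hl : l = k
    · subst hl
      simp only [true_and, if_true]
      split_ifs with h1 h2
      · simp
      · subst h2
        intro _
        rcases hle.lt_or_eq with h3 | h3
        · omega
        · exact absurd (hinj y (by omega) (by omega)) h1
      · intro h3
        have := h.pos_le l y h3
        have h4 := hinz y h3
        by_contra h5
        exact h2 (h4 (by omega))
    · simp only [hl, false_and, if_false]
      exact h.pos_le l y
  · intro l y
    rw [hp, ha]
    by_cases hl : l = k
    · subst hl
      simp only [true_and]
      rcases eq_or_ne y x with h1 | h1
      · simp [h1]
      rcases eq_or_ne y z with h2 | h2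
      · have h3 : z ≠ x := h2 ▸ h1
        simp [h2, h3]
      simp only [h1, h2, if_false]
      split_ifs with h3
      · intro h4
        have := h.pos_le l y h4
        exact absurd (hinj y h4 (by omega)) h1
      · exact h.arr_pos l y
    · simp only [hl, false_and, if_false]
      exact h.arr_pos l y
  · intro l i
    rw [hc, ha, hp]
    by_cases hl : l = k
    · subst hl
      simp only [true_and, if_true]
      intro hi
      have h1 := h.pos_arr l i (by omega)
      by_cases hi' : i = posOf M l x - 1
      · have : z ≠ x := fun h2 => by rw [h2] at hpz; omega
        rw [if_pos hi', if_neg this, if_pos rfl]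
        omega
      · rw [if_neg hi', if_neg, if_neg, h1]
        · intro h2
          rw [h2] at h1
          omega
        · intro h2
          rw [h2] at h1
          omega
    · simp only [hl, false_and, if_false]
      exact h.pos_arr l i
  · intro l y
    rw [hp]
    split_ifs with h1 h2
    · simp [h1]
    · obtain ⟨rfl, rfl⟩ := h2
      simp only [ne_eq, hx, not_false_eq_true, hpz, true_iff]
      omega
    · simp [h1]
  · intro l y h1
    rw [hp]
    split_ifs with h2 h3
    · obtain ⟨rfl, rfl⟩ := h2
      rcases h1 with h1 | h1
      · exact absurd rfl h1
      · omega
    · obtain ⟨rfl, rfl⟩ := h3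
      rcases h1 with h1 | h1
      · exact absurd rfl h1
      · omega
    · rfl
  · intro g a b hg
    simp only [eraseMem, Function.update_apply, loc_inj (by omega : g < 16) (by norm_num : 7 < 16),
      loc_inj (by omega : g < 16) (by norm_num : 9 < 16), loc_inj (by omega : g < 16) (by norm_num : 8 < 16)]
    have : g ≠ 7 ∧ g ≠ 8 ∧ g ≠ 9 := by omega
    simp [this]

/-- The statement that only lets time pass. -/
def skip : Stmt := .assign 49 (.const 0)

/-- Insertion of variable `41` into the set with key variable `40`. -/
def setInsert : Stmt :=
  .ite (.const 0) (.cell 9 (.var 40) (.var 41)) skip <|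
  .seq (.assign 42 (.cell 7 (.var 40) (.const 0))) <|
  .seq (.store 8 (.var 40) (.var 42) (.var 41)) <|
  .seq (.store 9 (.var 40) (.var 41) (.op .add (.var 42) (.const 1))) <|
  .store 7 (.var 40) (.const 0) (.op .add (.var 42) (.const 1))

/-- Removal of variable `41` from the set with key variable `40`. -/
def setErase : Stmt :=
  .seq (.assign 42 (.cell 9 (.var 40) (.var 41))) <|
  .ite (.const 0) (.var 42)
    (.seq (.assign 43 (.op .sub (.cell 7 (.var 40) (.const 0)) (.const 1))) <|
     .seq (.assign 44 (.cell 8 (.var 40) (.var 43))) <|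
     .seq (.store 8 (.var 40) (.op .sub (.var 42) (.const 1)) (.var 44)) <|
     .seq (.store 9 (.var 40) (.var 44) (.var 42)) <|
     .seq (.store 9 (.var 40) (.var 41) (.const 0)) <|
     .store 7 (.var 40) (.const 0) (.var 43))
    skip

/-- Numbers up to `Y` can be used as indices. -/
structure Fits (w Y : ℕ) : Prop where
  sq : 64 * Y ^ 2 + 16 * Y + 16 ≤ 2 ^ w

section

variable {w Y : ℕ} {inp : List ℕ}

theorem Fits.lt (h : Fits w Y) {a : ℕ} (ha : a ≤ Y + 1) : a < 2 ^ w := by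
  have := h.sq
  nlinarith [sq_nonneg Y]

theorem Fits.loc (h : Fits w Y) {g a b : ℕ} (ha : a ≤ Y) (hb : b ≤ Y) (hg : g < 16 := by norm_num) :
    loc g a b < 2 ^ w :=
  loc_lt hg ha hb h.sq

theorem Fits.ne_zero (h : Fits w Y) : w ≠ 0 := by
  rintro rfl
  have := h.lt (a := 1) (by omega)
  omega

/-- An element that is already present is left alone, so callers need not test membership first;
`refresh` relies on this. -/
theorem setInsert_spec (hY : Fits w Y) {σ : State} (h : SetsWF σ.mem) {Z : ℕ} (hZ : Z ≤ Y)
    (h1 : σ.v 40 ≤ Y) (h2 : σ.v 41 < Z) (h3 : ∀ x, posOf σ.mem (σ.v 40) x ≠ 0 → x < Z) :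
    wp w inp setInsert (fun σ' => IsInsert σ.mem σ'.mem (σ.v 40) (σ.v 41) ∧
      (∀ r < 42, σ'.v r = σ.v r) ∧ σ'.time ≤ σ.time + 120) σ := by
  have hc := h.cnt_le h3
  have hw0 : w ≠ 0 := hY.ne_zero
  have l1 := hY.loc (g := 9) h1 (b := σ.v 41) (by omega)
  have l2 := hY.loc (g := 7) h1 (b := 0) (by omega)
  have l3 := hY.loc (g := 8) h1 (b := cntOf σ.mem (σ.v 40)) (by omega)
  have l4 : cntOf σ.mem (σ.v 40) + 1 < 2 ^ w := hY.lt (by omega)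
  refine wp_ite (by simp) (by simp [l1]) (fun hlt => ?_) (fun hle => ?_)
  · refine wp_assign (by simp) (by simp) ⟨?_, ?_, by simp⟩
    · simp only [Expr.eval] at hlt
      refine ⟨h, ?_, fun _ _ _ => rfl, fun _ _ _ _ => rfl⟩
      intro l y
      constructor
      · exact Or.inl
      · rintro (h | ⟨rfl, rfl⟩)
        · exact h
        · exact hlt.ne'
    · intro r hr
      have : r ≠ 49 := by omega
      simp [this]
  · have hx : posOf σ.mem (σ.v 40) (σ.v 41) = 0 := by simpa [posOf] using hle
    refine wp_seq (wp_assign (by simp) (by simp [l2]) ?_)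
    refine wp_seq (wp_store (by simp) (by simp) (by simp) (by simpa [cntOf] using l3) ?_)
    refine wp_seq (wp_store (by simp) (by simp) (by simpa [cntOf, hw0] using l4) (by simpa using l1) ?_)
    refine wp_store (by simp) (by simp) (by simpa [cntOf, hw0] using l4) (by simpa using l2) ⟨?_, ?_, ?_⟩
    · simpa [insMem, cntOf] using insMem_isInsert h hx
    · intro r hr
      have : r ≠ 42 := by omega
      simp [this]
    · simp

theorem setErase_spec (hY : Fits w Y) {σ : State} (h : SetsWF σ.mem) {Z : ℕ} (hZ : Z ≤ Y)
    (h1 : σ.v 40 ≤ Y) (h2 : σ.v 41 ≤ Y) (h3 : ∀ x, posOf σ.mem (σ.v 40) x ≠ 0 → x < Z) :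
    wp w inp setErase (fun σ' => IsErase σ.mem σ'.mem (σ.v 40) (σ.v 41) ∧
      (∀ r < 42, σ'.v r = σ.v r) ∧ σ'.time ≤ σ.time + 180) σ := by
  have hc := h.cnt_le h3
  have hw0 : w ≠ 0 := hY.ne_zero
  have l1 := hY.loc (g := 9) h1 h2
  refine wp_seq (wp_assign (by simp) (by simp [l1]) ?_)
  refine wp_ite (by simp) (by simp) (fun hlt => ?_) (fun hle => ?_)
  · have hx : posOf σ.mem (σ.v 40) (σ.v 41) ≠ 0 := by
      simpa [posOf, Nat.pos_iff_ne_zero] using hlt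
    have hle := h.pos_le _ _ hx
    have hz : arrOf σ.mem (σ.v 40) (cntOf σ.mem (σ.v 40) - 1) < Z := by
      apply h3
      rw [h.pos_arr _ _ (by omega)]
      omega
    have l2 := hY.loc (g := 7) h1 (b := 0) (by omega)
    have l3 := hY.loc (g := 8) h1 (b := cntOf σ.mem (σ.v 40) - 1) (by omega)
    have l4 : cntOf σ.mem (σ.v 40) < 2 ^ w := hY.lt (by omega)
    have l5 := hY.loc (g := 8) h1 (b := posOf σ.mem (σ.v 40) (σ.v 41) - 1) (by omega)
    have l6 := hY.loc (g := 9) h1 (b := arrOf σ.mem (σ.v 40) (cntOf σ.mem (σ.v 40) - 1)) (by omega)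
    have l7 : posOf σ.mem (σ.v 40) (σ.v 41) < 2 ^ w := by omega
    have l8 : 1 ≤ cntOf σ.mem (σ.v 40) := by omega
    have l9 : 1 ≤ posOf σ.mem (σ.v 40) (σ.v 41) := by omega
    refine wp_seq (wp_assign (by simp) (by simpa [cntOf, hw0] using ⟨l2, l8, l4⟩) ?_)
    refine wp_seq (wp_assign (by simp) (by simpa [cntOf] using l3) ?_)
    refine wp_seq (wp_store (by simp) (by simpa [posOf, hw0] using ⟨l9, l7⟩) (by simp) (by simpa [posOf] using l5) ?_)
    refine wp_seq (wp_store (by simp) (by simp) (by simp) (by simpa [arrOf, cntOf] using l6) ?_)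
    refine wp_seq (wp_store (by simp) (by simp) (by simp) (by simpa using l1) ?_)
    refine wp_store (by simp) (by simp) (by simp) (by simpa using l2) ⟨?_, ?_, ?_⟩
    · simpa [eraseMem, cntOf, posOf, arrOf] using eraseMem_isErase h hx
    · intro r hr
      have : r ≠ 42 := by omega
      have : r ≠ 43 := by omega
      have : r ≠ 44 := by omega
      simp [*]
    · simp
  · have hx : posOf σ.mem (σ.v 40) (σ.v 41) = 0 := by simpa [posOf] using hle
    refine wp_assign (by simp) (by simp) ⟨?_, ?_, by simp⟩
    · refine ⟨h, ?_, fun _ _ _ => rfl, fun _ _ _ _ => rfl⟩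
      intro l y
      constructor
      · intro h3
        refine ⟨h3, ?_⟩
        rintro ⟨rfl, rfl⟩
        exact h3 hx
      · exact And.left
    · intro r hr
      have : r ≠ 42 := by omega
      have : r ≠ 49 := by omega
      simp [*]

end

/-! ### The potential function

Hyperedges are numbers below `Z`, with vertex lists `vs t` and levels `lev t`, which are powers of
two, or `0` if the hyperedge is absent. The weight of `t` is the inverse of `lev t`. Vertices are
numbers below `n` and have levels `pv v`. -/

/-- The least number of indices to be left out so that the rest has weight at most `1`. -/
noncomputable def excess (Z : ℕ) (g : ℕ → ℝ) : ℕ :=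
  sInf {k | ∃ A : Finset ℕ, A.card = k ∧ ∑ t ∈ Finset.range Z \ A, g t ≤ 1}

section Excess

variable {Z : ℕ} {g h : ℕ → ℝ}

theorem excess_le {A : Finset ℕ} (hA : ∑ t ∈ Finset.range Z \ A, g t ≤ 1) : excess Z g ≤ A.card :=
  Nat.sInf_le ⟨A, rfl, hA⟩

theorem exists_excess (Z : ℕ) (g : ℕ → ℝ) :
    ∃ A : Finset ℕ, A.card = excess Z g ∧ ∑ t ∈ Finset.range Z \ A, g t ≤ 1 :=
  Nat.sInf_mem (s := {k | ∃ A : Finset ℕ, A.card = k ∧ ∑ t ∈ Finset.range Z \ A, g t ≤ 1})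
    ⟨_, Finset.range Z, rfl, by simp⟩

theorem excess_mono (hgh : ∀ t, g t ≤ h t) : excess Z g ≤ excess Z h := by
  obtain ⟨A, h1, h2⟩ := exists_excess Z h
  rw [← h1]
  exact excess_le ((Finset.sum_le_sum fun t _ => hgh t).trans h2)

/-- Add the altered index to an optimal set of omitted indices; however large its weight has become,
it no longer counts. -/
theorem excess_le_succ {s : ℕ} (hgh : ∀ t, t ≠ s → g t = h t) (hs : 0 ≤ h s) :
    excess Z g ≤ excess Z h + 1 := by
  obtain ⟨A, h1, h2⟩ := exists_excess Z h
  rw [← h1]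
  refine (excess_le (A := insert s A) ?_).trans (Finset.card_insert_le s A)
  have h3 : ∑ t ∈ Finset.range Z \ insert s A, g t = ∑ t ∈ (Finset.range Z \ A).erase s, h t := by
    refine Finset.sum_congr ?_ ?_
    · ext t
      simp only [Finset.mem_sdiff, Finset.mem_insert, Finset.mem_erase]
      tauto
    · intro t ht
      exact hgh t (Finset.ne_of_mem_erase ht)
  rw [h3]
  refine le_trans ?_ h2
  by_cases hs' : s ∈ Finset.range Z \ A
  · have := Finset.add_sum_erase _ h hs'
    linarith
  · rw [Finset.erase_eq_of_notMem hs']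

theorem excess_eq_zero (hg : ∑ t ∈ Finset.range Z, g t ≤ 1) : excess Z g = 0 := by
  have := excess_le (Z := Z) (g := g) (A := ∅) (by simpa using hg)
  simpa using this

/-- The omitted indices must carry weight at least `2 - 1 = 1`, and each carries at most `1 / p`. -/
theorem le_excess {p : ℕ} (hp : 0 < p) (h0 : ∀ t, 0 ≤ g t) (hg : ∀ t, g t ≤ (p : ℝ)⁻¹)
    (hW : 2 ≤ ∑ t ∈ Finset.range Z, g t) : p ≤ excess Z g := by
  obtain ⟨A, h1, h2⟩ := exists_excess Z g
  rw [← h1]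
  have h3 : ∑ t ∈ Finset.range Z, g t ≤ ∑ t ∈ Finset.range Z \ A, g t + ∑ t ∈ A, g t := by
    rw [← Finset.sum_sdiff (Finset.inter_subset_left : Finset.range Z ∩ A ⊆ Finset.range Z),
      Finset.sdiff_inter_self_left]
    gcongr
    · exact fun i _ _ => h0 i
    · exact Finset.inter_subset_right
  have h4 : ∑ t ∈ A, g t ≤ A.card * (p : ℝ)⁻¹ := by
    rw [← nsmul_eq_mul]
    exact Finset.sum_le_card_nsmul _ _ _ fun t _ => hg t
  have hp' : (0 : ℝ) < p := by exact_mod_cast hp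
  have h5 : 1 ≤ (A.card : ℝ) * (p : ℝ)⁻¹ := by linarith
  rw [← div_eq_mul_inv, le_div_iff₀ hp'] at h5
  exact_mod_cast (by linarith : (p : ℝ) ≤ A.card)

end Excess

/-- The weight that the hyperedge `t` gives to the vertex `v`. -/
noncomputable def share (vs : ℕ → List ℕ) (lev : ℕ → ℕ) (v t : ℕ) : ℝ :=
  if v ∈ vs t then (lev t : ℝ)⁻¹ else 0

/-- The total weight at the vertex `v`. -/
noncomputable def load (Z : ℕ) (vs : ℕ → List ℕ) (lev : ℕ → ℕ) (v : ℕ) : ℝ :=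
  ∑ t ∈ Finset.range Z, share vs lev v t

/-- The potential of a vertex with level `p`, where `g` lists the weights of its hyperedges. -/
noncomputable def localPotential (cT cD : ℝ) (Z : ℕ) (g : ℕ → ℝ) (p : ℕ) : ℝ :=
  cT * max 0 (2 * (excess Z g : ℝ) - (p : ℝ)) +
    cD * if 1 < p then (p : ℝ) * max 0 (1 - ∑ t ∈ Finset.range Z, g t) else 0

/-- The potential. -/
noncomputable def potential (cT cD : ℝ) (n Z : ℕ) (vs : ℕ → List ℕ) (lev pv : ℕ → ℕ) : ℝ :=
  ∑ v ∈ Finset.range n, localPotential cT cD Z (share vs lev v) (pv v)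

section Potential

variable {cT cD : ℝ} {n Z : ℕ} {vs : ℕ → List ℕ} {lev pv : ℕ → ℕ}

theorem share_nonneg (v t : ℕ) : 0 ≤ share vs lev v t := by
  unfold share
  split_ifs <;> positivity

theorem localPotential_nonneg (hT : 0 ≤ cT) (hD : 0 ≤ cD) (g : ℕ → ℝ) (p : ℕ) :
    0 ≤ localPotential cT cD Z g p := by
  unfold localPotential
  have : 0 ≤ if 1 < p then (p : ℝ) * max 0 (1 - ∑ t ∈ Finset.range Z, g t) else 0 := by
    split_ifs <;> positivity
  positivity

theorem potential_nonneg (hT : 0 ≤ cT) (hD : 0 ≤ cD) : 0 ≤ potential cT cD n Z vs lev pv :=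
  Finset.sum_nonneg fun _ _ => localPotential_nonneg hT hD _ _

theorem share_update_of_ne {t s p v : ℕ} (h : s ≠ t) :
    share vs (Function.update lev t p) v s = share vs lev v s := by
  simp [share, h]

theorem share_update_of_notMem {t p v : ℕ} (h : v ∉ vs t) :
    share vs (Function.update lev t p) v = share vs lev v := by
  funext s
  rcases eq_or_ne s t with rfl | hs
  · simp [share, h]
  · exact share_update_of_ne hs

theorem share_update_self {t p v : ℕ} (h : v ∈ vs t) :
    share vs (Function.update lev t p) v t = (p : ℝ)⁻¹ := by
  simp [share, h]

/-- Because the inverse of 0 is 0, the formula includes the levels `0` of absent hyperedges;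
insertion and deletion are changes of level like any other. -/
theorem sum_share_update {t p v : ℕ} (ht : t < Z) (h : v ∈ vs t) :
    load Z vs (Function.update lev t p) v = load Z vs lev v - (lev t : ℝ)⁻¹ + (p : ℝ)⁻¹ := by
  unfold load
  rw [← Finset.add_sum_erase _ _ (Finset.mem_range.2 ht),
    ← Finset.add_sum_erase _ (share vs lev v) (Finset.mem_range.2 ht), share_update_self h,
    Finset.sum_congr rfl fun s hs => share_update_of_ne (Finset.ne_of_mem_erase hs)]
  simp only [share, h, if_true]
  ring

theorem load_update_of_notMem {t p v : ℕ} (h : v ∉ vs t) :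
    load Z vs (Function.update lev t p) v = load Z vs lev v := by
  unfold load
  rw [share_update_of_notMem h]

/-- Only the at most `f` vertices of a hyperedge notice a change of its level; this is the source of
the factor `f` in the potential estimates. -/
theorem sum_indicator_le {t f : ℕ} (hf : (vs t).length ≤ f) {c : ℝ} (hc : 0 ≤ c) :
    ∑ v ∈ Finset.range n, (if v ∈ vs t then c else 0) ≤ c * f := by
  rw [← Finset.sum_filter, Finset.sum_const, nsmul_eq_mul, mul_comm]
  gcongr
  refine le_trans ?_ hf
  refine (Finset.card_le_card ?_).trans (List.toFinset_card_le (vs t))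
  intro v
  simp

/-- The effect of lowering the weight of a hyperedge. -/
theorem potential_raise {t p f : ℕ} (hT : 0 ≤ cT) (hD : 0 ≤ cD) (ht : t < Z)
    (hf : (vs t).length ≤ f) (hp : (p : ℝ)⁻¹ ≤ (lev t : ℝ)⁻¹)
    (hv : ∀ v ∈ vs t, pv v * ((lev t : ℝ)⁻¹ - (p : ℝ)⁻¹) ≤ 1) :
    potential cT cD n Z vs (Function.update lev t p) pv ≤ potential cT cD n Z vs lev pv + cD * f := by
  refine le_trans ?_ (add_le_add le_rfl (sum_indicator_le (n := n) hf hD))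
  unfold potential
  rw [← Finset.sum_add_distrib]
  refine Finset.sum_le_sum fun v _ => ?_
  split_ifs with h
  · unfold localPotential
    have h1 : excess Z (share vs (Function.update lev t p) v) ≤ excess Z (share vs lev v) := by
      refine excess_mono fun s => ?_
      rcases eq_or_ne s t with rfl | hs
      · rw [share_update_self h]
        simpa [share, h] using hp
      · rw [share_update_of_ne hs]
    have h1' : (excess Z (share vs (Function.update lev t p) v) : ℝ) ≤ excess Z (share vs lev v) := by
      exact_mod_cast h1
    have h2 := sum_share_update (lev := lev) (p := p) ht h
    unfold load at h2
    -- The deficit `1 - load` grows by at most the lost weight, and `hv` says that the level times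
    -- the lost weight is at most 1.
    have h3 : (if 1 < pv v then (pv v : ℝ) *
          max 0 (1 - ∑ s ∈ Finset.range Z, share vs (Function.update lev t p) v s) else 0) ≤
        (if 1 < pv v then (pv v : ℝ) * max 0 (1 - ∑ s ∈ Finset.range Z, share vs lev v s) else 0)
          + 1 := by
      split_ifs
      · have h4 := hv v h
        have h5 : max 0 (1 - ∑ s ∈ Finset.range Z, share vs (Function.update lev t p) v s) ≤
            max 0 (1 - ∑ s ∈ Finset.range Z, share vs lev v s) + ((lev t : ℝ)⁻¹ - (p : ℝ)⁻¹) := by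
          rw [h2]
          refine max_le ?_ ?_
          · have := le_max_left 0 (1 - ∑ s ∈ Finset.range Z, share vs lev v s)
            linarith
          · have := le_max_right 0 (1 - ∑ s ∈ Finset.range Z, share vs lev v s)
            linarith
        calc _ ≤ (pv v : ℝ) * (max 0 (1 - ∑ s ∈ Finset.range Z, share vs lev v s) +
              ((lev t : ℝ)⁻¹ - (p : ℝ)⁻¹)) := by gcongr
          _ ≤ _ := by linarith
      · simp
    have h6 := mul_le_mul_of_nonneg_left h3 hD
    have h7 : cT * max 0 (2 * (excess Z (share vs (Function.update lev t p) v) : ℝ) - pv v) ≤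
        cT * max 0 (2 * (excess Z (share vs lev v) : ℝ) - pv v) := by gcongr
    linarith
  · rw [share_update_of_notMem h, add_zero]

/-- The effect of increasing the weight of a hyperedge. -/
theorem potential_lower {t p f : ℕ} (hT : 0 ≤ cT) (hD : 0 ≤ cD) (ht : t < Z)
    (hf : (vs t).length ≤ f) (hp : (lev t : ℝ)⁻¹ ≤ (p : ℝ)⁻¹) :
    potential cT cD n Z vs (Function.update lev t p) pv ≤
      potential cT cD n Z vs lev pv + 2 * cT * f := by
  refine le_trans ?_ (add_le_add le_rfl (sum_indicator_le (n := n) hf (by positivity)))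
  unfold potential
  rw [← Finset.sum_add_distrib]
  refine Finset.sum_le_sum fun v _ => ?_
  split_ifs with h
  · unfold localPotential
    -- A single heavier hyperedge raises `excess` by at most 1, hence `2 * excess - p` by at most 2;
    -- the deficit can only shrink.
    have h1 : excess Z (share vs (Function.update lev t p) v) ≤ excess Z (share vs lev v) + 1 :=
      excess_le_succ (s := t) (fun s hs => share_update_of_ne hs) (share_nonneg _ _)
    have h1' : (excess Z (share vs (Function.update lev t p) v) : ℝ) ≤
        excess Z (share vs lev v) + 1 := by exact_mod_cast h1
    have h2 := sum_share_update (lev := lev) (p := p) ht h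
    unfold load at h2
    have h3 : (if 1 < pv v then (pv v : ℝ) *
          max 0 (1 - ∑ s ∈ Finset.range Z, share vs (Function.update lev t p) v s) else 0) ≤
        (if 1 < pv v then (pv v : ℝ) *
          max 0 (1 - ∑ s ∈ Finset.range Z, share vs lev v s) else 0) := by
      split_ifs
      · refine mul_le_mul_of_nonneg_left (max_le_max le_rfl ?_) (by positivity)
        rw [h2]
        linarith
      · rfl
    have h6 := mul_le_mul_of_nonneg_left h3 hD
    have h7 : max 0 (2 * (excess Z (share vs (Function.update lev t p) v) : ℝ) - pv v) ≤
        max 0 (2 * (excess Z (share vs lev v) : ℝ) - pv v) + 2 := by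
      refine max_le ?_ ?_
      · have := le_max_left 0 (2 * (excess Z (share vs lev v) : ℝ) - pv v)
        linarith
      · have := le_max_right 0 (2 * (excess Z (share vs lev v) : ℝ) - pv v)
        linarith
    have h8 := mul_le_mul_of_nonneg_left h7 hT
    linarith
  · rw [share_update_of_notMem h, add_zero]

theorem potential_update_pv {v p : ℕ} (hv : v < n) :
    potential cT cD n Z vs lev (Function.update pv v p) =
      potential cT cD n Z vs lev pv - localPotential cT cD Z (share vs lev v) (pv v) +
        localPotential cT cD Z (share vs lev v) p := by
  unfold potential
  rw [← Finset.add_sum_erase _ _ (Finset.mem_range.2 hv),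
    ← Finset.add_sum_erase _ (fun v => localPotential cT cD Z (share vs lev v) (pv v))
      (Finset.mem_range.2 hv),
    Finset.sum_congr rfl fun s hs => by rw [Function.update_of_ne (Finset.ne_of_mem_erase hs)]]
  simp only [Function.update_self]
  ring

/-- The potential that is released when the level of a vertex goes up. -/
theorem potential_up {v : ℕ} (hv : v < n) (hp : 0 < pv v)
    (hlev : ∀ t, v ∈ vs t → lev t ≠ 0 → pv v ≤ lev t) (hW : 2 ≤ load Z vs lev v) :
    potential cT cD n Z vs lev (Function.update pv v (2 * pv v)) + cT * pv v ≤
      potential cT cD n Z vs lev pv := by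
  -- Every weight at `v` is at most the inverse of its level, so `le_excess` applies. Then `2 *
  -- excess - p` is nonnegative for the old and for the doubled level, and the term falls by exactly
  -- `pv v`.
  have h1 : pv v ≤ excess Z (share vs lev v) := by
    refine le_excess hp (share_nonneg v) (fun t => ?_) hW
    unfold share
    split_ifs with h
    · rcases Nat.eq_zero_or_pos (lev t) with h0 | h0
      · simp [h0]
      · have : (0 : ℝ) < pv v := by exact_mod_cast hp
        have : (pv v : ℝ) ≤ lev t := by exact_mod_cast hlev t h h0.ne'
        gcongr
    · positivity
  have h1' : (pv v : ℝ) ≤ excess Z (share vs lev v) := by exact_mod_cast h1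
  have h2 : max 0 (1 - ∑ t ∈ Finset.range Z, share vs lev v t) = 0 := by
    refine max_eq_left ?_
    unfold load at hW
    linarith
  have h0 : (0 : ℝ) ≤ pv v := by positivity
  rw [potential_update_pv hv]
  unfold localPotential
  rw [h2]
  push_cast
  rw [max_eq_right (by linarith), max_eq_right (by linarith)]
  simp only [mul_zero, ite_self]
  linarith

/-- The potential that is released when the level of a vertex goes down. -/
theorem potential_down {v p : ℕ} (hD : 0 ≤ cD) (hv : v < n) (hp : pv v = 2 * p) (hp0 : 0 < p)
    (hW : load Z vs lev v ≤ 1 / 2) :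
    potential cT cD n Z vs lev (Function.update pv v p) + cD * p / 2 ≤
      potential cT cD n Z vs lev pv := by
  have h1 : excess Z (share vs lev v) = 0 := excess_eq_zero (by unfold load at hW; linarith)
  have h0 : (0 : ℝ) ≤ p := by positivity
  -- The load is at most `1 / 2`, so the deficit is at least `1 / 2`, and its coefficient falls from
  -- `2 * p` to at most `p`. As `excess` vanishes, the other term is zero before and after.
  have h2 : 1 / 2 ≤ max 0 (1 - ∑ t ∈ Finset.range Z, share vs lev v t) := by
    refine le_max_of_le_right ?_
    unfold load at hW
    linarith
  rw [potential_update_pv hv]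
  unfold localPotential
  rw [h1, hp, if_pos (by omega)]
  push_cast
  set m := max 0 (1 - ∑ t ∈ Finset.range Z, share vs lev v t)
  rw [max_eq_left (by linarith : 2 * (0 : ℝ) - 2 * p ≤ 0), max_eq_left (by linarith)]
  have h3 : (if 1 < p then (p : ℝ) * m else 0) ≤ p * m := by
    split_ifs
    · rfl
    · positivity
  have h4 := mul_le_mul_of_nonneg_left h3 hD
  have h5 : cD * (p * (1 / 2)) ≤ cD * (p * m) := by gcongr
  linarith

/-- Absent hyperedges do not matter. -/
theorem share_congr {vs' : ℕ → List ℕ} (h : ∀ t, lev t ≠ 0 → vs' t = vs t) (v : ℕ) :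
    share vs' lev v = share vs lev v := by
  funext t
  unfold share
  rcases eq_or_ne (lev t) 0 with h0 | h0
  · simp [h0]
  · rw [h t h0]

theorem potential_congr {vs' : ℕ → List ℕ} (h : ∀ t, lev t ≠ 0 → vs' t = vs t) :
    potential cT cD n Z vs' lev pv = potential cT cD n Z vs lev pv := by
  unfold potential
  simp only [share_congr h]

end Potential

/-! ### The routines of the data structure -/

/-- The level of the vertex `v`. -/
def pvOf (M : Mem) (v : ℕ) : ℕ := M (loc 4 v 0) + 1

/-- The scaled weight at the vertex `v`. -/
def wOf (M : Mem) (v : ℕ) : ℕ := M (loc 5 v 0)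

/-- The level of the hyperedge `t`. -/
def levOf (M : Mem) (t : ℕ) : ℕ := M (loc 6 t 0)

/-- The key of the set of the hyperedges of level `p` at the vertex `v`. -/
def key (v p : ℕ) : ℕ := v + (v + p) * (v + p) + 2

theorem key_inj {v p v' p' : ℕ} : key v p = key v' p' ↔ v = v' ∧ p = p' := by
  constructor
  · intro h
    unfold key at h
    exact add_sq_inj (by omega)
  · rintro ⟨rfl, rfl⟩
    rfl

/-- Keys 0 and 1 are reserved for the sets of vertices to be raised and to be lowered. -/
theorem two_le_key (v p : ℕ) : 2 ≤ key v p := by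
  unfold key
  omega

/-- An expression for `key`. -/
def keyExpr (a b : Expr) : Expr :=
  .op .add (.op .add a (.op .mul (.op .add a b) (.op .add a b))) (.const 2)

/-- Sizes fit into the word length. -/
structure Env (n Z w : ℕ) : Prop where
  n_le : n ≤ Z
  fits : Fits w (8 * Z ^ 2 + 1000)

section

variable {n Z w : ℕ} {inp : List ℕ}

theorem Env.key_le (_ : Env n Z w) {v p : ℕ} (hv : v ≤ Z) (hp : p ≤ Z) :
    key v p ≤ 8 * Z ^ 2 + 1000 := by
  unfold key
  have : (v + p) * (v + p) ≤ (Z + Z) * (Z + Z) := Nat.mul_le_mul (by omega) (by omega)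
  nlinarith

theorem Env.Z_le (_ : Env n Z w) : Z ≤ 8 * Z ^ 2 + 1000 := by nlinarith

theorem Env.lt (h : Env n Z w) {a : ℕ} (ha : a ≤ Z) : a < 2 ^ w :=
  h.fits.lt (ha.trans (h.Z_le.trans (by omega)))

theorem Env.w_ge (h : Env n Z w) : 10 ≤ w := by
  by_contra hw
  have := h.fits.sq
  have h2 : 2 ^ w ≤ 2 ^ 10 := Nat.pow_le_pow_right (by norm_num) (by omega)
  nlinarith [sq_nonneg (Z : ℤ)]

theorem Env.pow_eq (h : Env n Z w) : 2 ^ w = 16 * 2 ^ (w - 4) := by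
  have := h.w_ge
  rw [show (16 : ℕ) = 2 ^ 4 by norm_num, ← pow_add]
  congr 1
  omega

/-- The unit of weights exceeds all levels. A level is a power of two, so it divides the unit and
weights are stored without rounding. -/
theorem Env.Z_lt (h : Env n Z w) : 1000 * (Z + 1) ≤ 2 ^ (w - 4) := by
  have h1 := h.fits.sq
  rw [h.pow_eq] at h1
  have h2 : 1000 * (8 * Z ^ 2 + 1000) ≤ (8 * Z ^ 2 + 1000) ^ 2 := by nlinarith
  nlinarith [Nat.le_self_pow (two_ne_zero) Z]

theorem keyExpr_ok (h : Env n Z w) {a b : Expr} {σ : State} (ha : a.ok w inp σ) (hb : b.ok w inp σ)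
    (ha' : a.eval w inp σ ≤ Z) (hb' : b.eval w inp σ ≤ Z) : (keyExpr a b).ok w inp σ := by
  have h1 := h.fits.lt ((h.key_le ha' hb').trans (by omega))
  unfold key at h1
  set x := a.eval w inp σ with hx
  set y := b.eval w inp σ with hy
  have h2 : (x + y) * (x + y) < 2 ^ w := by omega
  have h3 : x + y < 2 ^ w := lt_of_le_of_lt (Nat.le_mul_self _) h2
  have h4 : 2 < 2 ^ w := h.fits.lt (by omega)
  simp only [keyExpr, Expr.ok, Expr.eval, Op.safe, Op.nat, ← hx, ← hy, ha, hb, true_and]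
  refine ⟨⟨⟨h3, h3, h2⟩, by omega⟩, h4, by omega⟩

@[simp] theorem keyExpr_eval {a b : Expr} {σ : State} :
    (keyExpr a b).eval w inp σ = key (a.eval w inp σ) (b.eval w inp σ) := rfl

@[simp] theorem keyExpr_cost {a b : Expr} :
    (keyExpr a b).cost = 3 * a.cost + 2 * b.cost + 6 := by
  simp only [keyExpr, Expr.cost]
  omega

/-- Update the membership of the vertex in variable `30` in the two sets of vertices to be treated;
variables `2` and `3` hold the thresholds. -/
def refresh : Stmt :=
  .seq (.assign 41 (.var 30)) <|
  .seq (.assign 40 (.const 0)) <|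
  .seq (.ite (.cell 5 (.var 30) (.const 0)) (.op .mul (.const 2) (.var 2)) setErase setInsert) <|
  .seq (.assign 40 (.const 1)) <|
  .ite (.cell 5 (.var 30) (.const 0)) (.var 3)
    (.ite (.const 0) (.cell 4 (.var 30) (.const 0)) setInsert setErase) setErase

/-- The result of `refresh`. -/
structure Refreshed (M M' : Mem) (Q θ v : ℕ) : Prop where
  wf : SetsWF M'
  up : posOf M' 0 v ≠ 0 ↔ 2 * Q ≤ wOf M v
  down : posOf M' 1 v ≠ 0 ↔ wOf M v < θ ∧ 1 < pvOf M v
  mem : ∀ k x, x ≠ v → (posOf M' k x ≠ 0 ↔ posOf M k x ≠ 0)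
  pos : ∀ k x, 2 ≤ k → posOf M' k x = posOf M k x
  other : ∀ g a b, g < 7 → M' (loc g a b) = M (loc g a b)

/-- The set with key `k` has been modified only at `x`, where membership is now decided by `P`. -/
structure SetAt (M M' : Mem) (k x : ℕ) (P : Prop) : Prop where
  wf : SetsWF M'
  self : posOf M' k x ≠ 0 ↔ P
  mem : ∀ l y, ¬(l = k ∧ y = x) → (posOf M' l y ≠ 0 ↔ posOf M l y ≠ 0)
  pos : ∀ l y, l ≠ k → posOf M' l y = posOf M l y
  other : ∀ g a b, g < 7 → M' (loc g a b) = M (loc g a b)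

theorem IsInsert.setAt {M M' : Mem} {k x : ℕ} (h : IsInsert M M' k x) {P : Prop} (hP : P) :
    SetAt M M' k x P :=
  ⟨h.wf, by simp [h.mem, hP], fun l y hl => by simp [h.mem, hl], fun l y hl => h.pos l y (.inl hl),
    h.other⟩

theorem IsErase.setAt {M M' : Mem} {k x : ℕ} (h : IsErase M M' k x) {P : Prop} (hP : ¬P) :
    SetAt M M' k x P :=
  ⟨h.wf, by simp [h.mem, hP], fun l y hl => by simp [h.mem, hl], fun l y hl => h.pos l y (.inl hl),
    h.other⟩

theorem SetAt.lt {M M' : Mem} {k x : ℕ} {P : Prop} (h : SetAt M M' k x P) {Z : ℕ} (hx : x < Z)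
    (hM : ∀ l y, posOf M l y ≠ 0 → y < Z) : ∀ l y, posOf M' l y ≠ 0 → y < Z := by
  intro l y hy
  by_cases hly : l = k ∧ y = x
  · omega
  · exact hM l y ((h.mem l y hly).1 hy)

theorem Env.loc (h : Env n Z w) {g a b : ℕ} (ha : a ≤ Z) (hb : b ≤ Z)
    (hg : g < 16 := by norm_num) : loc g a b < 2 ^ w :=
  h.fits.loc (ha.trans h.Z_le) (hb.trans h.Z_le) hg

theorem refresh_spec (hE : Env n Z w) {σ : State} {Q θ v : ℕ} (hQ : Q = 2 ^ (w - 4))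
    (h2 : σ.v 2 = Q) (h3 : σ.v 3 = θ) (h30 : σ.v 30 = v) (hv : v < Z) (hwf : SetsWF σ.mem)
    (hit : ∀ k x, posOf σ.mem k x ≠ 0 → x < Z) :
    wp w inp refresh (fun σ' => Refreshed σ.mem σ'.mem Q θ v ∧
      (∀ r < 40, σ'.v r = σ.v r) ∧ σ'.time ≤ σ.time + 450) σ := by
  have hw := hE.w_ge
  have hw0 : w ≠ 0 := by omega
  have hw1 : 2 < 2 ^ w := hE.fits.lt (by omega)
  have hp := hE.pow_eq
  have l0 := hE.loc (g := 5) hv.le (b := 0) (by omega)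
  have l1 := hE.loc (g := 4) hv.le (b := 0) (by omega)
  have hZ := hE.Z_le
  have q1 : 2 * Q < 2 ^ w := by
    have := pow_pos (show 0 < 2 by norm_num) (w - 4)
    omega
  refine wp_seq (wp_assign (by simp) (by simp) ?_)
  refine wp_seq (wp_assign (by simp) (by simp) ?_)
  have key1 : wp w inp (.ite (.cell 5 (.var 30) (.const 0)) (.op .mul (.const 2) (.var 2)) setErase
      setInsert) (fun σ' => SetAt σ.mem σ'.mem 0 v (2 * Q ≤ wOf σ.mem v) ∧
        (∀ r < 40, σ'.v r = σ.v r) ∧ σ'.v 41 = v ∧ σ'.time ≤ σ.time + 210)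
      ((σ.set 41 ((Expr.var 30).eval w inp σ) ((Expr.var 30).cost + 2)).set 40
        ((Expr.const 0).eval w inp (σ.set 41 ((Expr.var 30).eval w inp σ) ((Expr.var 30).cost + 2)))
        ((Expr.const 0).cost + 2)) := by
    refine wp_ite (by simpa [h30] using l0) (by simpa [h2, hw1] using q1) (fun hc => ?_)
      (fun hc => ?_)
    · refine wp.mono (setErase_spec hE.fits (Z := Z) hwf hZ (by simp) (by simp [h30]; omega)
        (fun x => hit _ x)) ?_
      rintro σ' ⟨ha, hb, hc'⟩
      refine ⟨?_, ?_, ?_, ?_⟩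
      · simp [h30] at ha
        refine ha.setAt ?_
        simpa [h30, h2, wOf] using hc
      · intro r hr
        rw [hb r (by omega)]
        simp [show r ≠ 40 by omega, show r ≠ 41 by omega]
      · rw [hb 41 (by omega)]
        simp [h30]
      · simp at hc'
        omega
    · refine wp.mono (setInsert_spec hE.fits (Z := Z) hwf hZ (by simp) (by simp [h30]; omega)
        (fun x => hit _ x)) ?_
      rintro σ' ⟨ha, hb, hc'⟩
      refine ⟨?_, ?_, ?_, ?_⟩
      · simp [h30] at ha
        refine ha.setAt ?_
        simpa [h30, h2, wOf] using hc
      · intro r hr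
        rw [hb r (by omega)]
        simp [show r ≠ 40 by omega, show r ≠ 41 by omega]
      · rw [hb 41 (by omega)]
        simp [h30]
      · simp at hc'
        omega
  refine wp_seq (key1.mono ?_)
  rintro σ1 ⟨hs1, hr1, h41, ht1⟩
  refine wp_seq (wp_assign (by simp) (by simp [hw0]) ?_)
  have hit1 := hs1.lt hv hit
  have e5 : wOf σ1.mem v = wOf σ.mem v := hs1.other 5 v 0 (by omega)
  have e4 : σ1.mem (loc 4 v 0) = σ.mem (loc 4 v 0) := hs1.other 4 v 0 (by omega)
  have key2 : wp w inp (.ite (.cell 5 (.var 30) (.const 0)) (.var 3)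
      (.ite (.const 0) (.cell 4 (.var 30) (.const 0)) setInsert setErase) setErase)
      (fun σ' => SetAt σ1.mem σ'.mem 1 v (wOf σ.mem v < θ ∧ 1 < pvOf σ.mem v) ∧
        (∀ r < 40, σ'.v r = σ.v r) ∧ σ'.time ≤ σ1.time + 230)
      (σ1.set 40 ((Expr.const 1).eval w inp σ1) ((Expr.const 1).cost + 2)) := by
    have h30' : σ1.v 30 = v := by rw [hr1 30 (by omega), h30]
    have h3' : σ1.v 3 = θ := by rw [hr1 3 (by omega), h3]
    refine wp_ite (by simpa [h30'] using l0) (by simp) (fun hc => ?_) (fun hc => ?_)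
    · refine wp_ite (by simp) (by simpa [h30'] using l1) (fun hd => ?_) (fun hd => ?_)
      · refine wp.mono (setInsert_spec hE.fits (Z := Z) hs1.wf hZ (by simp) (by simp [h41]; omega)
          (fun x => hit1 _ x)) ?_
        rintro σ' ⟨ha, hb, hc'⟩
        refine ⟨?_, ?_, ?_⟩
        · simp [h41] at ha
          refine ha.setAt ?_
          rw [← e5]
          simp [h30', h3', e4, wOf, pvOf] at hc hd ⊢
          omega
        · intro r hr
          rw [hb r (by omega), ← hr1 r hr]
          simp [show r ≠ 40 by omega]
        · simp at hc'
          omega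
      · refine wp.mono (setErase_spec hE.fits (Z := Z) hs1.wf hZ (by simp) (by simp [h41]; omega)
          (fun x => hit1 _ x)) ?_
        rintro σ' ⟨ha, hb, hc'⟩
        refine ⟨?_, ?_, ?_⟩
        · simp [h41] at ha
          refine ha.setAt ?_
          rw [← e5]
          simp [h30', h3', e4, wOf, pvOf] at hc hd ⊢
          omega
        · intro r hr
          rw [hb r (by omega), ← hr1 r hr]
          simp [show r ≠ 40 by omega]
        · simp at hc'
          omega
    · refine wp.mono (setErase_spec hE.fits (Z := Z) hs1.wf hZ (by simp) (by simp [h41]; omega)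
        (fun x => hit1 _ x)) ?_
      rintro σ' ⟨ha, hb, hc'⟩
      refine ⟨?_, ?_, ?_⟩
      · simp [h41] at ha
        refine ha.setAt ?_
        rw [← e5]
        simp [h30', h3', wOf, pvOf] at hc ⊢
        omega
      · intro r hr
        rw [hb r (by omega), ← hr1 r hr]
        simp [show r ≠ 40 by omega]
      · simp at hc'
        omega
  refine key2.mono ?_
  rintro σ2 ⟨hs2, hr2, ht2⟩
  refine ⟨⟨hs2.wf, ?_, hs2.self, ?_, ?_, ?_⟩, hr2, by omega⟩
  · rw [hs2.mem 0 v (by simp), hs1.self]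
  · intro k x hx
    rw [hs2.mem k x (by simp [hx]), hs1.mem k x (by simp [hx])]
  · intro k x hk
    rw [hs2.pos k x (by omega), hs1.pos k x (by omega)]
  · intro g a b hg
    rw [hs2.other g a b hg, hs1.other g a b hg]

end

/-! ### Changing the level of a hyperedge -/

/-- For the hyperedge in variable `24`, whose level changes from variable `26` to variable `25`,
adjust the data of the vertex in variable `28`. -/
def touch : Stmt :=
  .seq (.assign 29 (.op .sub (.op .add (.cell 5 (.var 28) (.const 0)) (.op .div (.var 2) (.var 25)))
    (.op .div (.var 2) (.var 26)))) <|
  .seq (.store 5 (.var 28) (.const 0) (.var 29)) <|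
  .seq (.assign 41 (.var 24)) <|
  .seq (.assign 40 (keyExpr (.var 28) (.var 26))) <|
  .seq setErase <|
  .seq (.assign 40 (keyExpr (.var 28) (.var 25))) <|
  .seq setInsert <|
  .seq (.assign 30 (.var 28)) refresh

/-- The result of `touch`. -/
structure Touched (M M' : Mem) (Q θ v t p p' : ℕ) : Prop where
  wf : SetsWF M'
  w_self : wOf M' v = wOf M v + Q / p' - Q / p
  mem : ∀ k x, 2 ≤ k → (posOf M' k x ≠ 0 ↔
    (posOf M k x ≠ 0 ∧ ¬(k = key v p ∧ x = t)) ∨ (k = key v p' ∧ x = t))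
  pos : ∀ k x, 2 ≤ k → k ≠ key v p ∨ posOf M k x < posOf M k t → k ≠ key v p' →
    posOf M' k x = posOf M k x
  up : posOf M' 0 v ≠ 0 ↔ 2 * Q ≤ wOf M' v
  down : posOf M' 1 v ≠ 0 ↔ wOf M' v < θ ∧ 1 < pvOf M v
  low : ∀ k x, k < 2 → x ≠ v → (posOf M' k x ≠ 0 ↔ posOf M k x ≠ 0)
  other : ∀ g a b, g < 7 → g ≠ 5 ∨ a ≠ v ∨ b ≠ 0 → M' (loc g a b) = M (loc g a b)

section

variable {n Z w : ℕ} {inp : List ℕ}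

/-- The new weight is added before the old one is subtracted: the sum is at most `4 * Q`, far below
`2 ^ w = 16 * Q`, and `hpW` keeps the difference from being negative. -/
theorem touch_spec (hE : Env n Z w) {σ : State} {Q θ v t p p' : ℕ} (hQ : Q = 2 ^ (w - 4))
    (h2 : σ.v 2 = Q) (h3 : σ.v 3 = θ) (h24 : σ.v 24 = t) (h25 : σ.v 25 = p') (h26 : σ.v 26 = p)
    (h28 : σ.v 28 = v) (hv : v < Z) (ht : t < Z) (hp : p ≤ Z) (hp' : p' ≤ Z)
    (hwf : SetsWF σ.mem) (hit : ∀ k x, posOf σ.mem k x ≠ 0 → x < Z)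
    (hW : wOf σ.mem v ≤ 3 * Q) (hpW : Q / p ≤ wOf σ.mem v + Q / p') :
    wp w inp touch (fun σ' => Touched σ.mem σ'.mem Q θ v t p p' ∧
      (∀ k x, posOf σ'.mem k x ≠ 0 → x < Z) ∧
      (∀ r < 29, σ'.v r = σ.v r) ∧ σ'.time ≤ σ.time + 1000) σ := by
  have hw := hE.w_ge
  have hZ := hE.Z_le
  have hpw := hE.pow_eq
  have hQ0 : 0 < Q := by rw [hQ]; positivity
  have hdiv : Q / p' ≤ Q := Nat.div_le_self _ _
  have l0 := hE.loc (g := 5) hv.le (b := 0) (by omega)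
  have hkp := hE.key_le hv.le hp
  have hkp' := hE.key_le hv.le hp'
  have hWlt : wOf σ.mem v + Q / p' < 2 ^ w := by rw [hpw, ← hQ]; omega
  refine wp_seq (wp_assign (by simp) ?_ ?_)
  · simp only [Expr.ok, Expr.eval, Op.safe, Op.nat, h2, h25, h26, h28]
    refine ⟨⟨⟨by norm_num, by positivity, l0⟩, ⟨by norm_num, by norm_num, trivial⟩, hWlt⟩,
      ⟨by norm_num, by norm_num, trivial⟩, hpW, hWlt⟩
  refine wp_seq (wp_store (by simp) (by simp) (by simp) (by simpa [h28] using l0) ?_)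
  refine wp_seq (wp_assign (by simp) (by simp) ?_)
  refine wp_seq (wp_assign (by simp) (keyExpr_ok hE (by simp) (by simp) (by simpa [h28] using hv.le)
    (by simpa [h26] using hp)) ?_)
  set σ1 := State.set _ 40 _ _ with hσ1
  have m1 : σ1.mem = Function.update σ.mem (loc 5 v 0) (wOf σ.mem v + Q / p' - Q / p) := by
    simp [hσ1, h28, h2, h25, h26, wOf]
  have hg1 : ∀ g a b, g < 16 → g ≠ 5 ∨ a ≠ v ∨ b ≠ 0 → σ1.mem (loc g a b) = σ.mem (loc g a b) := by
    intro g a b hg hn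
    rw [m1, Function.update_of_ne]
    rw [Ne, loc_inj hg (by norm_num)]
    omega
  have e1 : ∀ k x, posOf σ1.mem k x = posOf σ.mem k x := fun k x => hg1 9 k x (by omega) (by omega)
  have e2 : ∀ k x, arrOf σ1.mem k x = arrOf σ.mem k x := fun k x => hg1 8 k x (by omega) (by omega)
  have e3 : ∀ k, cntOf σ1.mem k = cntOf σ.mem k := fun k => hg1 7 k 0 (by omega) (by omega)
  have e4 : wOf σ1.mem v = wOf σ.mem v + Q / p' - Q / p := by
    simp [wOf, m1]
  have hwf1 : SetsWF σ1.mem := by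
    refine ⟨fun k x => ?_, fun k x => ?_, fun k i => ?_⟩
    · rw [e1, e3]; exact hwf.pos_le k x
    · rw [e1, e2]; exact hwf.arr_pos k x
    · rw [e3, e2, e1]; exact hwf.pos_arr k i
  have hit1 : ∀ k x, posOf σ1.mem k x ≠ 0 → x < Z := fun k x => by rw [e1]; exact hit k x
  have v40 : σ1.v 40 = key v p := by simp [hσ1, h28, h26]
  have v41 : σ1.v 41 = t := by simp [hσ1, h24]
  have vlt : ∀ r < 29, σ1.v r = σ.v r := by
    intro r hr
    simp [hσ1, show r ≠ 29 by omega, show r ≠ 40 by omega, show r ≠ 41 by omega]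
  have t1 : σ1.time ≤ σ.time + 80 := by simp [hσ1]
  clear_value σ1
  refine wp_seq (wp.mono (setErase_spec hE.fits (Z := Z) hwf1 hZ (by omega) (by omega)
    (fun x => hit1 _ x)) ?_)
  rintro σ2 ⟨hs2, hr2, ht2⟩
  rw [v40, v41] at hs2
  have hit2 : ∀ k x, posOf σ2.mem k x ≠ 0 → x < Z := fun k x hx => hit1 k x ((hs2.mem k x).1 hx).1
  have vlt2 : ∀ r < 29, σ2.v r = σ.v r := fun r hr => by rw [hr2 r (by omega), vlt r hr]
  refine wp_seq (wp_assign (by simp) (keyExpr_ok hE (by simp) (by simp)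
    (by simpa [vlt2 28, h28] using hv.le) (by simpa [vlt2 25, h25] using hp')) ?_)
  set σ3 := State.set _ 40 _ _ with hσ3
  have m3 : σ3.mem = σ2.mem := rfl
  have v340 : σ3.v 40 = key v p' := by simp [hσ3, vlt2 28, h28, vlt2 25, h25]
  have v341 : σ3.v 41 = t := by simp [hσ3, hr2 41, v41]
  have vlt3 : ∀ r < 29, σ3.v r = σ.v r := by
    intro r hr
    simp [hσ3, show r ≠ 40 by omega, vlt2 r hr]
  have t3 : σ3.time ≤ σ2.time + 30 := by simp [hσ3]
  clear_value σ3
  refine wp_seq (wp.mono (setInsert_spec hE.fits (Z := Z) (m3 ▸ hs2.wf) hZ (by omega) (by omega)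
    (fun x => m3 ▸ hit2 _ x)) ?_)
  rintro σ4 ⟨hs4, hr4, ht4⟩
  rw [v340, v341, m3] at hs4
  have hit4 : ∀ k x, posOf σ4.mem k x ≠ 0 → x < Z := by
    intro k x hx
    rcases (hs4.mem k x).1 hx with h | h
    · exact hit2 k x h
    · omega
  have vlt4 : ∀ r < 29, σ4.v r = σ.v r := fun r hr => by rw [hr4 r (by omega), vlt3 r hr]
  refine wp_seq (wp_assign (by simp) (by simp) ?_)
  refine wp.mono (refresh_spec hE (v := v) (θ := θ) hQ (by simp [vlt4 2, h2]) (by simp [vlt4 3, h3])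
    (by simp [vlt4 28, h28]) hv hs4.wf hit4) ?_
  rintro σ5 ⟨hs5, hr5, ht5⟩
  simp only [State.set] at hs5
  have e5 : ∀ g a b, g < 7 → σ5.mem (loc g a b) = σ1.mem (loc g a b) := fun g a b hg => by
    rw [hs5.other g a b hg, hs4.other g a b hg, hs2.other g a b hg]
  have e6 : wOf σ4.mem v = wOf σ5.mem v := (hs5.other 5 v 0 (by omega)).symm
  have e7 : pvOf σ4.mem v = pvOf σ.mem v := by
    unfold pvOf
    rw [hs4.other 4 v 0 (by omega), hs2.other 4 v 0 (by omega), hg1 4 v 0 (by omega) (by omega)]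
  refine ⟨⟨hs5.wf, ?_, ?_, ?_, ?_, ?_, ?_, ?_⟩, ?_, ?_, ?_⟩
  · rw [← e4]
    exact e5 5 v 0 (by omega)
  · intro k x hk
    rw [hs5.pos k x hk, hs4.mem, hs2.mem, e1]
  · intro k x hk h1 h2
    rw [hs5.pos k x hk, hs4.pos k x (.inl h2), hs2.pos k x (by simpa only [e1] using h1), e1]
  · rw [hs5.up, e6]
  · rw [hs5.down, e6, e7]
  · intro k x hk hx
    have h1 := two_le_key v p
    have h2 := two_le_key v p'
    rw [hs5.mem k x hx, hs4.mem, hs2.mem, e1]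
    constructor
    · rintro (h | h)
      · exact h.1
      · omega
    · intro h
      exact .inl ⟨h, by omega⟩
  · intro g a b hg hn
    rw [e5 g a b hg, hg1 g a b (by omega) hn]
  · intro k x hx
    rcases eq_or_ne x v with rfl | hxv
    · exact hv
    · exact hit4 k x ((hs5.mem k x hxv).1 hx)
  · intro r hr
    rw [hr5 r (by omega)]
    simp [show r ≠ 30 by omega, vlt4 r hr]
  · simp at ht5
    omega

end

/-! ### What the memory represents -/

/-- Levels of hyperedges. -/
def IsLevel (Z p : ℕ) : Prop := p = 0 ∨ (∃ i, p = 2 ^ i) ∧ p ≤ Z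

theorem IsLevel.le {Z p : ℕ} (h : IsLevel Z p) : p ≤ Z := by
  rcases h with rfl | h
  · exact Nat.zero_le _
  · exact h.2

/-- A power of two up to `2 ^ q` divides `2 ^ q`. For level `0`, both division by zero and the
inverse of zero give 0. -/
theorem IsLevel.cast_div {Z p q : ℕ} (h : IsLevel Z p) (hq : Z ≤ 2 ^ q) :
    ((2 ^ q / p : ℕ) : ℝ) = (2 ^ q : ℕ) * (p : ℝ)⁻¹ := by
  rcases h with rfl | ⟨⟨i, rfl⟩, hi⟩
  · simp
  · have : i ≤ q := (Nat.pow_le_pow_iff_right (by norm_num)).1 (hi.trans hq)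
    rw [Nat.cast_div (pow_dvd_pow 2 this) (by positivity), div_eq_mul_inv]

/-- The data of the vertex `v` are correct for the levels `lev` of the hyperedges. -/
structure LocalOK (Z Q θ : ℕ) (path : ℕ → List ℕ) (M : Mem) (lev : ℕ → ℕ) (v : ℕ) : Prop where
  load : (wOf M v : ℝ) = Q * load Z path lev v
  list : ∀ p t, p ≠ 0 → (posOf M (key v p) t ≠ 0 ↔ v ∈ path t ∧ lev t = p)
  up : posOf M 0 v ≠ 0 ↔ 2 * Q ≤ wOf M v
  down : posOf M 1 v ≠ 0 ↔ wOf M v < θ ∧ 1 < pvOf M v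

/-- The dictionary: the nodes `1, …, N` of a trie with root `0` represent the lists `path t`. -/
structure Trie (n N : ℕ) (path : ℕ → List ℕ) (M : Mem) : Prop where
  root : path 0 = []
  parent_lt : ∀ y, y ≠ 0 → y ≤ N → M (loc 1 y 0) < y
  path_eq : ∀ y, y ≠ 0 → y ≤ N → path y = path (M (loc 1 y 0)) ++ [M (loc 2 y 0)]
  inj : ∀ x ≤ N, ∀ y ≤ N, path x = path y → x = y
  child_zero : ∀ x ≤ N, ∀ v, M (loc 0 x v) = 0 → ∀ y ≤ N, path y ≠ path x ++ [v]
  child_ne : ∀ x ≤ N, ∀ v, M (loc 0 x v) ≠ 0 →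
    M (loc 0 x v) ≤ N ∧ path (M (loc 0 x v)) = path x ++ [v]
  fresh : ∀ x, N < x → ∀ v, M (loc 0 x v) = 0
  count : M (loc 3 0 0) = N
  lt : ∀ y ≤ N, ∀ v ∈ path y, v < n

/-- The memory represents a dictionary, levels of hyperedges and levels of vertices. -/
structure Rep (n Z w θ N : ℕ) (path : ℕ → List ℕ) (M : Mem) : Prop where
  trie : Trie n N path M
  wf : SetsWF M
  items : ∀ k x, posOf M k x ≠ 0 → x < Z
  low : ∀ k x, k < 2 → posOf M k x ≠ 0 → x < n
  lev_le : ∀ t, levOf M t ≠ 0 → t ≤ N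
  level : ∀ t, IsLevel Z (levOf M t)
  pv_level : ∀ v, IsLevel Z (pvOf M v)
  loc : ∀ v < n, LocalOK Z (2 ^ (w - 4)) θ path M (levOf M) v
  N_lt : N < Z

theorem Trie.congr {n N : ℕ} {path : ℕ → List ℕ} {M M' : Mem} (h : Trie n N path M)
    (hM : ∀ g a b, g < 4 → M' (loc g a b) = M (loc g a b)) : Trie n N path M' := by
  refine ⟨h.root, ?_, ?_, h.inj, ?_, ?_, ?_, ?_, h.lt⟩
  · simpa only [hM 1 _ 0 (by norm_num)] using h.parent_lt
  · simpa only [hM 1 _ 0 (by norm_num), hM 2 _ 0 (by norm_num)] using h.path_eq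
  · simpa only [hM 0 _ _ (by norm_num)] using h.child_zero
  · simpa only [hM 0 _ _ (by norm_num)] using h.child_ne
  · simpa only [hM 0 _ _ (by norm_num)] using h.fresh
  · rw [hM 3 0 0 (by norm_num), h.count]

/-! ### Moving one hyperedge -/

/-- Give the hyperedge in variable `24` the level in variable `25`. -/
def moveEdge : Stmt :=
  .seq (.assign 26 (.cell 6 (.var 24) (.const 0))) <|
  .seq (.store 6 (.var 24) (.const 0) (.var 25)) <|
  .seq (.assign 27 (.var 24)) <|
  .while (.const 0) (.var 27) <|
    .seq (.assign 28 (.cell 2 (.var 27) (.const 0))) <|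
    .seq touch <|
    .assign 27 (.cell 1 (.var 27) (.const 0))

/-- The result of `moveEdge`. -/
structure Moved (n Z w θ N : ℕ) (path : ℕ → List ℕ) (M M' : Mem) (t p' : ℕ) : Prop where
  rep : Rep n Z w θ N path M'
  lev : levOf M' = Function.update (levOf M) t p'
  pv : pvOf M' = pvOf M
  pos : ∀ v z, levOf M t ≠ p' → posOf M (key v (levOf M t)) z < posOf M (key v (levOf M t)) t →
    posOf M' (key v (levOf M t)) z = posOf M (key v (levOf M t)) z
  other : ∀ g a b, g < 4 → M' (loc g a b) = M (loc g a b)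

section

variable {n Z w θ N Q t p p' : ℕ} {path : ℕ → List ℕ} {M M' : Mem} {lev : ℕ → ℕ}

theorem LocalOK.touched_of_ne {u v : ℕ} (h : LocalOK Z Q θ path M lev u)
    (hT : Touched M M' Q θ v t p p') (hu : u ≠ v) : LocalOK Z Q θ path M' lev u := by
  have e1 : wOf M' u = wOf M u := hT.other 5 u 0 (by norm_num) (by omega)
  have e2 : pvOf M' u = pvOf M u := by
    unfold pvOf
    rw [hT.other 4 u 0 (by norm_num) (by omega)]
  refine ⟨?_, ?_, ?_, ?_⟩
  · rw [e1, h.load]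
  · intro q s hq
    rw [hT.mem _ _ (two_le_key u q), ← h.list q s hq]
    simp [key_inj, hu]
  · rw [hT.low 0 u (by norm_num) hu, h.up, e1]
  · rw [hT.low 1 u (by norm_num) hu, h.down, e1, e2]

/-- A deleted hyperedge stays behind in the set with key `key v 0`. This is harmless, as
`LocalOK.list` says nothing about level `0`, and it makes deletion an ordinary change of level. -/
theorem LocalOK.touched {v : ℕ} (h : LocalOK Z Q θ path M lev v)
    (hT : Touched M M' Q θ v t (lev t) p') (hv : v ∈ path t) (ht : t < Z)
    (h1 : ((Q / lev t : ℕ) : ℝ) = Q * (lev t : ℝ)⁻¹) (h2 : ((Q / p' : ℕ) : ℝ) = Q * (p' : ℝ)⁻¹)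
    (hle : Q / lev t ≤ wOf M v + Q / p') :
    LocalOK Z Q θ path M' (Function.update lev t p') v := by
  have e2 : pvOf M' v = pvOf M v := by
    unfold pvOf
    rw [hT.other 4 v 0 (by norm_num) (by omega)]
  refine ⟨?_, ?_, hT.up, ?_⟩
  · rw [hT.w_self, Nat.cast_sub hle, Nat.cast_add, h1, h2, h.load, sum_share_update ht hv]
    ring
  · intro q s hq
    rw [hT.mem _ _ (two_le_key v q), h.list q s hq]
    rcases eq_or_ne s t with rfl | hs
    · simp only [key_inj, true_and, and_true, Function.update_self, hv]
      constructor
      · rintro (⟨rfl, h⟩ | rfl)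
        · exact absurd rfl h
        · rfl
      · rintro rfl
        exact .inr rfl
    · simp [hs]
  · rw [hT.down, e2]

theorem LocalOK.congr {M M' : Mem} {v : ℕ} (h : LocalOK Z Q θ path M lev v)
    (h4 : M' (loc 4 v 0) = M (loc 4 v 0)) (h5 : M' (loc 5 v 0) = M (loc 5 v 0))
    (h9 : ∀ k x, posOf M' k x = posOf M k x) : LocalOK Z Q θ path M' lev v := by
  have e1 : wOf M' v = wOf M v := h5
  have e2 : pvOf M' v = pvOf M v := by unfold pvOf; rw [h4]
  refine ⟨by rw [e1, h.load], fun p t hp => by rw [h9, h.list p t hp], by rw [h9, h.up, e1],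
    by rw [h9, h.down, e1, e2]⟩

theorem SetsWF.congr {M M' : Mem} (h : SetsWF M)
    (hM : ∀ g a b, 7 ≤ g → g < 16 → M' (loc g a b) = M (loc g a b)) : SetsWF M' := by
  have e1 : ∀ k x, posOf M' k x = posOf M k x := fun k x => hM 9 k x (by omega) (by omega)
  have e2 : ∀ k x, arrOf M' k x = arrOf M k x := fun k x => hM 8 k x (by omega) (by omega)
  have e3 : ∀ k, cntOf M' k = cntOf M k := fun k => hM 7 k 0 (by omega) (by omega)
  refine ⟨fun k x => ?_, fun k x => ?_, fun k i => ?_⟩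
  · rw [e1, e3]; exact h.pos_le k x
  · rw [e1, e2]; exact h.arr_pos k x
  · rw [e3, e2, e1]; exact h.pos_arr k i

end

section

variable {n Z w θ N Q t p p' : ℕ} {path : ℕ → List ℕ} {M M' : Mem} {lev : ℕ → ℕ} {inp : List ℕ}

theorem LocalOK.update_of_notMem {v : ℕ} (h : LocalOK Z Q θ path M lev v) (hv : v ∉ path t) :
    LocalOK Z Q θ path M (Function.update lev t p) v := by
  refine ⟨by rw [load_update_of_notMem hv, h.load], fun q s hq => ?_, h.up, h.down⟩
  rw [h.list q s hq]
  rcases eq_or_ne s t with rfl | hs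
  · simp [hv]
  · simp [hs]

theorem share_le_load {v : ℕ} (ht : t < Z) (hv : v ∈ path t) :
    (lev t : ℝ)⁻¹ ≤ load Z path lev v := by
  have := Finset.single_le_sum (f := share path lev v) (s := Finset.range Z)
    (fun i _ => share_nonneg v i) (Finset.mem_range.2 ht)
  simpa [share, hv, load] using this

theorem Trie.label {n N : ℕ} (h : Trie n N path M) {x : ℕ} (hx0 : x ≠ 0) (hx : x ≤ N) :
    M (loc 2 x 0) < n := by
  refine h.lt x hx _ ?_
  rw [h.path_eq x hx0 hx]
  simp

/-- The invariant of the loop of `moveEdge`: `rest` are the vertices that have been treated. -/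
structure MoveInv (n Z w θ N : ℕ) (path : ℕ → List ℕ) (M : Mem) (t p' : ℕ) (cur : Mem) (x : ℕ)
    (rest : List ℕ) : Prop where
  x_le : x ≤ N
  path_eq : path t = path x ++ rest
  wf : SetsWF cur
  items : ∀ k x, posOf cur k x ≠ 0 → x < Z
  low : ∀ k x, k < 2 → posOf cur k x ≠ 0 → x < n
  lev : levOf cur = Function.update (levOf M) t p'
  other : ∀ g a b, g < 5 → cur (loc g a b) = M (loc g a b)
  todo : ∀ u < n, u ∉ rest → LocalOK Z (2 ^ (w - 4)) θ path cur (levOf M) u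
  done : ∀ u < n, u ∈ rest → LocalOK Z (2 ^ (w - 4)) θ path cur (Function.update (levOf M) t p') u
  pos : ∀ v z, levOf M t ≠ p' →
    v ∉ rest ∨ posOf M (key v (levOf M t)) z < posOf M (key v (levOf M t)) t →
    posOf cur (key v (levOf M t)) z = posOf M (key v (levOf M t)) z

/-- At the root the remaining path is empty, so `rest` is the whole hyperedge and all its vertices
have been treated. -/
theorem MoveInv.moved (hR : Rep n Z w θ N path M) {cur : Mem} {rest : List ℕ}
    (h : MoveInv n Z w θ N path M t p' cur 0 rest) (htN : t ≤ N) (hp' : IsLevel Z p') :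
    Moved n Z w θ N path M cur t p' := by
  have hrest : path t = rest := by rw [h.path_eq, hR.trie.root, List.nil_append]
  refine ⟨⟨hR.trie.congr fun g a b hg => h.other g a b (by omega), h.wf, h.items, h.low, ?_, ?_, ?_,
    ?_, hR.N_lt⟩, h.lev, ?_, ?_, fun g a b hg => h.other g a b (by omega)⟩
  · intro s hs
    rw [h.lev] at hs
    rcases eq_or_ne s t with rfl | hst
    · exact htN
    · rw [Function.update_of_ne hst] at hs
      exact hR.lev_le s hs
  · intro s
    rw [h.lev]
    rcases eq_or_ne s t with rfl | hst
    · simpa using hp'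
    · simpa [hst] using hR.level s
  · intro v
    unfold pvOf
    rw [h.other 4 v 0 (by omega)]
    exact hR.pv_level v
  · intro v hv
    rw [h.lev]
    by_cases hvr : v ∈ rest
    · exact h.done v hv hvr
    · exact (h.todo v hv hvr).update_of_notMem (by rwa [hrest])
  · funext v
    unfold pvOf
    rw [h.other 4 v 0 (by omega)]
  · intro v z h1 h2
    exact h.pos v z h1 (.inr h2)

theorem MoveInv.step (hE : Env n Z w) (hR : Rep n Z w θ N path M) {cur cur' : Mem} {x : ℕ}
    {rest : List ℕ} (h : MoveInv n Z w θ N path M t p' cur x rest) (hx : x ≠ 0) (htN : t ≤ N)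
    (hnd : (path t).Nodup) (hp' : IsLevel Z p')
    (hT : Touched cur cur' (2 ^ (w - 4)) θ (M (loc 2 x 0)) t (levOf M t) p')
    (hit : ∀ k x, posOf cur' k x ≠ 0 → x < Z) :
    MoveInv n Z w θ N path M t p' cur' (M (loc 1 x 0)) (M (loc 2 x 0) :: rest) := by
  have hpx := hR.trie.path_eq x hx h.x_le
  have hv := hR.trie.label hx h.x_le
  set v := M (loc 2 x 0) with hvdef
  have hpt : path t = path (M (loc 1 x 0)) ++ v :: rest := by
    rw [h.path_eq, hpx, List.append_assoc, List.singleton_append]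
  have hvt : v ∈ path t := by rw [hpt]; simp
  -- The vertices of a hyperedge are distinct, so the data of `v` still belong to the old levels.
  have hvr : v ∉ rest := by
    rw [hpt] at hnd
    exact (List.nodup_cons.1 (List.nodup_append.1 hnd).2.1).1
  have hZQ : Z ≤ 2 ^ (w - 4) := by have := hE.Z_lt; omega
  have htZ : t < Z := lt_of_le_of_lt htN hR.N_lt
  have d1 := (hR.level t).cast_div hZQ
  have d2 := hp'.cast_div hZQ
  have hload := (h.todo v hv hvr).load
  have hle : 2 ^ (w - 4) / levOf M t ≤ wOf cur v + 2 ^ (w - 4) / p' := by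
    have h1 : ((2 ^ (w - 4) / levOf M t : ℕ) : ℝ) ≤ (wOf cur v : ℝ) := by
      rw [d1, hload]
      have := share_le_load (lev := levOf M) htZ hvt
      gcongr
    have h2 : 2 ^ (w - 4) / levOf M t ≤ wOf cur v := by exact_mod_cast h1
    exact h2.trans (Nat.le_add_right _ _)
  refine ⟨?_, hpt, hT.wf, hit, ?_, ?_, ?_, ?_, ?_, ?_⟩
  · exact (hR.trie.parent_lt x hx h.x_le).le.trans h.x_le
  · intro k y hk hy
    rcases eq_or_ne y v with rfl | hyv
    · exact hv
    · exact h.low k y hk ((hT.low k y hk hyv).1 hy)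
  · rw [← h.lev]
    funext s
    exact hT.other 6 s 0 (by norm_num) (by omega)
  · intro g a b hg
    rw [hT.other g a b (by omega) (by omega), h.other g a b hg]
  · intro u hu hur
    rw [List.mem_cons, not_or] at hur
    exact (h.todo u hu hur.2).touched_of_ne hT hur.1
  · intro u hu hur
    rcases eq_or_ne u v with huv | huv
    · rw [huv]
      exact (h.todo v hv hvr).touched hT hvt htZ d1 d2 hle
    · exact (h.done u hu ((List.mem_cons.1 hur).resolve_left huv)).touched_of_ne hT huv
  · intro u z hne hu
    rw [hT.pos _ _ (two_le_key _ _) _ (by rw [Ne, key_inj]; tauto)]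
    · refine h.pos u z hne ?_
      rcases hu with hu | hu
      · exact .inl fun h => hu (List.mem_cons_of_mem _ h)
      · exact .inr hu
    -- At `v` itself the removal of `t` preserves the positions before that of `t`; the sets of
    -- other vertices have other keys.
    · rcases eq_or_ne u v with huv | huv
      · right
        rw [huv] at hu ⊢
        rw [h.pos v z hne (.inl hvr), h.pos v t hne (.inl hvr)]
        rcases hu with hu | hu
        · simp at hu
        · exact hu
      · left
        rw [Ne, key_inj]
        tauto

/-- The level of the hyperedge is overwritten first, while the data of its vertices follow one at a
time along the parent pointers; the invariant therefore speaks of the old levels at some vertices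
and of the new ones at others. -/
theorem moveEdge_spec (hE : Env n Z w) {σ : State} (h2 : σ.v 2 = 2 ^ (w - 4)) (h3 : σ.v 3 = θ)
    (h24 : σ.v 24 = t) (h25 : σ.v 25 = p') (hR : Rep n Z w θ N path σ.mem) (htN : t ≤ N)
    (hnd : (path t).Nodup) (hp' : IsLevel Z p')
    (hW : ∀ v ∈ path t, wOf σ.mem v ≤ 3 * 2 ^ (w - 4)) :
    wp w inp moveEdge (fun σ' => Moved n Z w θ N path σ.mem σ'.mem t p' ∧
      (∀ r < 26, σ'.v r = σ.v r) ∧ σ'.time ≤ σ.time + 1100 * ((path t).length + 1)) σ := by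
  have htZ : t < Z := lt_of_le_of_lt htN hR.N_lt
  have hZQ : Z ≤ 2 ^ (w - 4) := by have := hE.Z_lt; omega
  have l0 := hE.loc (g := 6) htZ.le (b := 0) (by omega)
  refine wp_seq (wp_assign (by simp) (by simpa [h24] using l0) ?_)
  refine wp_seq (wp_store (by simp) (by simp) (by simp) (by simpa [h24] using l0) ?_)
  refine wp_seq (wp_assign (by simp) (by simp) ?_)
  set σ1 := State.set _ 27 _ _ with hσ1
  have m1 : σ1.mem = Function.update σ.mem (loc 6 t 0) p' := by simp [hσ1, h24, h25]
  have hg1 : ∀ g a b, g < 16 → g ≠ 6 → σ1.mem (loc g a b) = σ.mem (loc g a b) := by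
    intro g a b hg hn
    rw [m1, Function.update_of_ne]
    rw [Ne, loc_inj hg (by norm_num)]
    omega
  have v24 : σ1.v 24 = t := by simp [hσ1, h24]
  have v25 : σ1.v 25 = p' := by simp [hσ1, h25]
  have v26 : σ1.v 26 = levOf σ.mem t := by simp [hσ1, h24, levOf]
  have v27 : σ1.v 27 = t := by simp [hσ1, h24]
  have vlt : ∀ r < 26, σ1.v r = σ.v r := by
    intro r hr
    simp [hσ1, show r ≠ 26 by omega, show r ≠ 27 by omega]
  have t1 : σ1.time ≤ σ.time + 40 := by simp [hσ1]
  have hpos : ∀ k x, posOf σ1.mem k x = posOf σ.mem k x := fun k x => hg1 9 k x (by omega) (by omega)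
  have inv0 : MoveInv n Z w θ N path σ.mem t p' σ1.mem t [] := by
    refine ⟨htN, by simp, hR.wf.congr fun g a b hg hg' => hg1 g a b hg' (by omega),
      fun k x => by rw [hpos]; exact hR.items k x, fun k x => by rw [hpos]; exact hR.low k x,
      ?_, fun g a b hg => hg1 g a b (by omega) (by omega), fun u hu _ => (hR.loc u hu).congr
        (hg1 4 u 0 (by omega) (by omega)) (hg1 5 u 0 (by omega) (by omega)) hpos, by simp,
      fun v z _ _ => hpos _ _⟩
    funext s
    simp only [levOf, m1, Function.update_apply, loc_inj (by norm_num : 6 < 16) (by norm_num : 6 < 16)]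
    simp
  clear_value σ1
  refine wp_while (fun τ => ∃ rest, MoveInv n Z w θ N path σ.mem t p' τ.mem (τ.v 27) rest ∧
    (∀ r < 27, τ.v r = σ1.v r) ∧ τ.time ≤ σ1.time + 1040 * rest.length) (fun τ => τ.v 27) ?_
    ⟨[], by rwa [v27], fun _ _ => rfl, by simp⟩
  rintro τ ⟨rest, hI, hr, ht⟩
  refine ⟨by simp, by simp, fun hlt => ?_, fun hle => ?_⟩
  · have hx : τ.v 27 ≠ 0 := by simpa [Nat.pos_iff_ne_zero] using hlt
    have hxN := hI.x_le
    have lx := fun g (hg : g < 16) =>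
      hE.loc (g := g) (show τ.v 27 ≤ Z by have := hR.N_lt; omega) (b := 0) (by omega) hg
    have e2 : τ.mem (loc 2 (τ.v 27) 0) = σ.mem (loc 2 (τ.v 27) 0) := hI.other 2 _ _ (by norm_num)
    have hv := hR.trie.label hx hxN
    have hn := hE.n_le
    have hpx := hR.trie.path_eq _ hx hxN
    have hpt : path t = path (σ.mem (loc 1 (τ.v 27) 0)) ++ σ.mem (loc 2 (τ.v 27) 0) :: rest := by
      rw [hI.path_eq, hpx, List.append_assoc, List.singleton_append]
    have hvr : σ.mem (loc 2 (τ.v 27) 0) ∉ rest := by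
      rw [hpt] at hnd
      exact (List.nodup_cons.1 (List.nodup_append.1 hnd).2.1).1
    have hvt : σ.mem (loc 2 (τ.v 27) 0) ∈ path t := by rw [hpt]; simp
    -- An untreated vertex has the load of the old levels, and the load determines the stored
    -- weight.
    have hwe : wOf τ.mem (σ.mem (loc 2 (τ.v 27) 0)) = wOf σ.mem (σ.mem (loc 2 (τ.v 27) 0)) := by
      have h1 := (hI.todo _ hv hvr).load
      rw [← (hR.loc _ hv).load] at h1
      exact_mod_cast h1
    refine wp_seq (wp_assign (by simp) (by simpa using lx 2 (by norm_num)) ?_)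
    refine wp_seq (wp.mono (touch_spec hE (Q := 2 ^ (w - 4)) (θ := θ) (t := t) (p := levOf σ.mem t)
      (p' := p') (v := σ.mem (loc 2 (τ.v 27) 0)) rfl (by simp [hr 2, vlt 2, h2])
      (by simp [hr 3, vlt 3, h3]) (by simp [hr 24, v24]) (by simp [hr 25, v25]) (by simp [hr 26, v26])
      (by simp [e2]) (by omega) htZ (hR.level t).le hp'.le hI.wf hI.items ?_ ?_) ?_)
    · simpa [hwe] using hW _ hvt
    · have h1 : ((2 ^ (w - 4) / levOf σ.mem t : ℕ) : ℝ) ≤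
          (wOf σ.mem (σ.mem (loc 2 (τ.v 27) 0)) : ℝ) := by
        rw [(hR.level t).cast_div hZQ, (hR.loc _ hv).load]
        have := share_le_load (lev := levOf σ.mem) htZ hvt
        gcongr
      have h2 : 2 ^ (w - 4) / levOf σ.mem t ≤ wOf σ.mem (σ.mem (loc 2 (τ.v 27) 0)) := by
        exact_mod_cast h1
      simp only [State.set, State.tick, hwe]
      exact h2.trans (Nat.le_add_right _ _)
    · rintro τ' ⟨hT, hit, hr', ht'⟩
      simp only [State.set, State.tick] at hT
      have hst := hI.step hE hR hx htN hnd hp' hT hit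
      have v27' : τ'.v 27 = τ.v 27 := by simp [hr' 27]
      have e1 : τ'.mem (loc 1 (τ.v 27) 0) = σ.mem (loc 1 (τ.v 27) 0) := hst.other 1 _ _ (by norm_num)
      refine wp_assign (by simp) (by simpa [v27'] using lx 1 (by norm_num)) ⟨⟨σ.mem (loc 2 (τ.v 27) 0) :: rest, ?_, ?_, ?_⟩, ?_⟩
      · simpa [v27', e1] using hst
      · intro r hr2
        rw [← hr r hr2]
        simp [show r ≠ 27 by omega, show r ≠ 28 by omega, hr' r (by omega)]
      · simp at ht' ⊢
        omega
      · simpa [v27', e1] using hR.trie.parent_lt _ hx hxN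
  · have hx : τ.v 27 = 0 := by simpa using hle
    rw [hx] at hI
    have hl : (path t).length = rest.length := by
      rw [hI.path_eq, hR.trie.root, List.nil_append]
    refine ⟨hI.moved hR htN hp', ?_, ?_⟩
    · intro r hr2
      simp [hr r (by omega), vlt r hr2]
    · simp
      omega

/-! ### The level a hyperedge ought to have -/

/-- Compute the largest level of a vertex of the hyperedge in variable `14` into variable `21`. -/
def maxLevel : Stmt :=
  .seq (.assign 20 (.var 14)) <|
  .seq (.assign 21 (.const 0)) <|
  .while (.const 0) (.var 20) <|
    .seq (.assign 22 (.op .add (.cell 4 (.cell 2 (.var 20) (.const 0)) (.const 0)) (.const 1))) <|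
    .seq (.ite (.var 21) (.var 22) (.assign 21 (.var 22)) skip) <|
    .assign 20 (.cell 1 (.var 20) (.const 0))

theorem maxLevel_spec (hE : Env n Z w) {σ : State} (h14 : σ.v 14 = t)
    (hR : Rep n Z w θ N path σ.mem) (htN : t ≤ N) (ht0 : t ≠ 0) :
    wp w inp maxLevel (fun σ' => σ'.mem = σ.mem ∧ (∀ v ∈ path t, pvOf σ.mem v ≤ σ'.v 21) ∧
      (∃ v ∈ path t, pvOf σ.mem v = σ'.v 21) ∧ (∀ r < 20, σ'.v r = σ.v r) ∧
      σ'.time ≤ σ.time + 100 * ((path t).length + 1)) σ := by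
  have hw0 : w ≠ 0 := by have := hE.w_ge; omega
  refine wp_seq (wp_assign (by simp) (by simp) ?_)
  refine wp_seq (wp_assign (by simp) (by simp) ?_)
  refine wp_while (fun τ => ∃ rest, τ.mem = σ.mem ∧ τ.v 20 ≤ N ∧ path t = path (τ.v 20) ++ rest ∧
    (∀ v ∈ rest, pvOf σ.mem v ≤ τ.v 21) ∧
    ((rest = [] ∧ τ.v 21 = 0) ∨ ∃ v ∈ rest, pvOf σ.mem v = τ.v 21) ∧ (∀ r < 20, τ.v r = σ.v r) ∧
    τ.time ≤ σ.time + 10 + 90 * rest.length) (fun τ => τ.v 20) ?_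
    ⟨[], by simp, by simpa [h14] using htN, by simp [h14], by simp, by simp, ?_, by simp⟩
  swap
  · intro r hr
    simp [show r ≠ 20 by omega, show r ≠ 21 by omega]
  rintro τ ⟨rest, hm, hxN, hpt, hmax, hex, hr, ht⟩
  refine ⟨by simp, by simp, fun hlt => ?_, fun hle => ?_⟩
  · have hx : τ.v 20 ≠ 0 := by simpa [Nat.pos_iff_ne_zero] using hlt
    have lx := fun g (hg : g < 16) =>
      hE.loc (g := g) (show τ.v 20 ≤ Z by have := hR.N_lt; omega) (b := 0) (by omega) hg
    have hv := hR.trie.label hx hxN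
    have hn := hE.n_le
    have lv := hE.loc (g := 4) (show σ.mem (loc 2 (τ.v 20) 0) ≤ Z by omega) (b := 0) (by omega)
    have hpx := hR.trie.path_eq _ hx hxN
    have hpt' : path t = path (σ.mem (loc 1 (τ.v 20) 0)) ++ σ.mem (loc 2 (τ.v 20) 0) :: rest := by
      rw [hpt, hpx, List.append_assoc, List.singleton_append]
    have hpv : σ.mem (loc 4 (σ.mem (loc 2 (τ.v 20) 0)) 0) + 1 < 2 ^ w :=
      hE.lt (hR.pv_level (σ.mem (loc 2 (τ.v 20) 0))).le
    refine wp_seq (wp_assign (by simp) (by simpa [hm, hw0] using ⟨⟨lx 2 (by norm_num), lv⟩, hpv⟩) ?_)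
    have hpar := hR.trie.parent_lt _ hx hxN
    refine wp_seq (wp_ite (by simp) (by simp) (fun hc => ?_) (fun hc => ?_))
    · refine wp_assign (by simp) (by simp) ?_
      refine wp_assign (by simp) (by simpa using lx 1 (by norm_num)) ⟨⟨σ.mem (loc 2 (τ.v 20) 0) :: rest,
        ?_, ?_, ?_, ?_, ?_, ?_, ?_⟩, ?_⟩
      · simp [hm]
      · simp [hm]; omega
      · simpa [hm] using hpt'
      · simp [hm] at hc ⊢
        exact ⟨le_rfl, fun v hv => (hmax v hv).trans (by omega)⟩
      · exact .inr ⟨_, List.mem_cons_self, by simp [hm, pvOf]⟩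
      · intro r hr2
        simp [show r ≠ 20 by omega, show r ≠ 21 by omega, show r ≠ 22 by omega, hr r hr2]
      · simp
        omega
      · simpa [hm] using hpar
    · refine wp_assign (by simp) (by simp) ?_
      simp [hm] at hc
      refine wp_assign (by simp) (by simpa using lx 1 (by norm_num)) ⟨⟨σ.mem (loc 2 (τ.v 20) 0) :: rest,
        ?_, ?_, ?_, ?_, ?_, ?_, ?_⟩, ?_⟩
      · simp [hm]
      · simp [hm]; omega
      · simpa [hm] using hpt'
      · simp
        exact ⟨hc, hmax⟩
      · right
        rcases hex with ⟨_, h0⟩ | ⟨v, hv, h⟩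
        · omega
        · exact ⟨v, List.mem_cons_of_mem _ hv, by simpa using h⟩
      · intro r hr2
        simp [show r ≠ 20 by omega, show r ≠ 49 by omega, show r ≠ 22 by omega, hr r hr2]
      · simp
        omega
      · simpa [hm] using hpar
  · have hx : τ.v 20 = 0 := by simpa using hle
    have hl : path t = rest := by
      rw [hpt, hx, hR.trie.root, List.nil_append]
    refine ⟨hm, ?_, ?_, hr, ?_⟩
    · rw [hl]; exact hmax
    · rw [hl]
      rcases hex with ⟨h0, _⟩ | h
      -- The initial maximum 0 survives only for an empty path, but by injectivity the root is the
      -- only node with this path.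
      · exfalso
        apply ht0
        refine hR.trie.inj t htN 0 (by omega) ?_
        rw [hl, h0, hR.trie.root]
      · exact h
    · rw [hl]
      simp
      omega

end

section

variable {n Z w θ N f p q l v : ℕ} {path : ℕ → List ℕ} {M M' : Mem} {lev lev' : ℕ → ℕ} {inp : List ℕ}

theorem load_mono (h : ∀ t, (lev' t : ℝ)⁻¹ ≤ (lev t : ℝ)⁻¹) (v : ℕ) :
    load Z path lev' v ≤ load Z path lev v := by
  refine Finset.sum_le_sum fun t _ => ?_
  unfold share
  split_ifs
  · exact h t
  · rfl

/-- The hyperedges of level `p` at the vertex `v`. -/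
def edgesAt (Z : ℕ) (path : ℕ → List ℕ) (lev : ℕ → ℕ) (v p : ℕ) : Finset ℕ :=
  (Finset.range Z).filter fun t => v ∈ path t ∧ lev t = p

theorem mem_edgesAt {t : ℕ} : t ∈ edgesAt Z path lev v p ↔ t < Z ∧ v ∈ path t ∧ lev t = p := by
  simp [edgesAt]

/-- Each of these hyperedges gives `1 / p` to the vertex. This bounds the work of one change of
level by the load. -/
theorem card_edgesAt_le (Z : ℕ) (path : ℕ → List ℕ) (lev : ℕ → ℕ) (v p : ℕ) :
    ((edgesAt Z path lev v p).card : ℝ) * (p : ℝ)⁻¹ ≤ load Z path lev v := by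
  have h1 : ((edgesAt Z path lev v p).card : ℝ) * (p : ℝ)⁻¹ =
      ∑ t ∈ edgesAt Z path lev v p, share path lev v t := by
    rw [← nsmul_eq_mul, ← Finset.sum_const]
    refine Finset.sum_congr rfl fun t ht => ?_
    rw [mem_edgesAt] at ht
    simp [share, ht.2.1, ht.2.2]
  rw [h1]
  exact Finset.sum_le_sum_of_subset_of_nonneg (Finset.filter_subset _ _)
    fun t _ _ => share_nonneg v t

/-- There are at most `Z` hyperedges, each of weight at most `1 / p`. If the load is at least 2,
then `2 * p ≤ Z`; so levels remain bounded by `Z`. -/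
theorem load_le_of_le (hp : 0 < p) (h : ∀ t, v ∈ path t → lev t ≠ 0 → p ≤ lev t) :
    load Z path lev v ≤ Z * (p : ℝ)⁻¹ := by
  have := Finset.sum_le_card_nsmul (Finset.range Z) (share path lev v) ((p : ℝ)⁻¹) fun t _ => by
    unfold share
    split_ifs with hv
    · rcases Nat.eq_zero_or_pos (lev t) with h0 | h0
      · simp [h0]
      · have : (0 : ℝ) < p := by exact_mod_cast hp
        have : (p : ℝ) ≤ lev t := by exact_mod_cast h t hv h0.ne'
        gcongr
    · positivity
  simpa [load] using this

theorem IsLevel.two_mul_le (hp : IsLevel Z p) (hl : IsLevel Z l) (h0 : p ≠ 0) (h : p < l) :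
    2 * p ≤ l := by
  obtain ⟨⟨i, rfl⟩, -⟩ := hp.resolve_left h0
  obtain ⟨⟨j, rfl⟩, -⟩ := hl.resolve_left (Nat.ne_zero_of_lt h)
  have := (Nat.pow_lt_pow_iff_right (by norm_num)).1 h
  rw [← pow_succ']
  exact Nat.pow_le_pow_right (by norm_num) this

theorem IsLevel.two_mul (hp : IsLevel Z p) (h : 2 * p ≤ Z) : IsLevel Z (2 * p) := by
  rcases hp with rfl | ⟨⟨i, rfl⟩, -⟩
  · exact .inl rfl
  · exact .inr ⟨⟨i + 1, by rw [pow_succ']⟩, h⟩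

theorem IsLevel.half (hp : IsLevel Z p) (h : 1 < p) : IsLevel Z (p / 2) ∧ p = 2 * (p / 2) := by
  have h0 : p ≠ 0 := by omega
  obtain ⟨⟨i, rfl⟩, hZ⟩ := hp.resolve_left h0
  obtain ⟨j, rfl⟩ : ∃ j, i = j + 1 := Nat.exists_eq_succ_of_ne_zero (by rintro rfl; simp at h)
  have : 2 ^ (j + 1) / 2 = 2 ^ j := by rw [pow_succ, Nat.mul_div_cancel _ (by norm_num)]
  rw [this]
  exact ⟨.inr ⟨⟨j, rfl⟩, le_trans (Nat.pow_le_pow_right (by norm_num) (by omega)) hZ⟩,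
    by rw [pow_succ']⟩

theorem pvOf_pos (M : Mem) (v : ℕ) : 0 < pvOf M v := Nat.succ_pos _

/-! ### Changing the level of a vertex -/

/-- Give the vertex in variable `10` the level in variable `15`. -/
def setLevel : Stmt :=
  .seq (.store 4 (.var 10) (.const 0) (.op .sub (.var 15) (.const 1))) <|
  .seq (.assign 30 (.var 10)) refresh

/-- The result of `setLevel`. -/
structure Relevelled (n Z w θ N : ℕ) (path : ℕ → List ℕ) (M M' : Mem) (v q : ℕ) : Prop where
  rep : Rep n Z w θ N path M'
  lev : levOf M' = levOf M
  pv : pvOf M' = Function.update (pvOf M) v q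
  other : ∀ g a b, g < 4 → M' (loc g a b) = M (loc g a b)

/-- Weights and lists depend on the levels of hyperedges only. Hence the level of a vertex alone can
affect nothing but its membership in the set of vertices to be lowered. -/
theorem setLevel_spec (hE : Env n Z w) {σ : State} (h2 : σ.v 2 = 2 ^ (w - 4)) (h3 : σ.v 3 = θ)
    (h10 : σ.v 10 = v) (h15 : σ.v 15 = q) (hR : Rep n Z w θ N path σ.mem) (hv : v < n)
    (hq : IsLevel Z q) (hq0 : q ≠ 0) :
    wp w inp setLevel (fun σ' => Relevelled n Z w θ N path σ.mem σ'.mem v q ∧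
      (∀ r < 30, σ'.v r = σ.v r) ∧ σ'.time ≤ σ.time + 480) σ := by
  have hw0 : w ≠ 0 := by have := hE.w_ge; omega
  have hvZ : v < Z := hv.trans_le hE.n_le
  have l0 := hE.loc (g := 4) hvZ.le (b := 0) (by omega)
  have hq1 : 1 ≤ q := Nat.one_le_iff_ne_zero.2 hq0
  refine wp_seq (wp_store (by simp) (by simp)
    (by simpa [h15, hw0] using ⟨hq1, hE.lt hq.le⟩) (by simpa [h10] using l0) ?_)
  refine wp_seq (wp_assign (by simp) (by simp) ?_)
  set σ1 := State.set _ 30 _ _ with hσ1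
  have m1 : σ1.mem = Function.update σ.mem (loc 4 v 0) (q - 1) := by simp [hσ1, h10, h15]
  have hg1 : ∀ g a b, g < 16 → g ≠ 4 ∨ a ≠ v ∨ b ≠ 0 → σ1.mem (loc g a b) = σ.mem (loc g a b) := by
    intro g a b hg hn
    rw [m1, Function.update_of_ne]
    rw [Ne, loc_inj hg (by norm_num)]
    omega
  have hpos : ∀ k x, posOf σ1.mem k x = posOf σ.mem k x := fun k x => hg1 9 k x (by omega) (by omega)
  have v30 : σ1.v 30 = v := by simp [hσ1, h10]
  have vlt : ∀ r < 30, σ1.v r = σ.v r := by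
    intro r hr
    simp [hσ1, show r ≠ 30 by omega]
  have t1 : σ1.time ≤ σ.time + 30 := by simp [hσ1]
  have p1 : pvOf σ1.mem v = q := by
    simp only [pvOf, m1, Function.update_self]
    omega
  clear_value σ1
  refine wp.mono (refresh_spec hE (v := v) (θ := θ) (Q := 2 ^ (w - 4)) rfl (by rw [vlt 2 (by omega), h2])
    (by rw [vlt 3 (by omega), h3]) v30 hvZ
    (hR.wf.congr fun g a b hg hg' => hg1 g a b hg' (by omega))
    (fun k x => by rw [hpos]; exact hR.items k x)) ?_
  rintro σ' ⟨hs, hr, ht⟩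
  have hoth : ∀ g a b, g < 7 → g ≠ 4 ∨ a ≠ v ∨ b ≠ 0 → σ'.mem (loc g a b) = σ.mem (loc g a b) := by
    intro g a b hg hn
    rw [hs.other g a b hg, hg1 g a b (by omega) hn]
  have hlev : levOf σ'.mem = levOf σ.mem := by
    funext s
    exact hoth 6 s 0 (by omega) (by omega)
  have hw : wOf σ'.mem = wOf σ.mem := by
    funext s
    exact hoth 5 s 0 (by omega) (by omega)
  have hpv : pvOf σ'.mem = Function.update (pvOf σ.mem) v q := by
    funext u
    rcases eq_or_ne u v with rfl | hu
    · rw [Function.update_self, ← p1]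
      unfold pvOf
      rw [hs.other 4 u 0 (by omega)]
    · rw [Function.update_of_ne hu]
      unfold pvOf
      rw [hoth 4 u 0 (by omega) (by omega)]
  have hmem : ∀ k x, x ≠ v → (posOf σ'.mem k x ≠ 0 ↔ posOf σ.mem k x ≠ 0) := by
    intro k x hx
    rw [hs.mem k x hx, hpos]
  refine ⟨⟨⟨hR.trie.congr fun g a b hg => hoth g a b (by omega) (by omega), hs.wf, ?_, ?_, ?_, ?_,
    ?_, ?_, hR.N_lt⟩, hlev, hpv, fun g a b hg => hoth g a b (by omega) (by omega)⟩, ?_, by omega⟩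
  · intro k x hx
    rcases eq_or_ne x v with rfl | hxv
    · exact hvZ
    · exact hR.items k x ((hmem k x hxv).1 hx)
  · intro k x hk hx
    rcases eq_or_ne x v with rfl | hxv
    · exact hv
    · exact hR.low k x hk ((hmem k x hxv).1 hx)
  · rw [hlev]; exact hR.lev_le
  · rw [hlev]; exact hR.level
  · intro u
    rw [hpv]
    rcases eq_or_ne u v with rfl | hu
    · simpa using hq
    · simpa [hu] using hR.pv_level u
  · intro u hu
    have hl := hR.loc u hu
    rw [hlev]
    refine ⟨by rw [hw, hl.load], fun s t hst => ?_, ?_, ?_⟩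
    · rw [hs.pos _ _ (two_le_key u s), hpos, hl.list s t hst]
    · rcases eq_or_ne u v with rfl | huv
      · rw [hs.up, hw]
        unfold wOf
        rw [hg1 5 u 0 (by omega) (by omega)]
      · rw [hmem 0 u huv, hl.up, hw]
    · rcases eq_or_ne u v with rfl | huv
      · rw [hs.down, hw, hpv, p1, Function.update_self]
        unfold wOf
        rw [hg1 5 u 0 (by omega) (by omega)]
      · rw [hmem 1 u huv, hl.down, hw, hpv, Function.update_of_ne huv]
  · intro r hr2
    rw [hr r (by omega), vlt r hr2]

/-! ### The invariant, and raising a vertex -/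

/-- The level of every hyperedge is the greatest level of its vertices, and the weights at the
vertices are bounded. -/
structure Valid (n Z w θ N f : ℕ) (path : ℕ → List ℕ) (M : Mem) : Prop where
  rep : Rep n Z w θ N path M
  edge : ∀ t, levOf M t ≠ 0 → (path t).Nodup ∧ (path t).length ≤ f ∧ t ≠ 0
  pv_le : ∀ t, levOf M t ≠ 0 → ∀ v ∈ path t, pvOf M v ≤ levOf M t
  supp : ∀ t, levOf M t ≠ 0 → ∃ v ∈ path t, pvOf M v = levOf M t
  w_le : ∀ v < n, wOf M v ≤ 3 * 2 ^ (w - 4)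

/-- The potential of a memory. -/
noncomputable def memPotential (n Z f : ℕ) (path : ℕ → List ℕ) (M : Mem) : ℝ :=
  potential (64000 * f) 16000 n Z path (levOf M) (pvOf M)

/-- Variable `11` becomes the level of the vertex in variable `10`, and variable `12` the key of the
set of hyperedges of this level at this vertex. -/
def readLevel : Stmt :=
  .seq (.assign 11 (.op .add (.cell 4 (.var 10) (.const 0)) (.const 1)))
    (.assign 12 (keyExpr (.var 10) (.var 11)))

theorem readLevel_spec (hE : Env n Z w) {σ : State} (h10 : σ.v 10 = v) (hv : v < n)
    (hR : Rep n Z w θ N path σ.mem) :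
    wp w inp readLevel (fun σ' => σ'.mem = σ.mem ∧ σ'.v 11 = pvOf σ.mem v ∧
      σ'.v 12 = key v (pvOf σ.mem v) ∧ (∀ r < 11, σ'.v r = σ.v r) ∧ σ'.time ≤ σ.time + 50) σ := by
  have hw0 : w ≠ 0 := by have := hE.w_ge; omega
  have hvZ : v < Z := hv.trans_le hE.n_le
  have l0 := hE.loc (g := 4) hvZ.le (b := 0) (by omega)
  have hp := (hR.pv_level v).le
  have hp' : σ.mem (loc 4 v 0) + 1 < 2 ^ w := hE.lt hp
  refine wp_seq (wp_assign (by simp) (by simpa [h10, hw0] using ⟨l0, hp'⟩) ?_)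
  refine wp_assign (by simp) (keyExpr_ok hE (by simp) (by simp) (by simpa [h10] using hvZ.le)
    (by simpa [h10, pvOf] using hp)) ⟨rfl, by simp [h10, pvOf], by simp [h10, pvOf], ?_, by simp⟩
  intro r hr
  simp [show r ≠ 11 by omega, show r ≠ 12 by omega]

/-- Raise the level of the vertex in variable `10`. -/
def raiseVertex : Stmt :=
  .seq readLevel <|
  .seq (.assign 15 (.op .add (.var 11) (.var 11))) <|
  .seq setLevel <|
  .while (.const 0) (.cell 7 (.var 12) (.const 0)) <|
    .seq (.assign 24 (.cell 8 (.var 12) (.op .sub (.cell 7 (.var 12) (.const 0)) (.const 1)))) <|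
    .seq (.assign 25 (.var 15)) moveEdge

/-- The relation of the memories before and during `raiseVertex`. -/
structure Raising (n Z w θ N : ℕ) (path : ℕ → List ℕ) (M M' : Mem) (v : ℕ) : Prop where
  rep : Rep n Z w θ N path M'
  lev : ∀ t, levOf M' t = levOf M t ∨
    (v ∈ path t ∧ levOf M t = pvOf M v ∧ levOf M' t = 2 * pvOf M v)
  pv : pvOf M' = Function.update (pvOf M) v (2 * pvOf M v)
  other : ∀ g a b, g < 4 → M' (loc g a b) = M (loc g a b)

theorem Raising.lev_ne (h : Raising n Z w θ N path M M' v) (t : ℕ) :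
    levOf M' t ≠ 0 ↔ levOf M t ≠ 0 := by
  have := pvOf_pos M v
  rcases h.lev t with h | ⟨_, h1, h2⟩
  · rw [h]
  · omega

theorem Raising.w_le (h : Raising n Z w θ N path M M' v) (hV : Valid n Z w θ N f path M) {u : ℕ}
    (hu : u < n) : wOf M' u ≤ 3 * 2 ^ (w - 4) := by
  refine le_trans ?_ (hV.w_le u hu)
  have : (wOf M' u : ℝ) ≤ wOf M u := by
    rw [(h.rep.loc u hu).load, (hV.rep.loc u hu).load]
    refine mul_le_mul_of_nonneg_left (load_mono (fun t => ?_) u) (by positivity)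
    rcases h.lev t with h | ⟨_, h1, h2⟩
    · rw [h]
    · rw [h1, h2]
      have : (0 : ℝ) < pvOf M v := by exact_mod_cast pvOf_pos M v
      gcongr
      linarith
  exact_mod_cast this

/-- Once no hyperedge at `v` has the old level `p`, all of them have level at least `2 * p`, the
next power of two. A moved hyperedge has `v` as its highest vertex; an unmoved one keeps its former
highest vertex, which cannot have been `v`. -/
theorem Raising.valid (h : Raising n Z w θ N path M M' v) (hV : Valid n Z w θ N f path M)
    (hdone : ∀ t, v ∈ path t → levOf M' t ≠ pvOf M v) : Valid n Z w θ N f path M' := by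
  have hp := pvOf_pos M v
  refine ⟨h.rep, fun t ht => hV.edge t ((h.lev_ne t).1 ht), ?_, ?_, fun u hu => h.w_le hV hu⟩
  · intro t ht u hu
    have ht0 := (h.lev_ne t).1 ht
    have h1 := hV.pv_le t ht0
    rw [h.pv]
    rcases eq_or_ne u v with rfl | huv
    · rw [Function.update_self]
      rcases h.lev t with h2 | ⟨-, -, h2⟩
      · refine (hV.rep.pv_level u).two_mul_le (h.rep.level t) hp.ne' ?_
        have := hdone t hu
        have := h1 u hu
        omega
      · rw [h2]
    · rw [Function.update_of_ne huv]
      have := h1 u hu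
      rcases h.lev t with h2 | ⟨-, h2, h3⟩ <;> omega
  · intro t ht
    have ht0 := (h.lev_ne t).1 ht
    rw [h.pv]
    rcases h.lev t with h2 | ⟨hv, -, h2⟩
    · obtain ⟨u, hu, h3⟩ := hV.supp t ht0
      refine ⟨u, hu, ?_⟩
      rw [Function.update_of_ne, h3, h2]
      rintro rfl
      exact hdone t hu (by omega)
    · exact ⟨v, hv, by rw [Function.update_self, h2]⟩

theorem Raising.step (h : Raising n Z w θ N path M M' v) {M'' : Mem} {t : ℕ}
    (hm : Moved n Z w θ N path M' M'' t (2 * pvOf M v)) (hv : v ∈ path t)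
    (ht : levOf M' t = pvOf M v) : Raising n Z w θ N path M M'' v := by
  have hp := pvOf_pos M v
  refine ⟨hm.rep, fun s => ?_, by rw [hm.pv, h.pv], fun g a b hg => by
    rw [hm.other g a b hg, h.other g a b hg]⟩
  rw [hm.lev]
  rcases eq_or_ne s t with rfl | hs
  · right
    refine ⟨hv, ?_, by simp⟩
    rcases h.lev s with h1 | ⟨-, h1, -⟩
    · rw [← h1, ht]
    · exact h1
  · simpa [hs] using h.lev s

theorem card_edgesAt_update {t : ℕ} (ht : t ∈ edgesAt Z path lev v p) (hq : q ≠ p) :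
    (edgesAt Z path (Function.update lev t q) v p).card + 1 = (edgesAt Z path lev v p).card := by
  have : edgesAt Z path (Function.update lev t q) v p = (edgesAt Z path lev v p).erase t := by
    ext s
    rw [Finset.mem_erase, mem_edgesAt, mem_edgesAt]
    rcases eq_or_ne s t with rfl | hs
    · simp [hq]
    · simp [hs]
  rw [this, Finset.card_erase_add_one ht]

/-- The weight falls by `1 / (2p)`, where `p` is the old level of `v`, and no vertex of the
hyperedge has a level above `2p`; so `potential_raise` applies. -/
theorem Raising.potential_step (h : Raising n Z w θ N path M M' v) (hV : Valid n Z w θ N f path M)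
    {M'' : Mem} {t : ℕ} (hm : Moved n Z w θ N path M' M'' t (2 * pvOf M v)) (hv : v ∈ path t)
    (ht : levOf M' t = pvOf M v) :
    memPotential n Z f path M'' ≤ memPotential n Z f path M' + 16000 * f := by
  have hp := pvOf_pos M v
  have ht0 := (h.lev_ne t).1 (by omega)
  have htZ : t < Z := lt_of_le_of_lt (h.rep.lev_le t (by omega)) h.rep.N_lt
  have hp0 : (0 : ℝ) < pvOf M v := by exact_mod_cast hp
  unfold memPotential
  rw [hm.lev, hm.pv]
  refine potential_raise (by positivity) (by norm_num) htZ (hV.edge t ht0).2.1 ?_ ?_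
  · rw [ht, Nat.cast_mul]
    exact inv_anti₀ hp0 (by norm_num; linarith)
  · intro u hu
    have h1 : pvOf M' u ≤ 2 * pvOf M v := by
      rw [h.pv]
      rcases eq_or_ne u v with rfl | huv
      · simp
      · rw [Function.update_of_ne huv]
        have h1 := hV.pv_le t ht0 u hu
        rcases h.lev t with h2 | ⟨-, h2, h3⟩ <;> omega
    have h2 : (pvOf M' u : ℝ) ≤ 2 * pvOf M v := by exact_mod_cast h1
    rw [ht, Nat.cast_mul, Nat.cast_ofNat]
    have h3 : (pvOf M v : ℝ)⁻¹ - (2 * (pvOf M v : ℝ))⁻¹ = (2 * (pvOf M v : ℝ))⁻¹ := by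
      field_simp
      norm_num
    rw [h3, ← div_eq_mul_inv]
    exact div_le_one_of_le₀ h2 (by positivity)

-- Accounting: the new vertex level releases `64000 * f * p`. At most `3 * p` hyperedges are moved,
-- each at the price of `4000 * f` steps and `16000 * f` of potential, together `60000 * f * p`; the
-- remaining `4000 * f * p` covers the fixed costs and the surplus of 100.
set_option maxHeartbeats 1000000 in
theorem raiseVertex_spec (hE : Env n Z w) (hf : 1 ≤ f) {σ : State} (h2 : σ.v 2 = 2 ^ (w - 4))
    (h3 : σ.v 3 = θ) (h10 : σ.v 10 = v) (hV : Valid n Z w θ N f path σ.mem) (hv : v < n)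
    (hup : 2 * 2 ^ (w - 4) ≤ wOf σ.mem v) :
    wp w inp raiseVertex (fun σ' => Valid n Z w θ N f path σ'.mem ∧
      (∀ t, levOf σ'.mem t ≠ 0 ↔ levOf σ.mem t ≠ 0) ∧
      (∀ g a b, g < 4 → σ'.mem (loc g a b) = σ.mem (loc g a b)) ∧ (∀ r < 10, σ'.v r = σ.v r) ∧
      ∃ k : ℕ, σ'.time ≤ σ.time + k ∧
        memPotential n Z f path σ'.mem + k + 100 ≤ memPotential n Z f path σ.mem) σ := by
  have hw0 : w ≠ 0 := by have := hE.w_ge; omega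
  have hR := hV.rep
  set p := pvOf σ.mem v with hpdef
  have hp0 : 0 < p := pvOf_pos _ _
  have hQ0 : (0 : ℝ) < (2 ^ (w - 4) : ℕ) := by positivity
  have hload := (hR.loc v hv).load
  have hl2 : 2 ≤ load Z path (levOf σ.mem) v := by
    have : ((2 * 2 ^ (w - 4) : ℕ) : ℝ) ≤ wOf σ.mem v := by exact_mod_cast hup
    rw [hload, Nat.cast_mul, mul_comm] at this
    exact_mod_cast le_of_mul_le_mul_left this hQ0
  have hl3 : load Z path (levOf σ.mem) v ≤ 3 := by
    have : (wOf σ.mem v : ℝ) ≤ ((3 * 2 ^ (w - 4) : ℕ) : ℝ) := by exact_mod_cast hV.w_le v hv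
    rw [hload, Nat.cast_mul, mul_comm] at this
    exact_mod_cast le_of_mul_le_mul_right this hQ0
  have hple : ∀ t, v ∈ path t → levOf σ.mem t ≠ 0 → p ≤ levOf σ.mem t :=
    fun t hvt ht => hV.pv_le t ht v hvt
  have hp0' : (0 : ℝ) < p := by exact_mod_cast hp0
  have h2p : 2 * p ≤ Z := by
    have h := hl2.trans (load_le_of_le hp0 hple)
    rw [← div_eq_mul_inv, le_div_iff₀ hp0'] at h
    exact_mod_cast h
  have hL : IsLevel Z (2 * p) := (hR.pv_level v).two_mul h2p
  -- The load is at most 3 and each of these hyperedges contributes `1 / p`.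
  have hcard : ((edgesAt Z path (levOf σ.mem) v p).card : ℝ) ≤ 3 * p := by
    have h := (card_edgesAt_le Z path (levOf σ.mem) v p).trans hl3
    rwa [← div_eq_mul_inv, div_le_iff₀ hp0'] at h
  refine wp_seq (wp.mono (readLevel_spec hE h10 hv hR) ?_)
  rintro σ1 ⟨m1, v11, v12, vr1, t1⟩
  refine wp_seq (wp_assign (by simp) (by simpa [v11, ← two_mul] using hE.lt h2p) ?_)
  refine wp_seq (wp.mono (setLevel_spec hE (v := v) (q := 2 * p) (θ := θ) (N := N) (path := path)
    (by simp [vr1, h2]) (by simp [vr1, h3]) (by simp [vr1, h10]) (by simp [v11, two_mul, hpdef])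
    (by simpa [m1] using hR) hv hL (by omega)) ?_)
  rintro σ2 ⟨hS, vr2, t2⟩
  simp only [State.set, m1] at hS
  have v15 : σ2.v 15 = 2 * p := by simp [vr2, v11, two_mul, hpdef]
  have w12 : σ2.v 12 = key v p := by simp [vr2, v12, hpdef]
  have w2 : σ2.v 2 = 2 ^ (w - 4) := by simp [vr2, vr1, h2]
  have w3 : σ2.v 3 = θ := by simp [vr2, vr1, h3]
  have vlt : ∀ r < 10, σ2.v r = σ.v r := by
    intro r hr
    rw [vr2 r (by omega)]
    simp [show r ≠ 15 by omega, vr1 r (by omega)]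
  have tt : σ2.time ≤ σ.time + 550 := by
    simp at t2
    omega
  have hphi : memPotential n Z f path σ2.mem + 64000 * f * p ≤ memPotential n Z f path σ.mem := by
    unfold memPotential
    rw [hS.lev, hS.pv]
    exact potential_up hv hp0 hple hl2
  have hpZ : p ≤ Z := by omega
  have hkey := hE.key_le (hv.le.trans hE.n_le) hpZ
  have hf0 : (1 : ℝ) ≤ f := by exact_mod_cast hf
  refine wp_while (fun τ => Raising n Z w θ N path σ.mem τ.mem v ∧ (∀ r < 24, τ.v r = σ2.v r) ∧
    ∃ i : ℕ, i + (edgesAt Z path (levOf τ.mem) v p).card = (edgesAt Z path (levOf σ.mem) v p).card ∧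
      τ.time ≤ σ2.time + i * (4000 * f) ∧
      memPotential n Z f path τ.mem ≤ memPotential n Z f path σ2.mem + i * (16000 * f))
    (fun τ => (edgesAt Z path (levOf τ.mem) v p).card) ?_
    ⟨⟨hS.rep, fun t => .inl (by rw [hS.lev]), hS.pv, hS.other⟩, fun _ _ => rfl, 0, by rw [hS.lev]; simp,
      by simp, by simp⟩
  rintro τ ⟨hI, vr, i, hi, ht, hphi'⟩
  have hcl := hI.rep.wf.cnt_le (k := key v p) (Z := Z) (fun x => hI.rep.items _ x)
  have lc := hE.fits.loc (g := 7) hkey (b := 0) (by omega)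
  have hZ8 := hE.Z_le
  refine ⟨by simp, by simpa [vr, w12] using lc, fun hlt => ?_, fun hle => ?_⟩
  · have hcnt : 0 < cntOf τ.mem (key v p) := by simpa [vr, w12, cntOf] using hlt
    set t := arrOf τ.mem (key v p) (cntOf τ.mem (key v p) - 1) with htdef
    have hpos : posOf τ.mem (key v p) t ≠ 0 := by
      rw [htdef, hI.rep.wf.pos_arr _ _ (by omega)]
      omega
    obtain ⟨hvt, hlt⟩ := ((hI.rep.loc v hv).list p t hp0.ne').1 hpos
    have htN : t ≤ N := hI.rep.lev_le t (by omega)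
    have htZ : t < Z := lt_of_le_of_lt htN hI.rep.N_lt
    have htE := hV.edge t ((hI.lev_ne t).1 (by omega))
    have la := hE.fits.loc (g := 8) hkey (b := cntOf τ.mem (key v p) - 1) (by omega)
    refine wp_seq (wp_assign (by simp) ?_ ?_)
    · simpa [vr, w12, hw0, cntOf] using ⟨⟨lc, hcnt, hE.lt hcl⟩, la⟩
    refine wp_seq (wp_assign (by simp) (by simp) ?_)
    refine wp.mono (moveEdge_spec hE (t := t) (p' := 2 * p) (θ := θ) (N := N) (path := path)
      (by simp [vr, w2]) (by simp [vr, w3]) (by simp [vr, w12, cntOf, arrOf, htdef])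
      (by simp [vr, v15]) hI.rep htN htE.1 hL
      (fun u hu => hI.w_le hV (hI.rep.trie.lt t htN u hu))) ?_
    rintro τ' ⟨hm, vr', ht'⟩
    simp only [State.set, State.tick] at hm
    refine ⟨⟨hI.step hm hvt hlt, ?_, i + 1, ?_, ?_, ?_⟩, ?_⟩
    · intro r hr
      rw [vr' r (by omega), ← vr r hr]
      simp [show r ≠ 24 by omega, show r ≠ 25 by omega]
    · rw [← hi, hm.lev, ← card_edgesAt_update (q := 2 * p) (mem_edgesAt.2 ⟨htZ, hvt, hlt⟩) (by omega)]
      ring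
    · simp at ht'
      have := htE.2.1
      rw [Nat.succ_mul]
      omega
    · have := hI.potential_step hV hm hvt hlt
      push_cast
      linarith
    · rw [hm.lev, ← card_edgesAt_update (q := 2 * p) (mem_edgesAt.2 ⟨htZ, hvt, hlt⟩) (by omega)]
      omega
  · have hcnt : cntOf τ.mem (key v p) = 0 := by simpa [vr, w12, cntOf] using hle
    refine ⟨hI.valid hV ?_, hI.lev_ne, hI.other, ?_, 600 + i * (4000 * f), ?_, ?_⟩
    · intro t hvt hl
      have h := ((hI.rep.loc v hv).list p t hp0.ne').2 ⟨hvt, hl⟩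
      have := hI.rep.wf.pos_le _ _ h
      omega
    · intro r hr
      rw [← vlt r hr, ← vr r (by omega)]
      rfl
    · simp
      omega
    · have hi' : (i : ℝ) ≤ 3 * p := by
        refine le_trans ?_ hcard
        exact_mod_cast (by omega : i ≤ (edgesAt Z path (levOf σ.mem) v p).card)
      have h1 : (i : ℝ) * (20000 * f) ≤ 3 * p * (20000 * f) := by gcongr
      have h2 : (1 : ℝ) ≤ f * p := one_le_mul_of_one_le_of_one_le hf0 (by exact_mod_cast hp0)
      simp only [State.tick]
      push_cast
      nlinarith

end

section

variable {n Z w θ N f p q l v : ℕ} {path : ℕ → List ℕ} {M M' : Mem} {lev lev' : ℕ → ℕ} {inp : List ℕ}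

/-! ### Lowering a vertex -/

/-- Lower the level of the vertex in variable `10`. -/
def lowerVertex : Stmt :=
  .seq readLevel <|
  .seq (.assign 15 (.op .div (.var 11) (.const 2))) <|
  .seq setLevel <|
  .seq (.assign 13 (.cell 7 (.var 12) (.const 0))) <|
  .while (.const 0) (.var 13) <|
    .seq (.assign 13 (.op .sub (.var 13) (.const 1))) <|
    .seq (.assign 14 (.cell 8 (.var 12) (.var 13))) <|
    .seq maxLevel <|
    .ite (.var 21) (.var 11)
      (.seq (.assign 24 (.var 14)) <| .seq (.assign 25 (.var 21)) moveEdge) skip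

/-- The relation of the memories before and during `lowerVertex`, when the first `k` hyperedges of
the set have not been treated yet and at most `i` hyperedges have been moved. -/
structure Lowering (n Z w θ N : ℕ) (path : ℕ → List ℕ) (M M' : Mem) (v q k i : ℕ) : Prop where
  rep : Rep n Z w θ N path M'
  pv : pvOf M' = Function.update (pvOf M) v q
  lev : ∀ t, levOf M' t = levOf M t ∨
    (v ∈ path t ∧ levOf M t = 2 * q ∧ levOf M' t < 2 * q ∧ (∀ u ∈ path t, pvOf M' u ≤ levOf M' t) ∧
      ∃ u ∈ path t, pvOf M' u = levOf M' t)
  todo : ∀ t, v ∈ path t → levOf M' t = 2 * q →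
    posOf M' (key v (2 * q)) t ≤ k ∨ ∃ u ∈ path t, pvOf M' u = levOf M' t
  le_cnt : k ≤ cntOf M' (key v (2 * q))
  load : ∀ u, load Z path (levOf M') u ≤ load Z path (levOf M) u + i * ((2 * q : ℕ) : ℝ)⁻¹
  other : ∀ g a b, g < 4 → M' (loc g a b) = M (loc g a b)

variable {k i t : ℕ}

theorem Lowering.lev_ne (h : Lowering n Z w θ N path M M' v q k i) (hq : 0 < q) (t : ℕ) :
    levOf M' t ≠ 0 ↔ levOf M t ≠ 0 := by
  rcases h.lev t with h1 | ⟨hv, h1, h2, h3, -⟩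
  · rw [h1]
  · have := h3 v hv
    rw [h.pv, Function.update_self] at this
    omega

/-- Every treated hyperedge adds at most `1 / (2q)` to a load, and there are at most `2q` of them.
Loads below 2 therefore do not exceed 3. -/
theorem Lowering.w_le (h : Lowering n Z w θ N path M M' v q k i) (hR : Rep n Z w θ N path M)
    (hi : i ≤ 2 * q) (h2 : ∀ u < n, wOf M u < 2 * 2 ^ (w - 4)) {u : ℕ} (hu : u < n) :
    wOf M' u ≤ 3 * 2 ^ (w - 4) := by
  have hQ0 : (0 : ℝ) < (2 ^ (w - 4) : ℕ) := by positivity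
  have h4 : (wOf M u : ℝ) ≤ ((2 * 2 ^ (w - 4) : ℕ) : ℝ) := by exact_mod_cast (h2 u hu).le
  rw [(hR.loc u hu).load, Nat.cast_mul, mul_comm] at h4
  have h5 := le_of_mul_le_mul_right h4 hQ0
  have h6 : (i : ℝ) * ((2 * q : ℕ) : ℝ)⁻¹ ≤ 1 := by
    rw [← div_eq_mul_inv]
    exact div_le_one_of_le₀ (by exact_mod_cast hi) (by positivity)
  have h7 : (wOf M' u : ℝ) ≤ ((3 * 2 ^ (w - 4) : ℕ) : ℝ) := by
    rw [(h.rep.loc u hu).load, Nat.cast_mul, mul_comm]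
    have := h.load u
    push_cast at h5 ⊢
    gcongr
    linarith
  exact_mod_cast h7

/-- For `k = 0` no untreated position remains, since positions start at 1. So a hyperedge at `v`
that still has level `2 * q` is supported by another vertex. -/
theorem Lowering.valid (h : Lowering n Z w θ N path M M' v q 0 i) (hV : Valid n Z w θ N f path M)
    (hi : i ≤ 2 * q) (h2 : ∀ u < n, wOf M u < 2 * 2 ^ (w - 4)) (hv : v < n)
    (hq : 0 < q) (hp : pvOf M v = 2 * q) : Valid n Z w θ N f path M' := by
  refine ⟨h.rep, fun t ht => hV.edge t ((h.lev_ne hq t).1 ht), ?_, ?_,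
    fun u hu => h.w_le hV.rep hi h2 hu⟩
  · intro t ht u hu
    rcases h.lev t with h1 | ⟨-, -, -, h3, -⟩
    · rw [h1, h.pv]
      have := hV.pv_le t ((h.lev_ne hq t).1 ht) u hu
      rcases eq_or_ne u v with rfl | huv
      · rw [Function.update_self]
        omega
      · rwa [Function.update_of_ne huv]
    · exact h3 u hu
  · intro t ht
    rcases h.lev t with h1 | ⟨-, -, -, -, h3⟩
    · obtain ⟨u, hu, h4⟩ := hV.supp t ((h.lev_ne hq t).1 ht)
      rcases eq_or_ne u v with rfl | huv
      · have h5 : levOf M' t = 2 * q := by omega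
        refine (h.todo t hu h5).resolve_left fun h6 => ?_
        have := ((h.rep.loc u hv).list (2 * q) t (by omega)).2 ⟨hu, h5⟩
        omega
      · exact ⟨u, hu, by rw [h.pv, Function.update_of_ne huv, h4, h1]⟩
    · exact h3

/-- A hyperedge that keeps its level is counted in `i` all the same; `i` only serves as an upper
bound. -/
theorem Lowering.skip (h : Lowering n Z w θ N path M M' v q (k + 1) i) 
    (ht : posOf M' (key v (2 * q)) t = k + 1)
    (hs : ∃ u ∈ path t, pvOf M' u = levOf M' t) :
    Lowering n Z w θ N path M M' v q k (i + 1) := by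
  refine ⟨h.rep, h.pv, h.lev, fun s hv hl => ?_, by have := h.le_cnt; omega, fun u => ?_, h.other⟩
  · rcases eq_or_ne s t with rfl | hst
    · exact .inr hs
    rcases h.todo s hv hl with h1 | h1
    · left
      by_contra h2
      have h3 : posOf M' (key v (2 * q)) s = k + 1 := by omega
      have h4 := h.rep.wf.arr_pos (key v (2 * q)) s (by omega)
      have h5 := h.rep.wf.arr_pos (key v (2 * q)) t (by omega)
      rw [h3] at h4
      rw [ht] at h5
      exact hst (h4.symm.trans h5)
    · exact .inr h1
  · refine (h.load u).trans ?_
    gcongr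
    omega

/-- The array is traversed from its end, and removing the element at position `k + 1` does not
affect positions up to `k`. The new level is at least the new level `q` of `v`, so the weight grows
by at most `1 / q - 1 / (2q) = 1 / (2q)`. -/
theorem Lowering.step (h : Lowering n Z w θ N path M M' v q (k + 1) i)
    (ht : posOf M' (key v (2 * q)) t = k + 1) (hv : v < n) (hq : 0 < q) {M'' : Mem} {r : ℕ}
    (hm : Moved n Z w θ N path M' M'' t r) (hr : r < 2 * q) (hle : ∀ u ∈ path t, pvOf M' u ≤ r)
    (hs : ∃ u ∈ path t, pvOf M' u = r) :
    Lowering n Z w θ N path M M'' v q k (i + 1) := by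
  obtain ⟨hvt, hlt⟩ := ((h.rep.loc v hv).list (2 * q) t (by omega)).1 (by omega)
  have htZ : t < Z := h.rep.items (key v (2 * q)) t (by omega)
  have hpos : ∀ z, posOf M' (key v (2 * q)) z ≤ k →
      posOf M'' (key v (2 * q)) z = posOf M' (key v (2 * q)) z := by
    intro z hz
    have := hm.pos v z (by omega)
    rw [hlt] at this
    exact this (by omega)
  have hinj : ∀ s, s ≠ t → posOf M' (key v (2 * q)) s ≠ k + 1 := by
    intro s hst h3
    have h4 := h.rep.wf.arr_pos (key v (2 * q)) s (by omega)
    have h5 := h.rep.wf.arr_pos (key v (2 * q)) t (by omega)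
    rw [h3] at h4
    rw [ht] at h5
    exact hst (h4.symm.trans h5)
  refine ⟨hm.rep, by rw [hm.pv, h.pv], fun s => ?_, fun s hvs hl => ?_, ?_, fun u => ?_, fun g a b hg =>
    by rw [hm.other g a b hg, h.other g a b hg]⟩
  · rw [hm.lev, hm.pv]
    rcases eq_or_ne s t with rfl | hst
    · right
      rw [Function.update_self]
      refine ⟨hvt, ?_, hr, hle, hs⟩
      rcases h.lev s with h1 | ⟨-, h1, -⟩ <;> omega
    · rw [Function.update_of_ne hst]
      exact h.lev s
  · rw [hm.lev] at hl
    rcases eq_or_ne s t with rfl | hst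
    · rw [Function.update_self] at hl
      omega
    rw [Function.update_of_ne hst] at hl
    rw [hm.lev, hm.pv, Function.update_of_ne hst]
    rcases h.todo s hvs hl with h1 | h1
    · left
      have := hinj s hst
      rw [hpos s (by omega)]
      omega
    · exact .inr h1
  -- The element at position `k` has kept its position, which bounds the new number of elements from
  -- below.
  · rcases Nat.eq_zero_or_pos k with rfl | hk
    · exact Nat.zero_le _
    have h1 := h.le_cnt
    have h2 := h.rep.wf.pos_arr (key v (2 * q)) (k - 1) (by omega)
    have h3 := hpos (arrOf M' (key v (2 * q)) (k - 1)) (by omega)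
    have := hm.rep.wf.pos_le (key v (2 * q)) _ (by rw [h3]; omega)
    omega
  · rw [hm.lev]
    by_cases hu : u ∈ path t
    · rw [sum_share_update htZ hu, hlt]
      have h1 : q ≤ r := by
        have := hle v hvt
        rw [h.pv, Function.update_self] at this
        exact this
      have hq0 : (0 : ℝ) < q := by exact_mod_cast hq
      have h2 : (r : ℝ)⁻¹ ≤ (q : ℝ)⁻¹ := inv_anti₀ hq0 (by exact_mod_cast h1)
      have h3 : (q : ℝ)⁻¹ = 2 * ((2 * q : ℕ) : ℝ)⁻¹ := by
        push_cast
        field_simp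
      have := h.load u
      push_cast at this h3 ⊢
      linarith
    · rw [load_update_of_notMem hu]
      refine (h.load u).trans ?_
      gcongr
      omega

/-- The weight grows, so `potential_lower` charges `2 * cT * f` with `cT = 64000 * f`. -/
theorem Lowering.potential_step (h : Lowering n Z w θ N path M M' v q k i)
    (hV : Valid n Z w θ N f path M) (hv : v < n) (hq : 0 < q) {M'' : Mem} {r : ℕ}
    (ht : posOf M' (key v (2 * q)) t ≠ 0) (hm : Moved n Z w θ N path M' M'' t r) (hr : r < 2 * q)
    (hle : ∀ u ∈ path t, pvOf M' u ≤ r) :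
    memPotential n Z f path M'' ≤ memPotential n Z f path M' + 128000 * f ^ 2 := by
  obtain ⟨hvt, hlt⟩ := ((h.rep.loc v hv).list (2 * q) t (by omega)).1 ht
  have htZ : t < Z := h.rep.items (key v (2 * q)) t ht
  have h1 : q ≤ r := by
    have := hle v hvt
    rw [h.pv, Function.update_self] at this
    exact this
  unfold memPotential
  rw [hm.lev, hm.pv]
  refine (potential_lower (f := f) (by positivity) (by norm_num) htZ
    (hV.edge t ((h.lev_ne hq t).1 (by omega))).2.1 ?_).trans (by linarith)
  rw [hlt]
  exact inv_anti₀ (by exact_mod_cast (by omega : 0 < r)) (by exact_mod_cast hr.le)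

theorem Rep.cnt_le_load (hR : Rep n Z w θ N path M) (hv : v < n) (hp : p ≠ 0) :
    (cntOf M (key v p) : ℝ) * (p : ℝ)⁻¹ ≤ load Z path (levOf M) v := by
  have hcnt : cntOf M (key v p) ≤ (edgesAt Z path (levOf M) v p).card := by
    refine hR.wf.cnt_le_card fun t ht => ?_
    rw [mem_edgesAt]
    exact ⟨hR.items _ t ht, ((hR.loc v hv).list p t hp).1 ht⟩
  refine le_trans ?_ (card_edgesAt_le Z path (levOf M) v p)
  gcongr

-- Accounting: the new vertex level releases `8000 * q`. At most `q / (64 * f ^ 2)` hyperedges are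
-- treated, each for at most `4000 * f` steps and `128000 * f ^ 2` of potential; this amounts to
-- less than `2100 * q`, and the rest covers the fixed costs and the surplus of 100.
set_option maxHeartbeats 1000000 in
theorem lowerVertex_spec (hE : Env n Z w) (hf : 1 ≤ f) {σ : State} (h2 : σ.v 2 = 2 ^ (w - 4))
    (h3 : σ.v 3 = θ) (h10 : σ.v 10 = v) (hV : Valid n Z w θ N f path σ.mem) (hv : v < n)
    (hθ : 128 * f ^ 2 * θ ≤ 2 ^ (w - 4)) (hW : ∀ u < n, wOf σ.mem u < 2 * 2 ^ (w - 4))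
    (hlow : wOf σ.mem v < θ) (hpv : 1 < pvOf σ.mem v) :
    wp w inp lowerVertex (fun σ' => Valid n Z w θ N f path σ'.mem ∧
      (∀ t, levOf σ'.mem t ≠ 0 ↔ levOf σ.mem t ≠ 0) ∧
      (∀ g a b, g < 4 → σ'.mem (loc g a b) = σ.mem (loc g a b)) ∧ (∀ r < 10, σ'.v r = σ.v r) ∧
      ∃ k : ℕ, σ'.time ≤ σ.time + k ∧
        memPotential n Z f path σ'.mem + k + 100 ≤ memPotential n Z f path σ.mem) σ := by
  have hw0 : w ≠ 0 := by have := hE.w_ge; omega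
  have hR := hV.rep
  obtain ⟨hL, hp2⟩ := (hR.pv_level v).half hpv
  set q := pvOf σ.mem v / 2 with hqdef
  have hq0 : 0 < q := by omega
  have hQ0 : (0 : ℝ) < (2 ^ (w - 4) : ℕ) := by positivity
  have hf0 : (1 : ℝ) ≤ f := by exact_mod_cast hf
  have hload := (hR.loc v hv).load
  have hl1 : 128 * (f : ℝ) ^ 2 * load Z path (levOf σ.mem) v ≤ 1 := by
    have h1 : (wOf σ.mem v : ℝ) ≤ θ := by exact_mod_cast hlow.le
    have h2 : 128 * (f : ℝ) ^ 2 * θ ≤ (2 ^ (w - 4) : ℕ) := by exact_mod_cast hθ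
    have h3 : 128 * (f : ℝ) ^ 2 * wOf σ.mem v ≤ 128 * (f : ℝ) ^ 2 * θ := by gcongr
    have h4 : ((2 ^ (w - 4) : ℕ) : ℝ) * (128 * (f : ℝ) ^ 2 * load Z path (levOf σ.mem) v) ≤
        (2 ^ (w - 4) : ℕ) * 1 := by
      rw [hload] at h3
      linarith
    exact le_of_mul_le_mul_left h4 hQ0
  have hlnn : 0 ≤ load Z path (levOf σ.mem) v := Finset.sum_nonneg fun t _ => share_nonneg v t
  have hl2 : load Z path (levOf σ.mem) v ≤ 1 / 2 := by nlinarith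
  have h2q : 2 * q ≤ Z := hp2 ▸ (hR.pv_level v).le
  have hkey := hE.key_le (hv.le.trans hE.n_le) h2q
  refine wp_seq (wp.mono (readLevel_spec hE h10 hv hR) ?_)
  rintro σ1 ⟨m1, v11, v12, vr1, t1⟩
  refine wp_seq (wp_assign (by simp) (by simpa using hE.fits.lt (a := 2) (by omega)) ?_)
  refine wp_seq (wp.mono (setLevel_spec hE (v := v) (q := q) (θ := θ) (N := N) (path := path)
    (by simp [vr1, h2]) (by simp [vr1, h3]) (by simp [vr1, h10]) (by simp [v11, hqdef])
    (by simpa [m1] using hR) hv hL (by omega)) ?_)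
  rintro σ2 ⟨hS, vr2, t2⟩
  simp only [State.set, m1] at hS
  have lc := hE.fits.loc (g := 7) hkey (b := 0) (by omega)
  have w12 : σ2.v 12 = key v (2 * q) := by simp [vr2, v12, hp2]
  have w11 : σ2.v 11 = 2 * q := by simp [vr2, v11, hp2]
  have w2 : σ2.v 2 = 2 ^ (w - 4) := by simp [vr2, vr1, h2]
  have w3 : σ2.v 3 = θ := by simp [vr2, vr1, h3]
  have vlt : ∀ r < 10, σ2.v r = σ.v r := by
    intro r hr
    rw [vr2 r (by omega)]
    simp [show r ≠ 15 by omega, vr1 r (by omega)]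
  have tt : σ2.time ≤ σ.time + 550 := by
    simp at t2
    omega
  have hphi : memPotential n Z f path σ2.mem + 8000 * q ≤ memPotential n Z f path σ.mem := by
    unfold memPotential
    rw [hS.lev, hS.pv]
    have := potential_down (cT := 64000 * f) (cD := 16000) (Z := Z) (vs := path) (lev := levOf σ.mem)
      (by norm_num) hv hp2 hq0 hl2
    linarith
  set K := cntOf σ2.mem (key v (2 * q)) with hKdef
  -- `K` hyperedges of weight `1 / (2q)` fit into a load of at most `1 / (128 f²)`. This is where
  -- the square in the threshold is needed: each treated hyperedge may cost order `f²`.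
  have hcard : 64 * (f : ℝ) ^ 2 * K ≤ q := by
    have h3 := hS.rep.cnt_le_load hv (p := 2 * q) (by omega)
    have hq' : (0 : ℝ) < (2 * q : ℕ) := by exact_mod_cast (by omega : 0 < 2 * q)
    rw [hS.lev, ← div_eq_mul_inv, div_le_iff₀ hq'] at h3
    have h4 : 128 * (f : ℝ) ^ 2 * K ≤
        128 * (f : ℝ) ^ 2 * (load Z path (levOf σ.mem) v * (2 * q : ℕ)) := by gcongr
    have h5 : 128 * (f : ℝ) ^ 2 * load Z path (levOf σ.mem) v * (2 * q : ℕ) ≤ 1 * (2 * q : ℕ) := by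
      gcongr
    push_cast at h4 h5
    linarith
  have hK : K ≤ 2 * q := by
    have h0 : (0 : ℝ) ≤ K := by positivity
    have hf2 : 1 ≤ (f : ℝ) ^ 2 := one_le_pow₀ hf0
    have h1 : (K : ℝ) ≤ 2 * q := by nlinarith
    exact_mod_cast h1
  refine wp_seq (wp_assign (by simp) (by simpa [w12] using lc) ?_)
  set σ3 := State.set _ 13 _ _ with hσ3
  have m3 : σ3.mem = σ2.mem := rfl
  have v13 : σ3.v 13 = K := by simp [hσ3, w12, hKdef, cntOf]
  have vr3 : ∀ r < 13, σ3.v r = σ2.v r := by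
    intro r hr
    simp [hσ3, show r ≠ 13 by omega]
  have t3 : σ3.time ≤ σ.time + 570 := by
    simp [hσ3]
    omega
  clear_value σ3 K
  refine wp_while (fun τ => ∃ i : ℕ, Lowering n Z w θ N path σ.mem τ.mem v q (τ.v 13) i ∧
    i + τ.v 13 ≤ K ∧ (∀ r < 13, τ.v r = σ2.v r) ∧
      τ.time ≤ σ3.time + i * (4000 * f) ∧
      memPotential n Z f path τ.mem ≤ memPotential n Z f path σ2.mem + i * (128000 * f ^ 2))
    (fun τ => τ.v 13) ?_ ⟨0, ⟨m3 ▸ hS.rep, by rw [m3, hS.pv], fun t => .inl (by rw [m3, hS.lev]),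
      fun t _ _ => ?_, by rw [v13, m3, hKdef], by simp [m3, hS.lev], by rw [m3]; exact hS.other⟩,
      by omega, vr3, by simp, by simp [m3]⟩
  swap
  · left
    rcases Nat.eq_zero_or_pos (posOf σ3.mem (key v (2 * q)) t) with h | h
    · omega
    · rw [m3] at h ⊢
      rw [v13, hKdef]
      exact hS.rep.wf.pos_le _ _ h.ne'
  rintro τ ⟨i, hI, hi, vr, ht, hphi'⟩
  refine ⟨by simp, by simp, fun hlt => ?_, fun hle => ?_⟩
  · obtain ⟨k, hk⟩ : ∃ k, τ.v 13 = k + 1 :=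
      Nat.exists_eq_succ_of_ne_zero (by simpa [Nat.pos_iff_ne_zero] using hlt)
    rw [hk] at hI hi
    have hkc := hI.le_cnt
    have hcl := hI.rep.wf.cnt_le (k := key v (2 * q)) (Z := Z) (fun x => hI.rep.items _ x)
    have hZ8 := hE.Z_le
    set t := arrOf τ.mem (key v (2 * q)) k with htdef
    have hpos : posOf τ.mem (key v (2 * q)) t = k + 1 := by
      rw [htdef, hI.rep.wf.pos_arr _ _ (by omega)]
    obtain ⟨hvt, hlt⟩ := ((hI.rep.loc v hv).list (2 * q) t (by omega)).1 (by omega)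
    have htN : t ≤ N := hI.rep.lev_le t (by omega)
    have htE := hV.edge t ((hI.lev_ne hq0 t).1 (by omega))
    have la := hE.fits.loc (g := 8) hkey (b := k) (by omega)
    have hkw := hE.lt (a := k + 1) (by omega)
    refine wp_seq (wp_assign (by simp) (by simpa [hk, hw0] using hkw) ?_)
    refine wp_seq (wp_assign (by simp) (by simpa [hk, vr, w12] using la) ?_)
    refine wp_seq (wp.mono (maxLevel_spec hE (t := t) (θ := θ) (N := N) (path := path) (n := n) (Z := Z)
      (by simp [hk, vr, w12, htdef, arrOf]) (by simpa using hI.rep) htN htE.2.2) ?_)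
    rintro σ4 ⟨m4, hle4, hex4, vr4, t4⟩
    simp only [State.set, State.tick] at m4 hle4 hex4
    have x13 : σ4.v 13 = k := by simp [vr4, hk]
    have x14 : σ4.v 14 = t := by simp [vr4, hk, vr, w12, htdef, arrOf]
    have x11 : σ4.v 11 = 2 * q := by simp [vr4, vr, w11]
    have x2 : σ4.v 2 = 2 ^ (w - 4) := by simp [vr4, vr, w2]
    have x3 : σ4.v 3 = θ := by simp [vr4, vr, w3]
    have xlt : ∀ r < 13, σ4.v r = σ2.v r := by
      intro r hr
      rw [vr4 r (by omega), ← vr r hr]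
      simp [show r ≠ 13 by omega, show r ≠ 14 by omega]
    have tt4 : σ4.time ≤ τ.time + (200 * f + 100) := by
      simp at t4
      have := htE.2.1
      omega
    clear_value t
    obtain ⟨u, hu, hu4⟩ := hex4
    refine wp_ite (by simp) (by simp) (fun hc => ?_) (fun hc => ?_)
    · have hr : σ4.v 21 < 2 * q := by simpa [x11] using hc
      refine wp_seq (wp_assign (by simp) (by simp) ?_)
      refine wp_seq (wp_assign (by simp) (by simp) ?_)
      refine wp.mono (moveEdge_spec hE (t := t) (p' := σ4.v 21) (θ := θ) (N := N) (path := path)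
        (by simp [x2]) (by simp [x3]) (by simp [x14])
        (by simp) (by simpa [m4] using hI.rep) htN htE.1 (hu4 ▸ hI.rep.pv_level u)
        (fun z hz => by
          simpa [m4] using hI.w_le hR (by omega) hW (hI.rep.trie.lt t htN z hz))) ?_
      rintro τ' ⟨hm, vr', ht'⟩
      simp only [State.set, State.tick, m4] at hm
      have y13 : τ'.v 13 = k := by simp [vr', x13]
      refine ⟨⟨i + 1, ?_, by omega, ?_, ?_, ?_⟩, by omega⟩
      · rw [y13]
        exact hI.step hpos hv hq0 hm hr hle4 ⟨u, hu, hu4⟩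
      · intro r hr
        rw [vr' r (by omega), ← xlt r hr]
        simp [show r ≠ 24 by omega, show r ≠ 25 by omega]
      · simp at ht'
        have := htE.2.1
        rw [Nat.succ_mul]
        omega
      · have := hI.potential_step hV hv hq0 (by omega) hm hr hle4
        push_cast
        linarith
    · have hr : 2 * q ≤ σ4.v 21 := by simpa [x11] using hc
      -- The maximum is attained at `u` and is at least `2 * q`, while validity before the lowering
      -- bounds it by the level `2 * q` of the hyperedge.
      have hsup : ∃ u ∈ path t, pvOf τ.mem u = levOf τ.mem t := by
        refine ⟨u, hu, ?_⟩
        have h1 : pvOf τ.mem u ≤ pvOf σ.mem u := by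
          rw [hI.pv]
          rcases eq_or_ne u v with rfl | huv
          · rw [Function.update_self]
            omega
          · rw [Function.update_of_ne huv]
        have h2 := hV.pv_le t ((hI.lev_ne hq0 t).1 (by omega)) u hu
        rcases hI.lev t with h | ⟨-, h, -⟩ <;> omega
      refine wp_assign (by simp) (by simp) ⟨⟨i + 1, ?_, ?_, ?_, ?_, ?_⟩, ?_⟩
      · simpa [m4, x13] using hI.skip hpos hsup
      · simp [x13]
        omega
      · intro r hr
        rw [← xlt r hr]
        exact Function.update_of_ne (by omega) _ _
      · simp only [State.set, State.tick, Expr.cost, add_mul, one_mul]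
        omega
      · simp only [State.set, State.tick, m4]
        push_cast
        have : (0 : ℝ) ≤ 128000 * f ^ 2 := by positivity
        linarith
      · simp [x13, hk]
  · have hk : τ.v 13 = 0 := by simpa using hle
    rw [hk] at hI hi
    refine ⟨hI.valid hV (by omega) hW hv hq0 hp2, hI.lev_ne hq0, hI.other, ?_,
      600 + i * (4000 * f), ?_, ?_⟩
    · intro r hr
      rw [← vlt r hr, ← vr r (by omega)]
      rfl
    · simp
      omega
    · have hi' : (i : ℝ) ≤ K := by exact_mod_cast (by omega : i ≤ K)
      have h1 : 64 * (f : ℝ) ^ 2 * i ≤ q := le_trans (by gcongr) hcard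
      have h2 : (i : ℝ) * f ≤ i * f ^ 2 := by
        gcongr
        exact le_self_pow₀ hf0 (by norm_num)
      have h3 : (1 : ℝ) ≤ q := by exact_mod_cast hq0
      simp only [State.tick]
      push_cast
      nlinarith

end

section

variable {n Z w θ N N' f v : ℕ} {path path' : ℕ → List ℕ} {M M' : Mem} {inp : List ℕ}

/-! ### Reaching a stable state -/

/-- Treat vertices until none is left to be treated. -/
def settle : Stmt :=
  .while (.const 0)
    (.op .add (.cell 7 (.const 0) (.const 0)) (.cell 7 (.const 1) (.const 0))) <|
    .ite (.const 0) (.cell 7 (.const 0) (.const 0))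
      (.seq (.assign 10 (.cell 8 (.const 0) (.op .sub (.cell 7 (.const 0) (.const 0)) (.const 1))))
        raiseVertex)
      (.seq (.assign 10 (.cell 8 (.const 1) (.op .sub (.cell 7 (.const 1) (.const 0)) (.const 1))))
        lowerVertex)

theorem memPotential_nonneg : 0 ≤ memPotential n Z f path M :=
  potential_nonneg (by positivity) (by norm_num)

/-- Each treatment is paid for by the potential with a surplus of 100, which covers the overhead of
the loop and makes the integer part of the potential decrease; hence the loop ends. Stability is
emptiness of the sets with keys 0 and 1. -/
theorem settle_spec (hE : Env n Z w) (hf : 1 ≤ f) {σ : State} (h2 : σ.v 2 = 2 ^ (w - 4))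
    (h3 : σ.v 3 = θ) (hV : Valid n Z w θ N f path σ.mem) (hθ : 128 * f ^ 2 * θ ≤ 2 ^ (w - 4)) :
    wp w inp settle (fun σ' => Valid n Z w θ N f path σ'.mem ∧
      (∀ v < n, wOf σ'.mem v < 2 * 2 ^ (w - 4) ∧ (wOf σ'.mem v < θ → pvOf σ'.mem v = 1)) ∧
      (∀ t, levOf σ'.mem t ≠ 0 ↔ levOf σ.mem t ≠ 0) ∧
      (∀ g a b, g < 4 → σ'.mem (loc g a b) = σ.mem (loc g a b)) ∧
      ∃ k : ℕ, σ'.time ≤ σ.time + k ∧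
        memPotential n Z f path σ'.mem + k ≤ memPotential n Z f path σ.mem + 100) σ := by
  have hw0 : w ≠ 0 := by have := hE.w_ge; omega
  have h1w : 1 < 2 ^ w := hE.fits.lt (by omega)
  have l0 := hE.fits.loc (g := 7) (a := 0) (by omega) (b := 0) (by omega)
  have l1 := hE.fits.loc (g := 7) (a := 1) (by omega) (b := 0) (by omega)
  have hZ8 := hE.Z_le
  refine wp_while (fun τ => Valid n Z w θ N f path τ.mem ∧
    (∀ t, levOf τ.mem t ≠ 0 ↔ levOf σ.mem t ≠ 0) ∧
    (∀ g a b, g < 4 → τ.mem (loc g a b) = σ.mem (loc g a b)) ∧ (∀ r < 10, τ.v r = σ.v r) ∧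
    ∃ k : ℕ, τ.time ≤ σ.time + k ∧ memPotential n Z f path τ.mem + k ≤ memPotential n Z f path σ.mem)
    (fun τ => ⌊memPotential n Z f path τ.mem⌋₊) ?_
    ⟨hV, fun _ => Iff.rfl, fun _ _ _ _ => rfl, fun _ _ => rfl, 0, by simp, by simp⟩
  rintro τ ⟨hI, hlev, hoth, hr, k, ht, hphi⟩
  have c0 := hI.rep.wf.cnt_le (k := 0) (Z := Z) (fun x => hI.rep.items _ x)
  have c1 := hI.rep.wf.cnt_le (k := 1) (Z := Z) (fun x => hI.rep.items _ x)
  have c01 : cntOf τ.mem 0 + cntOf τ.mem 1 < 2 ^ w := by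
    have := hE.fits.sq
    nlinarith
  have hfloor : ∀ τ' : State, ∀ j : ℕ, memPotential n Z f path τ'.mem + j + 100 ≤
      memPotential n Z f path τ.mem →
      ⌊memPotential n Z f path τ'.mem⌋₊ < ⌊memPotential n Z f path τ.mem⌋₊ := by
    intro τ' j hj
    rw [Nat.lt_iff_add_one_le, ← Nat.floor_add_one memPotential_nonneg]
    refine Nat.floor_mono ?_
    have : (0 : ℝ) ≤ j := by positivity
    linarith
  refine ⟨by simp, by simpa [hw0, ← two_mul] using ⟨l0, l1, c01⟩, fun hlt => ?_, fun hle => ?_⟩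
  · have hc : 0 < cntOf τ.mem 0 + cntOf τ.mem 1 := by simpa [cntOf] using hlt
    refine wp_ite (by simp) (by simpa using l0) (fun hd => ?_) (fun hd => ?_)
    · have hd0 : 0 < cntOf τ.mem 0 := by simpa [cntOf] using hd
      set v := arrOf τ.mem 0 (cntOf τ.mem 0 - 1) with hvdef
      have hpos : posOf τ.mem 0 v ≠ 0 := by
        rw [hvdef, hI.rep.wf.pos_arr _ _ (by omega)]
        omega
      have hv := hI.rep.low 0 v (by omega) hpos
      have la := hE.fits.loc (g := 8) (a := 0) (by omega) (b := cntOf τ.mem 0 - 1) (by omega)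
      refine wp_seq (wp_assign (by simp) ?_ ?_)
      · simpa [hw0, cntOf] using ⟨⟨l0, hd0, hE.lt c0⟩, la⟩
      refine wp.mono (raiseVertex_spec hE hf (v := v) (θ := θ) (N := N) (path := path)
        (by simp [hr, h2]) (by simp [hr, h3]) (by simp [hvdef, arrOf, cntOf]) (by simpa using hI) hv
        (by simpa using ((hI.rep.loc v hv).up.1 hpos))) ?_
      rintro τ' ⟨hV', hlev', hoth', hr', j, ht', hphi'⟩
      simp only [State.set, State.tick] at hlev' hoth' hphi'
      refine ⟨⟨hV', fun t => (hlev' t).trans (hlev t), fun g a b hg => by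
        rw [hoth' g a b hg, hoth g a b hg], fun r hr2 => ?_, k + j + 100, ?_, ?_⟩, hfloor τ' j hphi'⟩
      · rw [hr' r hr2, ← hr r hr2]
        simp [show r ≠ 10 by omega]
      · simp at ht'
        omega
      · push_cast
        linarith
    · have hd0 : 0 < cntOf τ.mem 1 := by
        have : cntOf τ.mem 0 = 0 := by simpa [cntOf] using hd
        omega
      have hz : cntOf τ.mem 0 = 0 := by simpa [cntOf] using hd
      set v := arrOf τ.mem 1 (cntOf τ.mem 1 - 1) with hvdef
      have hpos : posOf τ.mem 1 v ≠ 0 := by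
        rw [hvdef, hI.rep.wf.pos_arr _ _ (by omega)]
        omega
      have hv := hI.rep.low 1 v (by omega) hpos
      have la := hE.fits.loc (g := 8) (a := 1) (by omega) (b := cntOf τ.mem 1 - 1) (by omega)
      have hdn := (hI.rep.loc v hv).down.1 hpos
      refine wp_seq (wp_assign (by simp) ?_ ?_)
      · simpa [hw0, cntOf] using ⟨⟨l1, hd0, hE.lt c1⟩, la⟩
      refine wp.mono (lowerVertex_spec hE hf (v := v) (θ := θ) (N := N) (path := path)
        (by simp [hr, h2]) (by simp [hr, h3]) (by simp [hvdef, arrOf, cntOf]) (by simpa using hI) hv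
        hθ ?_ (by simpa using hdn.1) (by simpa using hdn.2)) ?_
      -- Lowering happens only when the set with key 0 is empty, that is, when all loads are below
      -- 2; this leaves room for the increase that it causes.
      · intro u hu
        by_contra h
        have h4 := (hI.rep.loc u hu).up.2 (by simpa using h)
        have := hI.rep.wf.pos_le _ _ h4
        omega
      rintro τ' ⟨hV', hlev', hoth', hr', j, ht', hphi'⟩
      simp only [State.set, State.tick] at hlev' hoth' hphi'
      refine ⟨⟨hV', fun t => (hlev' t).trans (hlev t), fun g a b hg => by
        rw [hoth' g a b hg, hoth g a b hg], fun r hr2 => ?_, k + j + 100, ?_, ?_⟩, hfloor τ' j hphi'⟩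
      · rw [hr' r hr2, ← hr r hr2]
        simp [show r ≠ 10 by omega]
      · simp at ht'
        omega
      · push_cast
        linarith
  · have hc : cntOf τ.mem 0 = 0 ∧ cntOf τ.mem 1 = 0 := by simpa [cntOf] using hle
    refine ⟨hI, fun v hv => ⟨?_, fun hlow => ?_⟩, hlev, hoth, k + 100, ?_, ?_⟩
    · by_contra h
      have h4 := (hI.rep.loc v hv).up.2 (by simpa using h)
      have := hI.rep.wf.pos_le _ _ h4
      omega
    · by_contra h
      have h5 := pvOf_pos τ.mem v
      simp only [State.tick] at hlow h
      have h4 := (hI.rep.loc v hv).down.2 ⟨hlow, by omega⟩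
      have := hI.rep.wf.pos_le _ _ h4
      omega
    · simp
      omega
    · simp only [State.tick]
      push_cast
      linarith

/-! ### The dictionary -/

/-- Each step to the parent removes the last entry, so the represented lists are closed under
prefixes. -/
theorem Trie.exists_prefix (h : Trie n N path M) {y : ℕ} (hy : y ≤ N) (l₁ l₂ : List ℕ)
    (hp : path y = l₁ ++ l₂) : ∃ x ≤ N, path x = l₁ := by
  induction l₂ using List.reverseRecOn generalizing y with
  | nil => exact ⟨y, hy, by simpa using hp⟩
  | append_singleton l₂ a ih =>
    have hy0 : y ≠ 0 := by
      rintro rfl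
      rw [h.root] at hp
      simp at hp
    have h1 := h.path_eq y hy0 hy
    rw [hp, ← List.append_assoc] at h1
    exact ih ((h.parent_lt y hy0 hy).le.trans hy) (List.append_inj_left' h1 rfl).symm

/-- The new node must have no children: a list extending its path would, by closure under prefixes,
have put that path into the dictionary already. -/
theorem Trie.addNode (h : Trie n N path M) {x v : ℕ} (hx : x ≤ N) (hv : v < n)
    (hc : M (loc 0 x v) = 0) (m0 : M' (loc 0 x v) = N + 1) (m1 : M' (loc 1 (N + 1) 0) = x)
    (m2 : M' (loc 2 (N + 1) 0) = v) (m3 : M' (loc 3 0 0) = N + 1)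
    (o0 : ∀ a b, ¬(a = x ∧ b = v) → M' (loc 0 a b) = M (loc 0 a b))
    (o1 : ∀ a, a ≠ N + 1 → M' (loc 1 a 0) = M (loc 1 a 0))
    (o2 : ∀ a, a ≠ N + 1 → M' (loc 2 a 0) = M (loc 2 a 0)) :
    Trie n (N + 1) (Function.update path (N + 1) (path x ++ [v])) M' := by
  have hold : ∀ y ≤ N, Function.update path (N + 1) (path x ++ [v]) y = path y := fun y hy =>
    Function.update_of_ne (by omega) _ _
  have hnew : Function.update path (N + 1) (path x ++ [v]) (N + 1) = path x ++ [v] :=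
    Function.update_self ..
  have hcase : ∀ y ≤ N + 1, y ≤ N ∨ y = N + 1 := by omega
  have hne := h.child_zero x hx v hc
  set path' := Function.update path (N + 1) (path x ++ [v]) with hpath'
  clear_value path'
  refine ⟨?_, ?_, ?_, ?_, ?_, ?_, ?_, m3, ?_⟩
  · rw [hold 0 (by omega), h.root]
  · intro y hy0 hy
    rcases hcase y hy with hy | rfl
    · rw [o1 y (by omega)]
      exact h.parent_lt y hy0 hy
    · omega
  · intro y hy0 hy
    rcases hcase y hy with hy | rfl
    · have := h.parent_lt y hy0 hy
      rw [o1 y (by omega), o2 y (by omega), hold y hy, hold _ (by omega)]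
      exact h.path_eq y hy0 hy
    · rw [m1, m2, hnew, hold x hx]
  · intro y hy z hz hyz
    rcases hcase y hy with hy | rfl <;> rcases hcase z hz with hz | rfl
    · rw [hold y hy, hold z hz] at hyz
      exact h.inj y hy z hz hyz
    · rw [hold y hy, hnew] at hyz
      exact absurd hyz (hne y hy)
    · rw [hold z hz, hnew] at hyz
      exact absurd hyz.symm (hne z hz)
    · rfl
  · intro y hy u hu z hz hzy
    have hyu : ¬(y = x ∧ u = v) := by
      rintro ⟨rfl, rfl⟩
      omega
    rw [o0 y u hyu] at hu
    rcases hcase y hy with hy | rfl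
    · rw [hold y hy] at hzy
      rcases hcase z hz with hz | rfl
      · rw [hold z hz] at hzy
        exact h.child_zero y hy u hu z hz hzy
      · rw [hnew] at hzy
        obtain ⟨h1, h2⟩ := List.append_inj' hzy rfl
        exact hyu ⟨(h.inj x hx y hy h1).symm, by simpa using h2.symm⟩
    · rw [hnew] at hzy
      rcases hcase z hz with hz | rfl
      · rw [hold z hz] at hzy
        obtain ⟨y', hy', h1⟩ := h.exists_prefix hz _ _ hzy
        exact hne y' hy' h1
      · rw [hnew] at hzy
        simpa using congrArg List.length hzy
  · intro y hy u hu
    by_cases hyu : y = x ∧ u = v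
    · obtain ⟨rfl, rfl⟩ := hyu
      rw [m0, hnew, hold y hx]
      exact ⟨le_rfl, rfl⟩
    · rw [o0 y u hyu] at hu ⊢
      rcases hcase y hy with hy | rfl
      · obtain ⟨h1, h2⟩ := h.child_ne y hy u hu
        exact ⟨by omega, by rw [hold _ h1, hold y hy, h2]⟩
      · exact absurd (h.fresh (N + 1) (by omega) u) hu
  · intro y hy u
    rw [o0 y u (by omega)]
    exact h.fresh y (by omega) u
  · intro y hy u hu
    rcases hcase y hy with hy | rfl
    · rw [hold y hy] at hu
      exact h.lt y hy u hu
    · rw [hnew, List.mem_append, List.mem_singleton] at hu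
      rcases hu with hu | rfl
      · exact h.lt x hx u hu
      · exact hv

/-- Look up the hyperedge of the request in the dictionary, where it is inserted if necessary;
variable `4` becomes its number. -/
def findEdge : Stmt :=
  .seq (.assign 4 (.const 0)) <|
  .seq (.assign 5 (.const 0)) <|
  .seq (.assign 6 (.inp (.const 3))) <|
  .while (.var 5) (.var 6) <|
    .seq (.assign 7 (.inp (.op .add (.const 4) (.var 5)))) <|
    .seq (.assign 8 (.cell 0 (.var 4) (.var 7))) <|
    .seq (.ite (.const 0) (.var 8) skip <|
      .seq (.assign 8 (.op .add (.cell 3 (.const 0) (.const 0)) (.const 1))) <|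
      .seq (.store 3 (.const 0) (.const 0) (.var 8)) <|
      .seq (.store 0 (.var 4) (.var 7) (.var 8)) <|
      .seq (.store 1 (.var 8) (.const 0) (.var 4)) <|
      .store 2 (.var 8) (.const 0) (.var 7)) <|
    .seq (.assign 4 (.var 8)) <|
    .assign 5 (.op .add (.var 5) (.const 1))

/-- The dictionary has been extended, unless it contained `l`. -/
structure Extended (n N N' : ℕ) (path path' : ℕ → List ℕ) (M M' : Mem) (l : List ℕ) : Prop where
  trie : Trie n N' path' M'
  N_le : N ≤ N'
  path_eq : ∀ y ≤ N, path' y = path y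
  other : ∀ g a b, 4 ≤ g → g < 16 → M' (loc g a b) = M (loc g a b)
  same : (∃ y ≤ N, path y = l) → N' = N ∧ path' = path ∧ M' = M

/-- New nodes are created only for an unknown list, at most one per entry. For a known list the
memory is untouched, so the same routine may be used by queries. -/
theorem findEdge_spec (hE : Env n Z w) {σ : State} {k0 k1 k2 : ℕ} {l : List ℕ}
    (hinp : inp = [k0, k1, k2, l.length] ++ l) (hl : ∀ v ∈ l, v < n)
    (hT : Trie n N path σ.mem) (hN : N < Z) (hlZ : l.length < Z)
    (hZ : (¬∃ y ≤ N, path y = l) → N + l.length < Z) :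
    wp w inp findEdge (fun σ' => (∃ N' path', Extended n N N' path path' σ.mem σ'.mem l ∧
      N' ≤ N + l.length ∧ N' < Z ∧ σ'.v 4 ≤ N' ∧ path' (σ'.v 4) = l) ∧
      (∀ r < 4, σ'.v r = σ.v r) ∧ σ'.time ≤ σ.time + 200 * (l.length + 1)) σ := by
  have hw0 : w ≠ 0 := by have := hE.w_ge; omega
  have h4w : 4 < 2 ^ w := hE.fits.lt (by omega)
  have h3w : 3 < 2 ^ w := by omega
  have i3 : inp.getD 3 0 = l.length := by simp [hinp]
  have i4 : ∀ j (hj : j < l.length), inp.getD (4 + j) 0 = l[j] := by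
    intro j hj
    simp [hinp, add_comm 4 j, hj]
  have hlw : l.length < 2 ^ w := hE.lt hlZ.le
  refine wp_seq (wp_assign (by simp) (by simp) ?_)
  refine wp_seq (wp_assign (by simp) (by simp) ?_)
  refine wp_seq (wp_assign (by simp) (by
    simp only [Expr.ok, Expr.eval]
    exact ⟨h3w, by rwa [i3]⟩) ?_)
  refine wp_while (fun τ => ∃ N' path', Extended n N N' path path' σ.mem τ.mem l ∧
      τ.v 5 ≤ l.length ∧ N' ≤ N + τ.v 5 ∧ N' < Z ∧ τ.v 4 ≤ N' ∧ path' (τ.v 4) = l.take (τ.v 5) ∧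
      τ.v 6 = l.length ∧ (∀ r < 4, τ.v r = σ.v r) ∧ τ.time ≤ σ.time + 50 + 200 * τ.v 5)
    (fun τ => l.length - τ.v 5) ?_
    ⟨N, path, ⟨hT, le_rfl, fun _ _ => rfl, fun _ _ _ _ _ => rfl, fun _ => ⟨rfl, rfl, rfl⟩⟩, by simp,
      by simp, hN, by simp, by simp [hT.root], by simpa using i3, ?_, by simp⟩
  swap
  · intro r hr
    simp [show r ≠ 4 by omega, show r ≠ 5 by omega, show r ≠ 6 by omega]
  rintro τ ⟨N', path', hX, hj, hN', hN'Z, hx, hp, h6, hr, ht⟩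
  refine ⟨by simp, by simp, fun hlt => ?_, fun hle => ?_⟩
  · have hjl : τ.v 5 < l.length := by simpa [h6] using hlt
    set j := τ.v 5 with hjdef
    set x := τ.v 4 with hxdef
    have hv : l[j] < n := hl _ (List.getElem_mem hjl)
    have htake : l.take (j + 1) = path' x ++ [l[j]] := by
      rw [hp, List.take_succ_eq_append_getElem hjl]
    have hn := hE.n_le
    have hvw : l[j] < 2 ^ w := hE.lt (by omega)
    have l0 := hE.loc (g := 0) (a := x) (by omega) (b := l[j]) (by omega)
    have hinpj := i4 j hjl
    have hjw : 4 + j < 2 ^ w := by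
      have := hE.fits.sq
      have := hE.Z_le
      nlinarith
    set vj := l[j] with hvj
    clear_value vj
    refine wp_seq (wp_assign (by simp) (by
      simp only [Expr.ok, Expr.eval, Op.safe, Op.nat, State.tick, ← hjdef, hinpj]
      exact ⟨⟨h4w, by norm_num, hjw⟩, hvw⟩) ?_)
    set τ1 := State.set _ 7 _ _ with hτ1
    have a7 : τ1.v 7 = vj := by
      simp only [hτ1, State.set, Function.update_self, Expr.eval, Op.nat]
      exact hinpj
    have am : τ1.mem = τ.mem := rfl
    have ar : ∀ r < 7, τ1.v r = τ.v r := by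
      intro r hr
      simp [hτ1, show r ≠ 7 by omega]
    have at1 : τ1.time ≤ τ.time + 20 := by simp [hτ1]
    clear_value τ1
    refine wp_seq (wp_assign (by simp) (by simpa [a7, ar, ← hxdef] using l0) ?_)
    set τ2 := State.set _ 8 _ _ with hτ2
    have b7 : τ2.v 7 = vj := by simp [hτ2, a7]
    have b8 : τ2.v 8 = τ.mem (loc 0 x vj) := by simp [hτ2, a7, ar, ← hxdef, am]
    have bm : τ2.mem = τ.mem := am
    have br : ∀ r < 7, τ2.v r = τ.v r := by
      intro r hr
      simp [hτ2, show r ≠ 8 by omega, ar r hr]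
    have bt : τ2.time ≤ τ.time + 50 := by
      simp [hτ2]
      omega
    clear_value τ2
    refine wp_seq (wp.mono (Q := fun τ' => ∃ N'' path'', Extended n N N'' path path'' σ.mem τ'.mem l ∧
      N'' ≤ N + (j + 1) ∧ N'' < Z ∧ τ'.v 8 ≤ N'' ∧ path'' (τ'.v 8) = l.take (j + 1) ∧
      (∀ r < 7, τ'.v r = τ.v r) ∧ τ'.time ≤ τ.time + 180) ?_ ?_)
    · refine wp_ite (by simp) (by simp) (fun hc => ?_) (fun hc => ?_)
      · have hc0 : τ.mem (loc 0 x vj) ≠ 0 := by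
          simpa [b8, Nat.pos_iff_ne_zero] using hc
        obtain ⟨h1, h2⟩ := hX.trie.child_ne x hx vj hc0
        refine wp_assign (by simp) (by simp) ⟨N', path', by simpa [bm] using hX, by omega, hN'Z, ?_, ?_,
          ?_, ?_⟩
        · simpa [b8] using h1
        · simp [b8, h2, htake]
        · intro r hr2
          simp [show r ≠ 49 by omega, br r hr2]
        · simp
          omega
      · have hc0 : τ.mem (loc 0 x vj) = 0 := by simpa [b8] using hc
        -- If the list were known, all its prefixes would have nodes, and the lookup of the next
        -- entry could not have failed.
        have hnot : ¬∃ y ≤ N, path y = l := by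
          intro h
          obtain ⟨h1, h2, h3⟩ := hX.same h
          obtain ⟨y, hy, h4⟩ := h
          rw [h1] at hx
          have h5 := hX.trie
          rw [h1] at h5
          obtain ⟨z, hz, h6⟩ := h5.exists_prefix (y := y) hy (l.take (j + 1)) (l.drop (j + 1))
            (by rw [h2, h4, List.take_append_drop])
          exact h5.child_zero x hx vj hc0 z hz (by rw [h6, htake])
        have hNZ := hZ hnot
        have e3 : τ.mem (loc 3 0 0) = N' := hX.trie.count
        have l3 := hE.loc (g := 3) (a := 0) (by omega) (b := 0) (by omega)
        have l1 := hE.loc (g := 1) (a := N' + 1) (by omega) (b := 0) (by omega)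
        have l2 := hE.loc (g := 2) (a := N' + 1) (by omega) (b := 0) (by omega)
        have hNw : N' + 1 < 2 ^ w := hE.lt (by omega)
        have b4 : τ2.v 4 = x := br 4 (by omega)
        refine wp_seq (wp_assign (by simp) (by simpa [bm, e3, hw0] using ⟨l3, hNw⟩) ?_)
        refine wp_seq (wp_store (by simp) (by simp) (by simp) (by simpa using l3) ?_)
        refine wp_seq (wp_store (by simp) (by simp) (by simp) (by simpa [b4, b7] using l0) ?_)
        refine wp_seq (wp_store (by simp) (by simp) (by simp) (by simpa [bm, e3] using l1) ?_)
        refine wp_store (by simp) (by simp) (by simp) (by simpa [bm, e3] using l2) ?_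
        set τ3 := State.put _ _ _ _ with hτ3
        have m3 : τ3.mem = Function.update (Function.update (Function.update (Function.update τ.mem
            (loc 3 0 0) (N' + 1)) (loc 0 x vj) (N' + 1)) (loc 1 (N' + 1) 0) x)
            (loc 2 (N' + 1) 0) vj := by
          simp [hτ3, bm, e3, b4, b7]
        have c8 : τ3.v 8 = N' + 1 := by simp [hτ3, bm, e3]
        have cr : ∀ r < 7, τ3.v r = τ.v r := by
          intro r hr2
          simp [hτ3, show r ≠ 8 by omega, br r hr2]
        have ct : τ3.time ≤ τ.time + 150 := by
          simp [hτ3]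
          omega
        clear_value τ3
        refine ⟨N' + 1, Function.update path' (N' + 1) (path' x ++ [vj]), ⟨?_, ?_, ?_, ?_, ?_⟩, by omega,
          by omega, by omega, by rw [c8, Function.update_self, htake], cr, by omega⟩
        · refine hX.trie.addNode (v := vj) hx hv hc0 ?_ ?_ ?_ ?_ ?_ ?_ ?_ <;> intros <;>
            simp (disch := norm_num) only [m3, update_loc] <;> grind
        · have := hX.N_le
          omega
        · intro y hy
          have := hX.N_le
          rw [Function.update_of_ne (by omega), hX.path_eq y hy]
        · intro g a b hg hg'
          rw [← hX.other g a b hg hg', m3]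
          simp only [Function.update_apply, loc_inj hg' (by norm_num : (2 : ℕ) < 16),
              loc_inj hg' (by norm_num : (1 : ℕ) < 16),
              loc_inj hg' (by norm_num : (0 : ℕ) < 16),
              loc_inj hg' (by norm_num : (3 : ℕ) < 16)]
          simp [show g ≠ 0 by omega, show g ≠ 1 by omega, show g ≠ 2 by omega, show g ≠ 3 by omega]
        · exact fun h => absurd h hnot
    · rintro τ' ⟨N'', path'', hX', h1, h2, h3, h4, h5, h7⟩
      have h5j : τ'.v 5 = j := h5 5 (by omega)
      refine wp_seq (wp_assign (by simp) (by simp) ?_)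
      refine wp_assign (by simp) ?_ ⟨⟨N'', path'', by simpa using hX', ?_, ?_, h2, ?_, ?_, ?_, ?_, ?_⟩, ?_⟩
      · have : j + 1 < 2 ^ w := by omega
        simpa [h5j, hw0] using this
      · simp [h5j]
        omega
      · simpa [h5j] using h1
      · simpa using h3
      · simpa [h5j] using h4
      · simp [h5 6, h6]
      · intro r hr2
        simp [show r ≠ 4 by omega, show r ≠ 5 by omega, h5 r (by omega), hr r hr2]
      · simp [h5j]
        omega
      · simp [h5j]
        omega
  · have hjl : l.length ≤ τ.v 5 := by simpa [h6] using hle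
    refine ⟨⟨N', path', hX, by omega, hN'Z, hx, ?_⟩, hr, ?_⟩
    · simpa [List.take_of_length_le hjl] using hp
    · simp
      omega

end

/-! ### Duality of fractional matchings and vertex covers -/

section

variable {n : ℕ} {E : Finset (Finset (Fin n))} {x : Finset (Fin n) → ℝ} {S : Finset (Fin n)}

/-- Weak duality: charge each hyperedge to a vertex of the cover that it contains; every vertex is
charged at most 1. -/
theorem sum_le_card_of_cover (hx : IsFractionalMatching E x) (hS : IsVertexCover E S) :
    ∑ e ∈ E, x e ≤ S.card := by
  calc ∑ e ∈ E, x e ≤ ∑ e ∈ E, ∑ v ∈ S, (if v ∈ e then x e else 0) := by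
        refine Finset.sum_le_sum fun e he => ?_
        obtain ⟨v, hv, hvS⟩ := hS e he
        have := Finset.single_le_sum (f := fun v => if v ∈ e then x e else 0) (s := S)
          (fun i _ => by
            split_ifs
            · exact hx.1 e he
            · exact le_rfl) hvS
        simpa [hv] using this
    _ = ∑ v ∈ S, ∑ e ∈ E with v ∈ e, x e := by
        rw [Finset.sum_comm]
        simp only [Finset.sum_filter]
    _ ≤ ∑ v ∈ S, 1 := Finset.sum_le_sum fun v _ => hx.2 v
    _ = S.card := by simp

/-- A cover at most `c` times as large as a matching certifies both: every matching is bounded by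
this cover, and every cover bounds this matching. -/
theorem approx_of_card_le {c : ℝ} (hc : 0 ≤ c) (hx : IsFractionalMatching E x)
    (hS : IsVertexCover E S) (h : (S.card : ℝ) ≤ c * ∑ e ∈ E, x e) :
    IsApproxMaxFractionalMatching c E x ∧ IsApproxMinVertexCover c E S :=
  ⟨⟨hx, fun _ hy => (sum_le_card_of_cover hy hS).trans h⟩,
    ⟨hS, fun _ hS' => h.trans (mul_le_mul_of_nonneg_left (sum_le_card_of_cover hx hS') hc)⟩⟩

theorem edgeList_injective : Function.Injective (fun e : Finset (Fin n) => (edgeList e).map Fin.val) := by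
  intro e e' h
  have h1 : edgeList e = edgeList e' := (List.map_injective_iff.2 Fin.val_injective) h
  have h2 := congrArg List.toFinset h1
  simpa [edgeList] using h2

theorem mem_map_edgeList {e : Finset (Fin n)} {v : Fin n} :
    (v : ℕ) ∈ (edgeList e).map Fin.val ↔ v ∈ e := by
  simp [edgeList, Fin.val_inj]

theorem nodup_map_edgeList (e : Finset (Fin n)) : ((edgeList e).map Fin.val).Nodup :=
  List.Nodup.map Fin.val_injective (Finset.sort_nodup _ _)

theorem length_edgeList (e : Finset (Fin n)) : (edgeList e).length = e.card := by
  simp [edgeList]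

end

/-! ### The state between requests -/

/-- The threshold for the weights at the vertices of the cover. -/
def threshold (w f : ℕ) : ℕ := 2 ^ (w - 4) / (128 * (f * f))

/-- The memory represents the hypergraph `E`; the hyperedges in `D` have been seen. -/
structure Represents {n : ℕ} (Z w f N : ℕ) (path : ℕ → List ℕ) (M : Mem)
    (E D : Finset (Finset (Fin n))) : Prop where
  valid : Valid n Z w (threshold w f) N f path M
  stable : ∀ v < n, wOf M v < 2 * 2 ^ (w - 4) ∧ (wOf M v < threshold w f → pvOf M v = 1)
  present : ∀ t ≤ N, levOf M t ≠ 0 ↔ ∃ e ∈ E, path t = (edgeList e).map Fin.val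
  node : ∀ e ∈ D, ∃ t ≤ N, path t = (edgeList e).map Fin.val
  sub : E ⊆ D
  N_le : N ≤ f * D.card

section

variable {n Z w f N : ℕ} {path : ℕ → List ℕ} {M : Mem} {E D : Finset (Finset (Fin n))}

/-- Nodes that do not belong to a hyperedge of `E` have level `0` and contribute nothing, and
different hyperedges have different nodes. -/
theorem Represents.sum_share (h : Represents Z w f N path M E D) {node : Finset (Fin n) → ℕ}
    (hN : ∀ e ∈ E, node e ≤ N) (hp : ∀ e ∈ E, path (node e) = (edgeList e).map Fin.val) (v : Fin n) :
    load Z path (levOf M) v = ∑ e ∈ E with v ∈ e, (levOf M (node e) : ℝ)⁻¹ := by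
  have hinj : Set.InjOn node E := by
    intro e he e' he' hee
    apply edgeList_injective
    dsimp only
    rw [← hp e he, ← hp e' he', hee]
  have h1 : E.image node ⊆ Finset.range Z := by
    intro t ht
    obtain ⟨e, he, rfl⟩ := Finset.mem_image.1 ht
    exact Finset.mem_range.2 ((hN e he).trans_lt h.valid.rep.N_lt)
  unfold load
  rw [← Finset.sum_subset h1, Finset.sum_image hinj, Finset.sum_filter]
  · refine Finset.sum_congr rfl fun e he => ?_
    unfold share
    rw [hp e he]
    simp only [mem_map_edgeList]
  · intro t _ ht
    have h0 : levOf M t = 0 := by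
      by_contra hl
      have htN := h.valid.rep.lev_le t hl
      obtain ⟨e, he, hpe⟩ := (h.present t htN).1 hl
      refine ht (Finset.mem_image.2 ⟨e, he, ?_⟩)
      exact h.valid.rep.trie.inj _ (hN e he) _ htN (by rw [hp e he, hpe])
    simp [share, h0]

theorem Represents.approx (h : Represents Z w f N path M E D) {node : Finset (Fin n) → ℕ}
    (hN : ∀ e ∈ E, node e ≤ N) (hp : ∀ e ∈ E, path (node e) = (edgeList e).map Fin.val)
    (hf : 1 ≤ f) (hfw : 128 * (f * f) ≤ 2 ^ (w - 4)) :
    IsApproxMaxFractionalMatching (512 * (f : ℝ) ^ 3) E (fun e => (levOf M (node e) : ℝ)⁻¹ / 2) ∧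
    IsApproxMinVertexCover (512 * (f : ℝ) ^ 3) E
      (Finset.univ.filter fun v : Fin n => threshold w f ≤ wOf M v) := by
  have hQ0 : (0 : ℝ) < (2 ^ (w - 4) : ℕ) := by positivity
  have hf0 : (1 : ℝ) ≤ f := by exact_mod_cast hf
  have hd0 : 0 < 128 * (f * f) := by positivity
  have hsum := h.sum_share hN hp
  have hR := h.valid.rep
  have hload : ∀ v : Fin n, (wOf M v : ℝ) = (2 ^ (w - 4) : ℕ) * load Z path (levOf M) v :=
    fun v => (hR.loc v v.2).load
  have hpres : ∀ e ∈ E, levOf M (node e) ≠ 0 := fun e he => (h.present _ (hN e he)).2 ⟨e, he, hp e he⟩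
  have hθQ : threshold w f ≤ 2 ^ (w - 4) := Nat.div_le_self _ _
  -- Rounding down a quotient that is at least 1 loses less than a factor of 2, so 128 becomes 256.
  have hθ : (2 ^ (w - 4) : ℕ) ≤ 256 * (f : ℝ) ^ 2 * threshold w f := by
    have h1 := Nat.lt_div_mul_add hd0 (a := 2 ^ (w - 4))
    have h2 : 1 ≤ threshold w f := (Nat.one_le_div_iff hd0).2 hfw
    have h3 : 2 ^ (w - 4) ≤ 256 * f ^ 2 * threshold w f := by
      have h4 : 128 * (f * f) * 1 ≤ 128 * (f * f) * threshold w f := Nat.mul_le_mul_left _ h2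
      have h5 : 2 ^ (w - 4) < threshold w f * (128 * (f * f)) + 128 * (f * f) := h1
      nlinarith
    exact_mod_cast h3
  refine approx_of_card_le (by positivity) ⟨fun e _ => by positivity, fun v => ?_⟩ (fun e he => ?_) ?_
  · rw [← Finset.sum_div, ← hsum]
    have h1 : (wOf M v : ℝ) ≤ ((2 * 2 ^ (w - 4) : ℕ) : ℝ) := by exact_mod_cast (h.stable v v.2).1.le
    rw [hload, Nat.cast_mul, mul_comm] at h1
    have := le_of_mul_le_mul_right h1 hQ0
    push_cast at this
    linarith
  -- If the hyperedge is uncovered, its highest vertex is light and by stability has level 1. The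
  -- hyperedge then has weight 1, which contradicts a load below the threshold.
  · by_contra hno
    push Not at hno
    obtain ⟨v, hv, hpv⟩ := h.valid.supp _ (hpres e he)
    rw [hp e he] at hv
    obtain ⟨v, hv', rfl⟩ := List.mem_map.1 hv
    rw [mem_map_edgeList] at hv
    have h1 : wOf M v < threshold w f := by simpa using hno v hv
    have h2 := (h.stable v v.2).2 h1
    have h3 : (levOf M (node e) : ℝ)⁻¹ ≤ load Z path (levOf M) v :=
      share_le_load ((hN e he).trans_lt hR.N_lt) (by rw [hp e he]; exact mem_map_edgeList.2 hv)
    rw [← hpv, h2] at h3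
    have h4 : (wOf M v : ℝ) < (2 ^ (w - 4) : ℕ) := by exact_mod_cast h1.trans_le hθQ
    rw [hload] at h4
    norm_num at h3
    nlinarith
  · set S := Finset.univ.filter fun v : Fin n => threshold w f ≤ wOf M v
    have h1 : (S.card : ℝ) * threshold w f ≤ ∑ v : Fin n, (wOf M v : ℝ) := by
      rw [← nsmul_eq_mul, ← Finset.sum_const]
      refine (Finset.sum_le_sum fun v hv => ?_).trans
        (Finset.sum_le_sum_of_subset_of_nonneg (Finset.subset_univ S) fun v _ _ => by positivity)
      exact_mod_cast (Finset.mem_filter.1 hv).2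
    -- Double counting: a hyperedge contributes its weight to each of its at most `f` vertices.
    have h2 : ∑ v : Fin n, (wOf M v : ℝ) ≤
        (2 ^ (w - 4) : ℕ) * (f * ∑ e ∈ E, (levOf M (node e) : ℝ)⁻¹) := by
      simp only [hload]
      rw [← Finset.mul_sum]
      refine mul_le_mul_of_nonneg_left ?_ hQ0.le
      simp only [hsum, Finset.sum_filter]
      rw [Finset.sum_comm, Finset.mul_sum]
      refine Finset.sum_le_sum fun e he => ?_
      rw [← Finset.sum_filter, Finset.sum_const, nsmul_eq_mul]
      gcongr
      have h3 := (h.valid.edge _ (hpres e he)).2.1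
      rw [hp e he, List.length_map, length_edgeList] at h3
      simpa using h3
    rw [← Finset.sum_div]
    set s := ∑ e ∈ E, (levOf M (node e) : ℝ)⁻¹
    have h3 : (2 ^ (w - 4) : ℕ) * (S.card : ℝ) ≤ (2 ^ (w - 4) : ℕ) * (512 * (f : ℝ) ^ 3 * (s / 2)) := by
      calc (2 ^ (w - 4) : ℕ) * (S.card : ℝ) ≤ 256 * (f : ℝ) ^ 2 * threshold w f * S.card := by gcongr
        _ = 256 * (f : ℝ) ^ 2 * (S.card * threshold w f) := by ring
        _ ≤ 256 * (f : ℝ) ^ 2 * ((2 ^ (w - 4) : ℕ) * (f * s)) := by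
            exact mul_le_mul_of_nonneg_left (h1.trans h2) (by positivity)
        _ = _ := by ring
    exact le_of_mul_le_mul_left h3 hQ0

end

/-! ### Effect of one update on invariant and potential -/

section

variable {n Z w θ N N' f t r : ℕ} {path path' : ℕ → List ℕ} {M M' : Mem} {inp l : List ℕ}

/-- New nodes have level `0`, so they occur in no load and in no list of a nonzero level. -/
theorem Extended.valid (h : Extended n N N' path path' M M' l) (hV : Valid n Z w θ N f path M)
    (hN' : N' < Z) : Valid n Z w θ N' f path' M' := by
  have hR := hV.rep
  have hlev : levOf M' = levOf M := funext fun s => h.other 6 s 0 (by omega) (by omega)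
  have hpv : pvOf M' = pvOf M := funext fun s => by
    unfold pvOf
    rw [h.other 4 s 0 (by omega) (by omega)]
  have hw : wOf M' = wOf M := funext fun s => h.other 5 s 0 (by omega) (by omega)
  have hpos : posOf M' = posOf M := funext fun k => funext fun x => h.other 9 k x (by omega) (by omega)
  have hpath : ∀ s, levOf M s ≠ 0 → path' s = path s := fun s hs => h.path_eq s (hR.lev_le s hs)
  refine ⟨⟨h.trie, hR.wf.congr fun g a b hg hg' => h.other g a b (by omega) hg', ?_, ?_, ?_, ?_, ?_, ?_,
    hN'⟩, ?_, ?_, ?_, ?_⟩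
  · rw [hpos]; exact hR.items
  · rw [hpos]; exact hR.low
  · rw [hlev]; exact fun s hs => (hR.lev_le s hs).trans h.N_le
  · rw [hlev]; exact hR.level
  · rw [hpv]; exact hR.pv_level
  · intro v hv
    have hl := hR.loc v hv
    rw [hlev]
    refine ⟨?_, fun p s hp => ?_, by rw [hpos, hw]; exact hl.up, by rw [hpos, hw, hpv]; exact hl.down⟩
    · rw [hw, hl.load]
      unfold load
      rw [share_congr hpath]
    · rw [hpos, hl.list p s hp]
      constructor
      · rintro ⟨h1, rfl⟩
        exact ⟨by rwa [hpath s hp], rfl⟩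
      · rintro ⟨h1, rfl⟩
        exact ⟨by rwa [hpath s hp] at h1, rfl⟩
  · intro s hs
    rw [hlev] at hs
    rw [hpath s hs]
    exact hV.edge s hs
  · intro s hs
    rw [hlev] at hs ⊢
    rw [hpv, hpath s hs]
    exact hV.pv_le s hs
  · intro s hs
    rw [hlev] at hs ⊢
    rw [hpv, hpath s hs]
    exact hV.supp s hs
  · rw [hw]; exact hV.w_le

theorem Extended.memPotential_eq (h : Extended n N N' path path' M M' l)
    (hR : Rep n Z w θ N path M) : memPotential n Z f path' M' = memPotential n Z f path M := by
  have hlev : levOf M' = levOf M := funext fun s => h.other 6 s 0 (by omega) (by omega)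
  have hpv : pvOf M' = pvOf M := funext fun s => by
    unfold pvOf
    rw [h.other 4 s 0 (by omega) (by omega)]
  unfold memPotential
  rw [hlev, hpv]
  exact potential_congr fun s hs => h.path_eq s (hR.lev_le s hs)

theorem Moved.valid (hm : Moved n Z w θ N path M M' t r) (hV : Valid n Z w θ N f path M)
    (hW : ∀ v < n, wOf M v < 2 * 2 ^ (w - 4)) (ht : t < Z)
    (hr : r ≠ 0 → ((path t).Nodup ∧ (path t).length ≤ f ∧ t ≠ 0) ∧ (∀ v ∈ path t, pvOf M v ≤ r) ∧
      ∃ v ∈ path t, pvOf M v = r) : Valid n Z w θ N f path M' := by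
  have hQ0 : (0 : ℝ) < (2 ^ (w - 4) : ℕ) := by positivity
  refine ⟨hm.rep, fun s hs => ?_, fun s hs => ?_, fun s hs => ?_, fun v hv => ?_⟩
  · rw [hm.lev] at hs
    rcases eq_or_ne s t with rfl | hst
    · rw [Function.update_self] at hs
      exact (hr hs).1
    · rw [Function.update_of_ne hst] at hs
      exact hV.edge s hs
  · rw [hm.pv]
    rw [hm.lev] at hs ⊢
    rcases eq_or_ne s t with rfl | hst
    · rw [Function.update_self] at hs ⊢
      exact (hr hs).2.1
    · rw [Function.update_of_ne hst] at hs ⊢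
      exact hV.pv_le s hs
  · rw [hm.pv]
    rw [hm.lev] at hs ⊢
    rcases eq_or_ne s t with rfl | hst
    · rw [Function.update_self] at hs ⊢
      exact (hr hs).2.2
    · rw [Function.update_of_ne hst] at hs ⊢
      exact hV.supp s hs
  · have h1 : load Z path (levOf M') v ≤ load Z path (levOf M) v + 1 := by
      rw [hm.lev]
      by_cases hvt : v ∈ path t
      · rw [sum_share_update ht hvt]
        have h2 : (0 : ℝ) ≤ (levOf M t : ℝ)⁻¹ := by positivity
        have h3 : (r : ℝ)⁻¹ ≤ 1 := Nat.cast_inv_le_one r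
        linarith
      · rw [load_update_of_notMem hvt]
        linarith
    have h4 : (wOf M v : ℝ) ≤ ((2 * 2 ^ (w - 4) : ℕ) : ℝ) := by exact_mod_cast (hW v hv).le
    rw [(hV.rep.loc v hv).load, Nat.cast_mul, mul_comm] at h4
    have h5 := le_of_mul_le_mul_right h4 hQ0
    have h7 : (wOf M' v : ℝ) ≤ ((3 * 2 ^ (w - 4) : ℕ) : ℝ) := by
      rw [(hm.rep.loc v hv).load, Nat.cast_mul, mul_comm]
      push_cast at h5 ⊢
      gcongr
      linarith
    exact_mod_cast h7

/-- Deletion is the move to level `0`, a loss of weight: by validity the lost weight times the level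
of any of its vertices is at most 1. Insertion is the move from level `0`, a gain of weight, and
costs `2 * 64000 * f * f`. -/
theorem Moved.memPotential_le (hm : Moved n Z w θ N path M M' t r) (hV : Valid n Z w θ N f path M)
    (hf : 1 ≤ f) (ht : t < Z) (hlen : (path t).length ≤ f) (hr : r ≠ 0 → levOf M t = 0) :
    memPotential n Z f path M' ≤ memPotential n Z f path M + 128000 * f ^ 2 := by
  have hf0 : (1 : ℝ) ≤ f := by exact_mod_cast hf
  unfold memPotential
  rw [hm.lev, hm.pv]
  rcases eq_or_ne r 0 with rfl | hr0
  · refine (potential_raise (f := f) (by positivity) (by norm_num) ht hlen ?_ ?_).trans ?_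
    · simp
    · intro v hv
      rcases eq_or_ne (levOf M t) 0 with h0 | h0
      · simp [h0]
      · have h1 : (pvOf M v : ℝ) ≤ levOf M t := by exact_mod_cast hV.pv_le t h0 v hv
        rw [Nat.cast_zero, inv_zero, sub_zero, ← div_eq_mul_inv]
        exact div_le_one_of_le₀ h1 (by positivity)
    · nlinarith
  · refine (potential_lower (f := f) (by positivity) (by norm_num) ht hlen ?_).trans (by linarith)
    rw [hr hr0]
    simp

theorem changeLevel_spec (hE : Env n Z w) (hf : 1 ≤ f) {σ : State} (h2 : σ.v 2 = 2 ^ (w - 4))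
    (h3 : σ.v 3 = θ) (h24 : σ.v 24 = t) (h25 : σ.v 25 = r) (hV : Valid n Z w θ N f path σ.mem)
    (hθ : 128 * f ^ 2 * θ ≤ 2 ^ (w - 4)) (hW : ∀ v < n, wOf σ.mem v < 2 * 2 ^ (w - 4)) (htN : t ≤ N)
    (ht0 : t ≠ 0) (hnd : (path t).Nodup) (hlen : (path t).length ≤ f)
    (hr : r ≠ 0 → levOf σ.mem t = 0 ∧ (∀ v ∈ path t, pvOf σ.mem v ≤ r) ∧
      ∃ v ∈ path t, pvOf σ.mem v = r) :
    wp w inp (.seq moveEdge settle) (fun σ' => Valid n Z w θ N f path σ'.mem ∧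
      (∀ v < n, wOf σ'.mem v < 2 * 2 ^ (w - 4) ∧ (wOf σ'.mem v < θ → pvOf σ'.mem v = 1)) ∧
      (∀ s, levOf σ'.mem s ≠ 0 ↔ Function.update (levOf σ.mem) t r s ≠ 0) ∧
      ∃ k : ℕ, σ'.time ≤ σ.time + k ∧
        memPotential n Z f path σ'.mem + k ≤ memPotential n Z f path σ.mem + 131000 * f ^ 2) σ := by
  have htZ : t < Z := htN.trans_lt hV.rep.N_lt
  have hrl : IsLevel Z r := by
    rcases eq_or_ne r 0 with h | h
    · exact .inl h
    · obtain ⟨-, -, v, -, rfl⟩ := hr h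
      exact hV.rep.pv_level v
  refine wp_seq (wp.mono (moveEdge_spec hE h2 h3 h24 h25 hV.rep htN hnd hrl
    fun v hv => hV.w_le v (hV.rep.trie.lt t htN v hv)) ?_)
  rintro σ1 ⟨hm, vr, ht1⟩
  refine wp.mono (settle_spec hE hf (f := f) (θ := θ) (N := N) (path := path)
    (by rw [vr 2 (by omega), h2]) (by rw [vr 3 (by omega), h3])
    (hm.valid hV hW htZ fun h => ⟨⟨hnd, hlen, ht0⟩, (hr h).2⟩) hθ) ?_
  rintro σ2 ⟨hV2, hst, hlev, -, k, htk, hphi⟩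
  have h1 := hm.memPotential_le hV hf htZ hlen (fun h => (hr h).1)
  refine ⟨hV2, hst, fun s => by rw [hlev, hm.lev], 2200 * f + k, by omega, ?_⟩
  have hf0 : (1 : ℝ) ≤ f := by exact_mod_cast hf
  push_cast
  nlinarith

end

section

variable {n Z w f N N' t r : ℕ} {path path' : ℕ → List ℕ} {M M' : Mem}
  {E D : Finset (Finset (Fin n))} {e : Finset (Fin n)}

/-- All hyperedges of `E` have been seen and have nodes already, so new nodes rightly count as
absent. A hyperedge seen for the first time adds at most `f` nodes; since nodes are never freed, `D`
collects all hyperedges seen. -/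
theorem Represents.extend (h : Represents Z w f N path M E D)
    (hX : Extended n N N' path path' M M' ((edgeList e).map Fin.val)) (he : e.card ≤ f)
    (hN' : N' ≤ N + ((edgeList e).map Fin.val).length) (hN'Z : N' < Z) (htN : t ≤ N')
    (ht : path' t = (edgeList e).map Fin.val) : Represents Z w f N' path' M' E (insert e D) := by
  have hlev : levOf M' = levOf M := funext fun s => hX.other 6 s 0 (by omega) (by omega)
  have hpv : pvOf M' = pvOf M := funext fun s => by
    unfold pvOf
    rw [hX.other 4 s 0 (by omega) (by omega)]
  have hw : wOf M' = wOf M := funext fun s => hX.other 5 s 0 (by omega) (by omega)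
  refine ⟨hX.valid h.valid hN'Z, by rw [hw, hpv]; exact h.stable, fun s hs => ?_, fun e' he' => ?_,
    h.sub.trans (Finset.subset_insert _ _), ?_⟩
  · rw [hlev]
    by_cases hsN : s ≤ N
    · rw [hX.path_eq s hsN]
      exact h.present s hsN
    · have h0 : levOf M s = 0 := by
        by_contra h0
        exact hsN (h.valid.rep.lev_le s h0)
      refine iff_of_false (fun h1 => h1 h0) ?_
      rintro ⟨e', he', hp⟩
      obtain ⟨s', hs', hp'⟩ := h.node e' (h.sub he')
      have := hX.trie.inj s hs s' (hs'.trans hX.N_le) (by rw [hp, hX.path_eq s' hs', hp'])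
      omega
  · rcases Finset.mem_insert.1 he' with rfl | he'
    · exact ⟨t, htN, ht⟩
    · obtain ⟨s', hs', hp'⟩ := h.node e' he'
      exact ⟨s', hs'.trans hX.N_le, by rw [hX.path_eq s' hs', hp']⟩
  · by_cases heD : e ∈ D
    · rw [(hX.same (h.node e heD)).1, Finset.insert_eq_of_mem heD]
      exact h.N_le
    · rw [Finset.card_insert_of_notMem heD, Nat.mul_succ]
      rw [List.length_map, length_edgeList] at hN'
      have := h.N_le
      omega

theorem Represents.changed (h : Represents Z w f N path M E D) {E' : Finset (Finset (Fin n))}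
    (hV : Valid n Z w (threshold w f) N f path M')
    (hst : ∀ v < n, wOf M' v < 2 * 2 ^ (w - 4) ∧ (wOf M' v < threshold w f → pvOf M' v = 1))
    (hlev : ∀ s, levOf M' s ≠ 0 ↔ Function.update (levOf M) t r s ≠ 0) (htN : t ≤ N)
    (ht : path t = (edgeList e).map Fin.val) (hr : r ≠ 0 ↔ e ∈ E') (hE' : E' ⊆ D)
    (hne : ∀ e' ≠ e, e' ∈ E' ↔ e' ∈ E) : Represents Z w f N path M' E' D := by
  refine ⟨hV, hst, fun s hs => ?_, h.node, hE', h.N_le⟩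
  rw [hlev]
  rcases eq_or_ne s t with rfl | hst
  · rw [Function.update_self, hr, ht]
    constructor
    · exact fun h => ⟨e, h, rfl⟩
    · rintro ⟨e', he', h1⟩
      rwa [edgeList_injective h1]
  · rw [Function.update_of_ne hst, h.present s hs]
    have : ∀ e', path s = (edgeList e').map Fin.val → e' ≠ e := by
      rintro e' he' rfl
      exact hst (h.valid.rep.trie.inj s hs t htN (by rw [he', ht]))
    constructor
    · rintro ⟨e', h1, h2⟩
      exact ⟨e', (hne e' (this e' h2)).2 h1, h2⟩
    · rintro ⟨e', h1, h2⟩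
      exact ⟨e', (hne e' (this e' h2)).1 h1, h2⟩

theorem Represents.lev_eq_zero (h : Represents Z w f N path M E D) (he : e ∉ E) (htN : t ≤ N)
    (ht : path t = (edgeList e).map Fin.val) : levOf M t = 0 := by
  by_contra h0
  obtain ⟨e', he', h1⟩ := (h.present t htN).1 h0
  rw [ht] at h1
  exact he (edgeList_injective h1 ▸ he')

end

section

variable {n : ℕ}

/-- The encodings are chosen for this: vertex levels are stored minus 1, level `0` means absent,
positions count from 1, and `0` is both the root and the mark of a missing child. -/
theorem represents_zero {Z w f : ℕ} (hZ : 0 < Z) :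
    Represents Z w f 0 (fun _ => []) (fun _ => 0) (∅ : Finset (Finset (Fin n))) ∅ := by
  have hQ0 : 0 < 2 ^ (w - 4) := by positivity
  have hl : levOf (fun _ => 0) = fun _ => 0 := rfl
  refine ⟨⟨⟨⟨rfl, ?_, ?_, ?_, ?_, ?_, ?_, rfl, ?_⟩, ⟨?_, ?_, ?_⟩, ?_, ?_, ?_, ?_, ?_, ?_, hZ⟩,
    ?_, ?_, ?_, ?_⟩, ?_, ?_, ?_, ?_, ?_⟩
  all_goals try (intros; simp_all [posOf, cntOf, levOf, wOf, pvOf]; done)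
  · intro v
    exact .inl rfl
  · intro v
    exact .inr ⟨⟨0, rfl⟩, hZ⟩
  · intro v hv
    refine ⟨?_, ?_, ?_, ?_⟩
    · simp [wOf, load, share]
    all_goals simp [posOf, wOf, pvOf, levOf]

theorem memPotential_zero {Z f : ℕ} : memPotential n Z f (fun _ => []) (fun _ => 0) = 0 := by
  unfold memPotential potential
  refine Finset.sum_eq_zero fun v _ => ?_
  have h : share (fun _ => []) (levOf fun _ => 0) v = fun _ => 0 := by
    funext t
    simp [share]
  rw [localPotential, h, excess_eq_zero (by simp)]
  simp [pvOf]

end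

/-! ### The program -/

/-- Compute the unit of weights into variable `2` and the threshold into variable `3`. -/
def readParams : Stmt :=
  .seq (.assign 2 (.op .div (.op .add (.op .div .top (.const 2)) (.const 1)) (.const 8)))
    (.assign 3 (.op .div (.var 2)
      (.op .mul (.const 128) (.op .mul (.inp (.const 2)) (.inp (.const 2))))))

/-- Requests of kind `0` and `1`. -/
def handleUpdate : Stmt :=
  .seq findEdge <|
  .seq (.assign 14 (.var 4)) <|
  .seq (.ite (.inp (.const 0)) (.const 1) maxLevel (.assign 21 (.const 0))) <|
  .seq (.assign 24 (.var 14)) <|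
  .seq (.assign 25 (.var 21)) <|
  .seq moveEdge settle

/-- Requests of kind `2`. -/
def answerCover : Stmt :=
  .seq (.assign 4 (.inp (.const 4))) <|
  .ite (.cell 5 (.var 4) (.const 0)) (.var 3) (.assign 0 (.const 0)) (.assign 0 (.const 1))

/-- Requests of kind `3`. -/
def answerWeight : Stmt :=
  .seq findEdge <|
  .seq (.assign 0 (.op .div (.var 2) (.cell 6 (.var 4) (.const 0)))) <|
  .assign 1 (.op .mul (.const 2) (.var 2))

/-- The whole program. -/
def mainStmt : Stmt :=
  .seq readParams <|
  .ite (.inp (.const 0)) (.const 2) handleUpdate <|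
  .ite (.inp (.const 0)) (.const 3) answerCover answerWeight

section

variable {n Z w f N kind : ℕ} {path : ℕ → List ℕ} {M : Mem} {E D : Finset (Finset (Fin n))}
  {e : Finset (Fin n)} {l : List (Fin n)}

/-- The word length is large enough. -/
structure Suits (n f Z w : ℕ) : Prop where
  env : Env n Z w
  pos : 1 ≤ f
  f_le : 128 * (f * f) ≤ 2 ^ (w - 4)
  len : f < Z

theorem mul_threshold_le (w f : ℕ) : 128 * f ^ 2 * threshold w f ≤ 2 ^ (w - 4) := by
  have := Nat.mul_div_le (2 ^ (w - 4)) (128 * (f * f))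
  rw [← sq] at this
  unfold threshold
  rwa [← sq]

theorem readParams_spec (hS : Suits n f Z w) {σ : State} :
    wp w (request kind n f l) readParams (fun σ' => σ'.mem = σ.mem ∧ σ'.v 2 = 2 ^ (w - 4) ∧
      σ'.v 3 = threshold w f ∧ σ'.time ≤ σ.time + 40) σ := by
  have hE := hS.env
  have hw := hE.w_ge
  have hw0 : w ≠ 0 := by omega
  have hpw := hE.pow_eq
  have hf := hS.f_le
  have h128 : 128 < 2 ^ w := hE.fits.lt (by omega)
  have hff : f ≤ f * f := Nat.le_mul_self f
  have hfw : f < 2 ^ w := by omega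
  have i2 : (request kind n f l).getD 2 0 = f := rfl
  -- The number `2 ^ w` is not a word; half of the greatest word, plus 1, is `2 ^ (w - 1)`.
  have e1 : ((2 ^ w - 1) / 2 + 1) / 8 = 2 ^ (w - 4) := by omega
  refine wp_seq (wp_assign (by simp) ?_ ?_)
  · simp only [Expr.ok, Expr.eval, Op.safe, Op.nat, true_and, and_true]
    omega
  refine wp_assign (by simp) ?_ ⟨rfl, ?_, ?_, ?_⟩
  · simp only [Expr.ok, Expr.eval, Op.safe, Op.nat, i2, and_true]
    refine ⟨by norm_num, h128, ⟨⟨by omega, hfw⟩, ⟨by omega, hfw⟩, by omega⟩, by omega⟩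
  · simp [e1]
  · simp only [State.set, Function.update_self, Expr.eval, Op.nat, i2, e1]
    rfl
  · simp

theorem mainStmt_update (hS : Suits n f Z w) (h : Represents Z w f N path M E D)
    {E' : Finset (Finset (Fin n))}
    (he : e.Nonempty) (hef : e.card ≤ f) (hD : f * (insert e D).card < Z)
    (hk : (kind = 0 ∧ e ∉ E ∧ E' = insert e E) ∨ (kind = 1 ∧ e ∈ E ∧ E' = E.erase e)) :
    wp w (request kind n f (edgeList e)) mainStmt (fun σ' => ∃ N' path',
      Represents Z w f N' path' σ'.mem E' (insert e D) ∧ ∃ k : ℕ, σ'.time ≤ k ∧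
        memPotential n Z f path' σ'.mem + k ≤ memPotential n Z f path M + 132000 * f ^ 2)
      ⟨fun _ => 0, M, 0⟩ := by
  have hE := hS.env
  have hw := hE.w_ge
  have hw0 : w ≠ 0 := by omega
  have h128 : 128 < 2 ^ w := hE.fits.lt (by omega)
  have i0 : (request kind n f (edgeList e)).getD 0 0 = kind := rfl
  have hkind : kind < 2 := by omega
  have hllen : ((edgeList e).map Fin.val).length = e.card := by rw [List.length_map, length_edgeList]
  refine wp_seq (wp.mono (readParams_spec hS) ?_)
  rintro σ1 ⟨m1, v2, v3, t1⟩
  dsimp only at m1 t1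
  refine wp_ite (by simp only [Expr.ok, Expr.eval, i0]; omega) (by simp only [Expr.ok]; omega)
    (fun _ => ?_) (fun hc => by simp only [Expr.eval, i0] at hc; omega)
  refine wp_seq (wp.mono (findEdge_spec (n := n) (N := N) (path := path) hE (k0 := kind) (k1 := n) (k2 := f)
    (l := (edgeList e).map Fin.val) (by simp [request]) ?_ (by simpa [m1] using h.valid.rep.trie)
    h.valid.rep.N_lt (by have := hS.len; omega) ?_) ?_)
  · intro v hv
    obtain ⟨u, -, rfl⟩ := List.mem_map.1 hv
    exact u.2
  · intro hno
    have heD : e ∉ D := fun h1 => hno (h.node e h1)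
    rw [Finset.card_insert_of_notMem heD, Nat.mul_succ] at hD
    have := h.N_le
    omega
  rintro σ2 ⟨⟨N', path', hX, hN', hN'Z, htN, hpt⟩, r2, t2⟩
  simp only [State.tick, m1] at hX
  have h' := h.extend hX hef hN' hN'Z htN hpt
  have hphi := hX.memPotential_eq (f := f) h.valid.rep
  have tt2 : σ2.time ≤ 500 * f := by
    rw [hllen] at t2
    simp only [State.tick, Expr.cost] at t2
    have := hS.pos
    omega
  have ht0 : σ2.v 4 ≠ 0 := by
    intro h0
    rw [h0, hX.trie.root] at hpt
    rw [← hpt, List.length_nil] at hllen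
    have := he.card_pos
    omega
  have x2 : σ2.v 2 = 2 ^ (w - 4) := by simp [r2, v2]
  have x3 : σ2.v 3 = threshold w f := by simp [r2, v3]
  set t := σ2.v 4 with htdef
  refine wp_seq (wp_assign (by simp) (by simp) ?_)
  refine wp_seq (wp.mono (Q := fun σ' => σ'.mem = σ2.mem ∧ σ'.v 14 = t ∧ σ'.v 2 = 2 ^ (w - 4) ∧
    σ'.v 3 = threshold w f ∧ σ'.time ≤ 800 * f ∧ (σ'.v 21 ≠ 0 → levOf σ2.mem t = 0 ∧
      (∀ v ∈ path' t, pvOf σ2.mem v ≤ σ'.v 21) ∧ ∃ v ∈ path' t, pvOf σ2.mem v = σ'.v 21) ∧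
      (σ'.v 21 ≠ 0 ↔ e ∈ E')) ?_ ?_)
  · refine wp_ite (by simp only [Expr.ok, Expr.eval, i0]; omega) (by simp only [Expr.ok]; omega)
      (fun hc => ?_) (fun hc => ?_)
    · have hk0 : kind = 0 := by
        simp only [Expr.eval, i0] at hc
        omega
      obtain ⟨-, heE, rfl⟩ := hk.resolve_right (by omega)
      refine wp.mono (maxLevel_spec hE (t := t) (θ := threshold w f) (N := N') (path := path') (n := n)
        (Z := Z) (by simp [htdef]) (by simpa using h'.valid.rep) htN ht0) ?_
      rintro σ3 ⟨m3, a1, a2, r3, t3⟩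
      simp only [State.set, State.tick] at m3 a1 a2
      refine ⟨m3, by simp [r3, htdef], by simp [r3, x2], by simp [r3, x3], ?_,
        fun _ => ⟨h'.lev_eq_zero heE htN hpt, a1, a2⟩, iff_of_true ?_ (Finset.mem_insert_self _ _)⟩
      · rw [hpt, hllen] at t3
        simp at t3
        have := hS.pos
        omega
      · obtain ⟨v, -, hv⟩ := a2
        rw [← hv]
        exact (pvOf_pos _ _).ne'
    · have hk0 : kind = 1 := by
        simp only [Expr.eval, i0] at hc
        omega
      obtain ⟨-, heE, rfl⟩ := hk.resolve_left (by omega)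
      refine wp_assign (by simp) (by simp) ⟨rfl, by simp [htdef], by simp [x2], by simp [x3], ?_,
        by simp, by simp⟩
      simp
      have := hS.pos
      omega
  rintro σ3 ⟨m3, y14, y2, y3, t3, hr, hrE⟩
  refine wp_seq (wp_assign (by simp) (by simp) ?_)
  refine wp_seq (wp_assign (by simp) (by simp) ?_)
  refine wp.mono (changeLevel_spec hE hS.pos (f := f) (θ := threshold w f) (N := N') (path := path')
    (t := t) (r := σ3.v 21) (by simp [y2]) (by simp [y3]) (by simp [y14]) (by simp)
    (by simpa [m3] using h'.valid) (mul_threshold_le w f) (by simpa [m3] using fun v hv => (h'.stable v hv).1)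
    htN ht0 (hpt ▸ nodup_map_edgeList e) (by rw [hpt, hllen]; exact hef) (by simpa [m3] using hr)) ?_
  rintro σ4 ⟨hV, hst, hlev, k, htk, hphi4⟩
  simp only [State.set, m3] at hlev hphi4
  refine ⟨N', path', h'.changed hV hst hlev htN hpt hrE ?_ ?_, 1000 * f + k, ?_, ?_⟩
  · rcases hk with ⟨-, -, rfl⟩ | ⟨-, -, rfl⟩
    · exact Finset.insert_subset_insert _ h.sub
    · exact (Finset.erase_subset _ _).trans h'.sub
  · intro e' hne
    rcases hk with ⟨-, -, rfl⟩ | ⟨-, -, rfl⟩ <;> simp [hne]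
  · simp at htk
    have := hS.pos
    omega
  · have hf0 : (1 : ℝ) ≤ f := by exact_mod_cast hS.pos
    rw [hphi] at hphi4
    push_cast
    nlinarith

theorem mainStmt_cover (hS : Suits n f Z w) (v : Fin n) :
    wp w (coverQuery f v) mainStmt (fun σ' => σ'.mem = M ∧ σ'.time ≤ 200 ∧
      (σ'.v 0 ≠ 0 ↔ threshold w f ≤ wOf M v)) ⟨fun _ => 0, M, 0⟩ := by
  have hE := hS.env
  have h128 : 128 < 2 ^ w := hE.fits.lt (by omega)
  have i0 : (coverQuery f v).getD 0 0 = 2 := rfl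
  have i4 : (coverQuery f v).getD 4 0 = v := rfl
  have hvZ : (v : ℕ) ≤ Z := v.2.le.trans hE.n_le
  have hvw := hE.lt hvZ
  have l0 := hE.loc (g := 5) hvZ (b := 0) (by omega)
  refine wp_seq (wp.mono (readParams_spec hS) ?_)
  rintro σ1 ⟨m1, v2, v3, t1⟩
  dsimp only at m1 t1
  refine wp_ite (by simp only [Expr.ok, Expr.eval, i0]; omega) (by simp only [Expr.ok]; omega)
    (fun hc => by simp only [Expr.eval, i0] at hc; omega) (fun _ => ?_)
  refine wp_ite (by simp only [Expr.ok, Expr.eval, i0]; omega) (by simp only [Expr.ok]; omega)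
    (fun _ => ?_) (fun hc => by simp only [Expr.eval, i0] at hc; omega)
  refine wp_seq (wp_assign (by simp) (by simp only [Expr.ok, Expr.eval, i4]; omega) ?_)
  set σ2 := State.set _ 4 _ _ with hσ2
  have m2 : σ2.mem = M := m1
  have w4 : σ2.v 4 = v := i4
  have w3 : σ2.v 3 = threshold w f := by simp [hσ2, v3]
  have t2 : σ2.time ≤ 100 := by
    simp [hσ2]
    omega
  clear_value σ2
  refine wp_ite (by simpa [w4] using l0) (by simp) (fun hc => ?_) (fun hc => ?_)
  · refine wp_assign (by simp) (by simp) ⟨m2, ?_, ?_⟩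
    · simp
      omega
    · have : wOf M v < threshold w f := by simpa [w4, w3, m2, wOf] using hc
      simpa using this
  · refine wp_assign (by simp) (by simp only [Expr.ok]; omega) ⟨m2, ?_, ?_⟩
    · simp
      omega
    · have : threshold w f ≤ wOf M v := by simpa [w4, w3, m2, wOf] using hc
      simpa using this

theorem mainStmt_weight (hS : Suits n f Z w) (h : Represents Z w f N path M E D) (he : e ∈ E)
    {t : ℕ} (htN : t ≤ N) (hp : path t = (edgeList e).map Fin.val) :
    wp w (weightQuery f e) mainStmt (fun σ' => σ'.mem = M ∧ σ'.time ≤ 1000 * f ∧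
      σ'.v 0 = 2 ^ (w - 4) / levOf M t ∧ σ'.v 1 = 2 * 2 ^ (w - 4)) ⟨fun _ => 0, M, 0⟩ := by
  have hE := hS.env
  have hw := hE.w_ge
  have hpw := hE.pow_eq
  have h128 : 128 < 2 ^ w := hE.fits.lt (by omega)
  have i0 : (weightQuery f e).getD 0 0 = 3 := rfl
  have hef : e.card ≤ f := by
    have := (h.valid.edge t ((h.present t htN).2 ⟨e, he, hp⟩)).2.1
    rwa [hp, List.length_map, length_edgeList] at this
  have hllen : ((edgeList e).map Fin.val).length = e.card := by rw [List.length_map, length_edgeList]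
  have l6 := hE.loc (g := 6) (show t ≤ Z by have := h.valid.rep.N_lt; omega) (b := 0) (by omega)
  refine wp_seq (wp.mono (readParams_spec hS) ?_)
  rintro σ1 ⟨m1, v2, v3, t1⟩
  dsimp only at m1 t1
  refine wp_ite (by simp only [Expr.ok, Expr.eval, i0]; omega) (by simp only [Expr.ok]; omega)
    (fun hc => by simp only [Expr.eval, i0] at hc; omega) (fun _ => ?_)
  refine wp_ite (by simp only [Expr.ok, Expr.eval, i0]; omega) (by simp only [Expr.ok]; omega)
    (fun hc => by simp only [Expr.eval, i0] at hc; omega) (fun _ => ?_)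
  refine wp_seq (wp.mono (findEdge_spec (n := n) (N := N) (path := path) hE (k0 := 3) (k1 := n) (k2 := f)
    (l := (edgeList e).map Fin.val) (by simp [weightQuery, request]) ?_
    (by simpa [m1] using h.valid.rep.trie) h.valid.rep.N_lt (by have := hS.len; omega)
    (fun hno => absurd ⟨t, htN, hp⟩ hno)) ?_)
  · intro v hv
    obtain ⟨u, -, rfl⟩ := List.mem_map.1 hv
    exact u.2
  rintro σ2 ⟨⟨N', path', hX, hN', hN'Z, htN', hpt⟩, r2, t2⟩
  obtain ⟨rfl, rfl, m2⟩ := hX.same ⟨t, htN, hp⟩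
  simp only [State.tick, m1] at m2
  have hv4 : σ2.v 4 = t := h.valid.rep.trie.inj _ htN' _ htN (by rw [hpt, hp])
  have x2 : σ2.v 2 = 2 ^ (w - 4) := by simp [r2, v2]
  have tt2 : σ2.time ≤ 500 * f := by
    rw [hllen] at t2
    simp only [State.tick, Expr.cost] at t2
    have := hS.pos
    omega
  refine wp_seq (wp_assign (by simp) (by simpa [hv4] using l6) ?_)
  refine wp_assign (by simp) ?_ ⟨m2, ?_, ?_, ?_⟩
  · simp only [Expr.ok, Expr.eval, Op.safe, Op.nat, State.set]
    rw [Function.update_of_ne (by norm_num), x2]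
    omega
  · simp
    have := hS.pos
    omega
  · simp [x2, hv4, m2, levOf]
  · simp [x2]

/-- The program. -/
def program : Program := mainStmt.code 0

theorem Suits.lt (hS : Suits n f Z w) : 16 < 2 ^ w := hS.env.fits.lt (by omega)

theorem Evolves.card_le {us : List (Update n)} (h : Evolves f us E) : ∀ e ∈ E, e.Nonempty ∧ e.card ≤ f := by
  induction h with
  | nil => simp
  | insert _ h1 h2 _ ih =>
    intro e he
    rcases Finset.mem_insert.1 he with rfl | he
    · exact ⟨h1, h2⟩
    · exact ih e he
  | delete _ _ ih => exact fun e he => ih e (Finset.mem_of_mem_erase he)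

theorem edgesOccurring_append (us : List (Update n)) (u : Update n) :
    edgesOccurring (us ++ [u]) = insert u.edge (edgesOccurring us) := by
  ext e
  simp [edgesOccurring]

/-- The amortized costs telescope: the potential starts at 0, and every update increases time plus
potential by at most `132000 * f ^ 2`. -/
theorem exists_processes (hS : Suits n f Z w) {us : List (Update n)} (h : Evolves f us E)
    (hZ : f * (edgesOccurring us).card < Z) :
    ∃ M t N path, Processes w program f us M t ∧ Represents Z w f N path M E (edgesOccurring us) ∧
      (t : ℝ) + memPotential n Z f path M ≤ 132000 * f ^ 2 * us.length := by
  have hup : ∀ {us : List (Update n)} {E E' : Finset (Finset (Fin n))} {u : Update n} {kind : ℕ},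
      u.request f = request kind n f (edgeList u.edge) → u.edge.Nonempty → u.edge.card ≤ f →
      ((kind = 0 ∧ u.edge ∉ E ∧ E' = insert u.edge E) ∨
        (kind = 1 ∧ u.edge ∈ E ∧ E' = E.erase u.edge)) →
      f * (edgesOccurring (us ++ [u])).card < Z →
      (f * (edgesOccurring us).card < Z → ∃ M t N path, Processes w program f us M t ∧
        Represents Z w f N path M E (edgesOccurring us) ∧
        (t : ℝ) + memPotential n Z f path M ≤ 132000 * f ^ 2 * us.length) →
      ∃ M t N path, Processes w program f (us ++ [u]) M t ∧
        Represents Z w f N path M E' (edgesOccurring (us ++ [u])) ∧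
        (t : ℝ) + memPotential n Z f path M ≤ 132000 * f ^ 2 * (us ++ [u]).length := by
    intro us E E' u kind hreq he hef hk hZ' ih
    rw [edgesOccurring_append] at hZ' ⊢
    obtain ⟨M, t, N, path, hP, hR, ht⟩ := ih (lt_of_le_of_lt
      (Nat.mul_le_mul_left _ (Finset.card_le_card (Finset.subset_insert _ _))) hZ')
    obtain ⟨σ', hex, N', path', hR', k, htk, hphi⟩ := mainStmt_update hS hR he hef hZ' hk
    obtain ⟨s, c, hrun, hs, hm, -⟩ := hex.runs hS.lt
    refine ⟨c.mem, t + s, N', path', hP.snoc (hreq ▸ hrun), hm ▸ hR', ?_⟩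
    have h1 : (s : ℝ) ≤ k := by exact_mod_cast hs.trans htk
    rw [hm, List.length_append, List.length_singleton]
    push_cast
    linarith
  induction h with
  | nil =>
    have hZ0 : 0 < Z := Nat.zero_lt_of_lt hS.len
    exact ⟨_, _, _, _, .nil, represents_zero hZ0, by simp [memPotential_zero]⟩
  | insert _ h1 h2 h3 ih =>
    exact hup (kind := 0) rfl h1 h2 (.inl ⟨rfl, h3, rfl⟩) hZ ih
  | delete h0 h1 ih =>
    exact hup (kind := 1) rfl (h0.card_le _ h1).1 (h0.card_le _ h1).2 (.inr ⟨rfl, h1, rfl⟩) hZ ih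

/-- With `X = n + f + m + 1`, the bound `Z = X ^ 2` exceeds the at most `f * m` nodes beyond the
root. Keys are quadratic in `Z` and addresses quadratic in keys; absorbing constants as powers of `X
≥ 2`, everything stays below `X ^ 40`. -/
theorem Suits.of_pow {m C : ℕ} (hf : 1 ≤ f) (hC : 40 ≤ C) (h : (n + f + m + 1) ^ C ≤ 2 ^ w) :
    Suits n f ((n + f + m + 1) ^ 2) w ∧ f * m < (n + f + m + 1) ^ 2 := by
  obtain ⟨X, hX⟩ : ∃ X, X = n + f + m + 1 := ⟨_, rfl⟩
  rw [← hX] at h ⊢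
  have hX2 : 2 ≤ X := by omega
  have hX40 : X ^ 40 ≤ 2 ^ w := (Nat.pow_le_pow_right (by omega) hC).trans h
  have hp : ∀ i, 2 ^ i ≤ X ^ i := fun i => Nat.pow_le_pow_left hX2 i
  have h1 : 1 ≤ X ^ 4 := Nat.one_le_pow _ _ (by omega)
  have hY : 8 * (X ^ 2) ^ 2 + 1000 ≤ X ^ 14 := by
    calc 8 * (X ^ 2) ^ 2 + 1000 = 8 * X ^ 4 + 1000 := by ring
      _ ≤ 2 ^ 10 * X ^ 4 := by nlinarith
      _ ≤ X ^ 10 * X ^ 4 := Nat.mul_le_mul_right _ (hp 10)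
      _ = X ^ 14 := by ring
  have hw10 : 10 ≤ w := by
    have h3 : 2 ^ 10 ≤ 2 ^ w :=
      ((hp 10).trans (Nat.pow_le_pow_right (by omega) (by norm_num))).trans hX40
    exact (Nat.pow_le_pow_iff_right (by norm_num)).1 h3
  refine ⟨⟨⟨?_, ⟨?_⟩⟩, hf, ?_, ?_⟩, ?_⟩
  · nlinarith
  · set Y := 8 * (X ^ 2) ^ 2 + 1000
    have hY1 : 1000 ≤ Y := by omega
    calc 64 * Y ^ 2 + 16 * Y + 16 ≤ 2 ^ 7 * Y ^ 2 := by nlinarith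
      _ ≤ X ^ 7 * (X ^ 14) ^ 2 := Nat.mul_le_mul (hp 7) (Nat.pow_le_pow_left hY 2)
      _ = X ^ 35 := by ring
      _ ≤ X ^ 40 := Nat.pow_le_pow_right (by omega) (by norm_num)
      _ ≤ 2 ^ w := hX40
  · have h2 : 2 ^ w = 16 * 2 ^ (w - 4) := by
      rw [show (16 : ℕ) = 2 ^ 4 by norm_num, ← pow_add]
      congr 1
      omega
    have h3 : 16 * (128 * (f * f)) ≤ 2 ^ w := by
      calc 16 * (128 * (f * f)) = 2 ^ 11 * (f * f) := by ring
        _ ≤ X ^ 11 * (X * X) := Nat.mul_le_mul (hp 11) (Nat.mul_le_mul (by omega) (by omega))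
        _ = X ^ 13 := by ring
        _ ≤ X ^ 40 := Nat.pow_le_pow_right (by omega) (by norm_num)
        _ ≤ 2 ^ w := hX40
    omega
  · nlinarith
  · nlinarith

end

end DynHypergraph

theorem theorem1 :
    ∃ (P : DynHypergraph.Program) (C : ℕ), ∀ (n f w : ℕ), 1 ≤ f →
      ∀ (us : List (DynHypergraph.Update n)) (E : Finset (Finset (Fin n))),
        DynHypergraph.Evolves f us E →
        (n + f + (DynHypergraph.edgesOccurring us).card + 1) ^ C ≤ 2 ^ w →
        ∃ (M : DynHypergraph.Mem) (t : ℕ),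
          DynHypergraph.Processes w P f us M t ∧
          t ≤ C * f ^ 2 * us.length ∧
          (∃ x : Finset (Fin n) → ℝ,
            DynHypergraph.RepresentsWeights w P f (C * f) M E x ∧
            DynHypergraph.IsApproxMaxFractionalMatching ((C : ℝ) * (f : ℝ) ^ 3) E x) ∧
          (∃ S : Finset (Fin n),
            DynHypergraph.RepresentsCover w P f C M S ∧
            DynHypergraph.IsApproxMinVertexCover ((C : ℝ) * (f : ℝ) ^ 3) E S) := by
  -- The amortized cost dictates the constant; it exceeds the 512 of the approximation, the time
  -- constants of the queries and the exponent 40.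
  refine ⟨DynHypergraph.program, 132000, fun n f w hf us E hev hw => ?_⟩
  obtain ⟨hS, hZ⟩ := DynHypergraph.Suits.of_pow hf (by norm_num) hw
  obtain ⟨M, t, N, path, hP, hR, ht⟩ := DynHypergraph.exists_processes hS hev hZ
  have hnode : ∀ e ∈ E, ∃ s ≤ N, path s = (DynHypergraph.edgeList e).map Fin.val :=
    fun e he => hR.node e (hR.sub he)
  choose! node hN hp using hnode
  obtain ⟨h1, h2⟩ := hR.approx hN hp hf hS.f_le
  have hc : 512 * (f : ℝ) ^ 3 ≤ ((132000 : ℕ) : ℝ) * (f : ℝ) ^ 3 := by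
    push_cast
    gcongr
    norm_num
  refine ⟨M, t, hP, ?_, ⟨_, fun e he => ?_, h1.1, fun y hy => (h1.2 y hy).trans ?_⟩,
    ⟨_, fun v => ?_, h2.1, fun S' hS' => (h2.2 S' hS').trans ?_⟩⟩
  · have := DynHypergraph.memPotential_nonneg (n := n)
      (Z := (n + f + (DynHypergraph.edgesOccurring us).card + 1) ^ 2) (f := f) (path := path) (M := M)
    have h3 : (t : ℝ) ≤ 132000 * f ^ 2 * us.length := by linarith
    exact_mod_cast h3
  · obtain ⟨σ', hex, hm, htime, e0, e1⟩ := DynHypergraph.mainStmt_weight hS hR he (hN e he) (hp e he)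
    obtain ⟨s, c, hrun, hs, hm', hc0, hc1⟩ := hex.runs hS.lt
    refine ⟨s, c, hrun, hs.trans (htime.trans (by omega)), hm'.trans hm, ?_, ?_⟩
    · rw [hc1, e1]
      positivity
    -- The answer is the stored weight over twice the unit; the division by the level is exact, so
    -- the fraction is half the weight of the hyperedge.
    · have hZQ := hS.env.Z_lt
      rw [hc0, hc1, e0, e1, (hR.valid.rep.level _).cast_div (by omega), Nat.cast_mul]
      have : (0 : ℝ) < (2 ^ (w - 4) : ℕ) := by positivity
      field_simp
      norm_num
  · exact mul_le_mul_of_nonneg_right hc (Finset.sum_nonneg fun e he => h1.1.1 e he)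
  · obtain ⟨σ', hex, hm, htime, e0⟩ := DynHypergraph.mainStmt_cover (M := M) hS v
    obtain ⟨s, c, hrun, hs, hm', hc0, -⟩ := hex.runs hS.lt
    refine ⟨s, c, hrun, hs.trans (htime.trans (by norm_num)), hm'.trans hm, ?_⟩
    rw [hc0, e0]
    simp
  · exact mul_le_mul_of_nonneg_right hc (by positivity)
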